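/- Let $N\ge 1$. For an open set $\Omega\subset\mathbb R^N$ (possibly unbounded, disconnected, or of infinite measure) let $H^1_0(\Omega)$ be the closure of $C_c^\infty(\Omega)$ in $H^1(\mathbb R^N)$, and let $P(\Omega)=\int_\Omega u\,dx\in[0,\infty]$ be its torsional rigidity, where $u\in H^1_0(\Omega)$ solves $-\Delta u=1$ in $\mathcal D'(\Omega)$; $P(\Omega)=+\infty$ if there is no such $u$. For $R>0$ let $w_{\Omega\cap B_R}\in H^1_0(\Omega\cap B_R)$ be the weak solution of $-\Delta w+w=1$ in $\Omega\cap B_R$, extended by zero, and let $w_\Omega=\lim_{R\to+\infty}w_{\Omega\cap B_R}$ a.e. Let $\mathcal R_\Omega:L^2(\mathbb R^N)\to L^2(\mathbb R^N)$ map $f$ to the weak solution $u\in H^1_0(\Omega)$ of $-\Delta u+u=f$. (i) Suppose that $P(\Omega)<+\infty$. Then $w_\Omega\in L^1(\mathbb R^N)$; the space $H^1_0(\Omega)$ is compactly embedded in $L^1(\mathbb R^N)$ and in $L^2(\mathbb R^N)$; the operator $\mathcal R_\Omega$ is compact; the Dirichlet Laplacian $-\Delta$ on $L^2(\Omega)$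 has compact resolvent; and its spectrum is discrete, that is, it consists of eigenvalues of finite multiplicity and has no finite accumulation point. If moreover $\Omega\neq\emptyset$, then the spectrum is $\{\lambda_k(\Omega):k\ge1\}$, where $0<\lambda_1(\Omega)\le\lambda_2(\Omega)\le\dots\to+\infty$ are the eigenvalues counted with multiplicity, and $L^2(\Omega)$ has an orthonormal basis $(e_k)_{k\ge 1}$ with $-\Delta e_k=\lambda_k(\Omega)e_k$, $e_k\in H^1_0(\Omega)$. (ii) Consequently, for all $k\ge1$ and $c>0$ the problem $\min\{\lambda_k(\Omega):\Omega\subset\mathbb R^N\text{ open},\ P(\Omega)=c\}$ is well posed, in the sense that the class of admissible sets is not empty and that for every admissible $\Omega$ the $k$-th eigenvalue $\lambda_k(\Omega)$ exists and is a positive real number: it is the least $t\in\mathbb R$ such that at least $k$ eigenvalues of the Dirichlet Laplacian, counted with multiplicity, are $\le t$. -/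

import Mathlib

open MeasureTheory Filter Topology TopologicalSpace Set
open scoped ENNReal InnerProductSpace Gradient Distributions ContDiff

noncomputable section

/-- The space `ℝ^N`. -/
abbrev RN (N : ℕ) : Type := EuclideanSpace ℝ (Fin N)

/-- `L²(ℝ^N)`. -/
abbrev L2 (N : ℕ) : Type := Lp ℝ 2 (volume : Measure (RN N))

/-- `L²(ℝ^N; ℝ^N)`. -/
abbrev L2Vec (N : ℕ) : Type := Lp (RN N) 2 (volume : Measure (RN N))

/-- Pairs `(u, g)` with `u ∈ L²(ℝ^N)`, `g ∈ L²(ℝ^N; ℝ^N)`, and norm `(‖u‖² + ‖g‖²)^{1/2}`. With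
`g = ∇u` this is the `H¹` norm of `u`. -/
abbrev L2Pair (N : ℕ) : Type := WithLp 2 (L2 N × L2Vec N)

/-- `g` is the weak gradient of `u` on `ℝ^N`. -/
def IsWeakGradient {N : ℕ} (u : L2 N) (g : L2Vec N) : Prop :=
  ∀ φ : 𝓓((⊤ : Opens (RN N)), ℝ), ∀ v : RN N,
    ∫ x, u x * ⟪∇ φ x, v⟫_ℝ = -∫ x, ⟪g x, v⟫_ℝ * φ x

/-- The pairs `(φ, ∇φ)` for `φ ∈ C_c^∞(Ω)`. -/
def testPairs {N : ℕ} (Ω : Opens (RN N)) : Submodule ℝ (L2Pair N) where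
  carrier := {U | ∃ φ : 𝓓(Ω, ℝ), U.fst =ᵐ[volume] φ ∧ U.snd =ᵐ[volume] ∇ φ}
  zero_mem' := by
    refine ⟨0, ?_, ?_⟩
    · filter_upwards [Lp.coeFn_zero ℝ 2 (volume : Measure (RN N))] with x hx
      simp
    · filter_upwards [Lp.coeFn_zero (RN N) 2 (volume : Measure (RN N))] with x hx
      have h0 : ((0 : 𝓓(Ω, ℝ)) : RN N → ℝ) = fun _ => 0 := by ext; simp
      rw [h0]
      simp [gradient_fun_const]
  add_mem' := by
    rintro U V ⟨φ, h1, h2⟩ ⟨ψ, h3, h4⟩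
    refine ⟨φ + ψ, ?_, ?_⟩
    · filter_upwards [h1, h3, Lp.coeFn_add U.fst V.fst] with x a b c
      simpa [a, b] using c
    · filter_upwards [h2, h4, Lp.coeFn_add U.snd V.snd] with x a b c
      have hφ : DifferentiableAt ℝ φ x := (φ.contDiff.differentiable (by simp)) x
      have hψ : DifferentiableAt ℝ ψ x := (ψ.contDiff.differentiable (by simp)) x
      have h0 : ((φ + ψ : 𝓓(Ω, ℝ)) : RN N → ℝ) = (φ : RN N → ℝ) + ψ := by ext; simp
      rw [h0, gradient, fderiv_add hφ hψ, map_add]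
      simpa [a, b, gradient] using c
  smul_mem' := by
    rintro r U ⟨φ, h1, h2⟩
    refine ⟨r • φ, ?_, ?_⟩
    · filter_upwards [h1, Lp.coeFn_smul r U.fst] with x a c
      simpa [a] using c
    · filter_upwards [h2, Lp.coeFn_smul r U.snd] with x a c
      have hφ : DifferentiableAt ℝ φ x := (φ.contDiff.differentiable (by simp)) x
      have h0 : ((r • φ : 𝓓(Ω, ℝ)) : RN N → ℝ) = r • (φ : RN N → ℝ) := by ext; simp
      rw [h0, gradient, fderiv_const_smul hφ]
      simpa [a, gradient] using c

/-- `H¹₀(Ω)`: the closure of `C_c^∞(Ω)` in `H¹(ℝ^N)`. An element is recorded as the pair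
`U = (u, ∇u)`, so `U.fst` is the function (zero a.e. outside `Ω`) and `U.snd` is its weak
gradient. -/
def H10 {N : ℕ} (Ω : Opens (RN N)) : Submodule ℝ (L2Pair N) :=
  (testPairs Ω).topologicalClosure

instance {N : ℕ} (Ω : Opens (RN N)) : CompleteSpace (H10 Ω) :=
  (Submodule.isClosed_topologicalClosure _).completeSpace_coe

/-- The inclusion `H¹₀(Ω) → L²(ℝ^N)`, `u ↦ u`. -/
def H10.toL2 {N : ℕ} (Ω : Opens (RN N)) : H10 Ω →L[ℝ] L2 N :=
  (WithLp.fstL 2 ℝ (L2 N) (L2Vec N)).comp (H10 Ω).subtypeL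

theorem testFunction_memLp {N : ℕ} {Ω : Opens (RN N)} (φ : 𝓓(Ω, ℝ)) :
    MemLp φ 2 (volume : Measure (RN N)) :=
  φ.continuous.memLp_of_hasCompactSupport φ.hasCompactSupport

theorem testFunction_continuous_gradient {N : ℕ} {Ω : Opens (RN N)} (φ : 𝓓(Ω, ℝ)) :
    Continuous (∇ (φ : RN N → ℝ)) :=
  (InnerProductSpace.toDual ℝ (RN N)).symm.continuous.comp
    (φ.contDiff.continuous_fderiv (by simp))

theorem testFunction_hasCompactSupport_gradient {N : ℕ} {Ω : Opens (RN N)} (φ : 𝓓(Ω, ℝ)) :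
    HasCompactSupport (∇ (φ : RN N → ℝ)) :=
  (φ.hasCompactSupport.fderiv ℝ).comp_left (map_zero _)

theorem testFunction_memLp_gradient {N : ℕ} {Ω : Opens (RN N)} (φ : 𝓓(Ω, ℝ)) :
    MemLp (∇ (φ : RN N → ℝ)) 2 (volume : Measure (RN N)) :=
  (testFunction_continuous_gradient φ).memLp_of_hasCompactSupport
    (testFunction_hasCompactSupport_gradient φ)

/-- Every test function belongs to `H¹₀(Ω)`. -/
theorem testFunction_mem_H10 {N : ℕ} {Ω : Opens (RN N)} (φ : 𝓓(Ω, ℝ)) :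
    WithLp.toLp 2 ((testFunction_memLp φ).toLp φ, (testFunction_memLp_gradient φ).toLp _)
      ∈ H10 Ω :=
  Submodule.le_topologicalClosure _
    ⟨φ, (testFunction_memLp φ).coeFn_toLp, (testFunction_memLp_gradient φ).coeFn_toLp⟩

theorem integral_testFunction_gradient {N : ℕ} {Ω Ω' : Opens (RN N)} (φ : 𝓓(Ω, ℝ))
    (ψ : 𝓓(Ω', ℝ)) (v : RN N) :
    ∫ x, φ x * ⟪∇ ψ x, v⟫_ℝ = -∫ x, ⟪∇ φ x, v⟫_ℝ * ψ x := by
  have hg : ∀ {Ω : Opens (RN N)} (χ : 𝓓(Ω, ℝ)) x,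
      ⟪∇ (χ : RN N → ℝ) x, v⟫_ℝ = fderiv ℝ χ x v := by
    intro Ω χ x
    rw [gradient, InnerProductSpace.toDual_symm_apply]
  have hd : ∀ {Ω : Opens (RN N)} (χ : 𝓓(Ω, ℝ)), Continuous fun x => fderiv ℝ χ x v :=
    fun χ => (χ.contDiff.continuous_fderiv (by simp)).clm_apply continuous_const
  simp only [hg]
  refine integral_mul_fderiv_eq_neg_fderiv_mul_of_integrable ?_ ?_ ?_
    (fun x _ => (φ.contDiff.differentiable (by simp)) x)
    (fun x _ => (ψ.contDiff.differentiable (by simp)) x)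
  · exact ((hd φ).mul ψ.continuous).integrable_of_hasCompactSupport ψ.hasCompactSupport.mul_left
  · exact (φ.continuous.mul (hd ψ)).integrable_of_hasCompactSupport φ.hasCompactSupport.mul_right
  · exact (φ.continuous.mul ψ.continuous).integrable_of_hasCompactSupport
      φ.hasCompactSupport.mul_right

/-- The second component of an element of `H¹₀(Ω)` is the weak gradient of the first one. -/
theorem H10.isWeakGradient {N : ℕ} {Ω : Opens (RN N)} {U : L2Pair N} (hU : U ∈ H10 Ω) :
    IsWeakGradient U.fst U.snd := by
  intro φ v
  have hm1 : MemLp (fun x => ⟪∇ (φ : RN N → ℝ) x, v⟫_ℝ) 2 (volume : Measure (RN N)) :=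
    ((testFunction_continuous_gradient φ).inner continuous_const).memLp_of_hasCompactSupport
      ((testFunction_hasCompactSupport_gradient φ).comp_left
        (g := fun y => ⟪y, v⟫_ℝ) (inner_zero_left v))
  have hm2 : MemLp (fun x => φ x • v) 2 (volume : Measure (RN N)) :=
    (φ.continuous.smul continuous_const).memLp_of_hasCompactSupport
      φ.hasCompactSupport.smul_right
  have e1 : ∀ W : L2Pair N, ∫ x, W.fst x * ⟪∇ (φ : RN N → ℝ) x, v⟫_ℝ = ⟪W.fst, hm1.toLp _⟫_ℝ := by
    intro W
    rw [L2.inner_def]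
    refine integral_congr_ae ?_
    filter_upwards [hm1.coeFn_toLp] with x hx
    rw [hx]
    exact mul_comm _ _
  have e2 : ∀ W : L2Pair N, ∫ x, ⟪W.snd x, v⟫_ℝ * φ x = ⟪W.snd, hm2.toLp _⟫_ℝ := by
    intro W
    rw [L2.inner_def]
    refine integral_congr_ae ?_
    filter_upwards [hm2.coeFn_toLp] with x hx
    rw [hx, inner_smul_right, mul_comm]
  rw [e1, e2]
  have hc : IsClosed {W : L2Pair N | ⟪W.fst, hm1.toLp _⟫_ℝ = -⟪W.snd, hm2.toLp _⟫_ℝ} := by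
    have c1 : Continuous fun W : L2Pair N => W.fst := (WithLp.fstL 2 ℝ (L2 N) (L2Vec N)).continuous
    have c2 : Continuous fun W : L2Pair N => W.snd := (WithLp.sndL 2 ℝ (L2 N) (L2Vec N)).continuous
    exact isClosed_eq (c1.inner continuous_const) (c2.inner continuous_const).neg
  refine closure_minimal (s := (testPairs Ω : Set (L2Pair N))) ?_ hc hU
  rintro W ⟨ψ, h1, h2⟩
  change ⟪W.fst, hm1.toLp _⟫_ℝ = -⟪W.snd, hm2.toLp _⟫_ℝ
  rw [← e1, ← e2, integral_congr_ae (g := fun x => ψ x * ⟪∇ (φ : RN N → ℝ) x, v⟫_ℝ)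
      (h1.mono fun x hx => by simp only [hx]),
    integral_congr_ae (f := fun x => ⟪W.snd x, v⟫_ℝ * φ x) (g := fun x => ⟪∇ (ψ : RN N → ℝ) x, v⟫_ℝ * φ x)
      (h2.mono fun x hx => by simp only [hx])]
  exact integral_testFunction_gradient ψ φ v

/-- The torsion function of `Ω`: `u ∈ H¹₀(Ω)` and `-Δu = 1` in `𝒟'(Ω)`. -/
def IsTorsionFunction {N : ℕ} (Ω : Opens (RN N)) (U : L2Pair N) : Prop :=
  U ∈ H10 Ω ∧ ∀ φ : 𝓓(Ω, ℝ), ∫ x, ⟪U.snd x, ∇ φ x⟫_ℝ = ∫ x, φ x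

/-- The torsional rigidity `P(Ω) = ∫_Ω u dx ∈ [0, ∞]`, where `u` is the torsion function of `Ω`
(unique if it exists, and nonnegative); `P(Ω) = ∞` if there is no torsion function. -/
def torsionalRigidity {N : ℕ} (Ω : Opens (RN N)) : ℝ≥0∞ :=
  ⨅ (U : L2Pair N) (_ : IsTorsionFunction Ω U), ∫⁻ x in (Ω : Set (RN N)), ENNReal.ofReal (U.fst x)

/-- The resolvent operator `𝓡_Ω : L²(ℝ^N) → L²(ℝ^N)`, `f ↦ u`, where `u ∈ H¹₀(Ω)` is the weak
solution of `-Δu + u = f`, see `resolventOp_eq_iff`. -/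
def resolventOp {N : ℕ} (Ω : Opens (RN N)) : L2 N →L[ℝ] L2 N :=
  (H10.toL2 Ω).comp (ContinuousLinearMap.adjoint (H10.toL2 Ω))

theorem resolventOp_eq_iff {N : ℕ} (Ω : Opens (RN N)) (f u : L2 N) :
    resolventOp Ω f = u ↔ ∃ U ∈ H10 Ω, U.fst = u ∧
      ∀ V ∈ H10 Ω, ⟪U.snd, V.snd⟫_ℝ + ⟪U.fst, V.fst⟫_ℝ = ⟪f, V.fst⟫_ℝ := by
  constructor
  · rintro rfl
    refine ⟨ContinuousLinearMap.adjoint (H10.toL2 Ω) f, Subtype.coe_prop _, rfl, fun V hV => ?_⟩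
    have h := ContinuousLinearMap.adjoint_inner_left (H10.toL2 Ω) ⟨V, hV⟩ f
    rw [Submodule.coe_inner, WithLp.prod_inner_apply] at h
    rw [add_comm]
    exact h
  · rintro ⟨U, hU, rfl, h⟩
    have : ContinuousLinearMap.adjoint (H10.toL2 Ω) f = ⟨U, hU⟩ := by
      refine ext_inner_right ℝ fun V => ?_
      rw [ContinuousLinearMap.adjoint_inner_left, Submodule.coe_inner, WithLp.prod_inner_apply]
      have := h V.1 V.2
      rw [add_comm] at this
      exact this.symm
    change H10.toL2 Ω (ContinuousLinearMap.adjoint (H10.toL2 Ω) f) = _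
    rw [this]
    rfl

/-- The bounded open set `Ω ∩ B_R`. -/
def truncation {N : ℕ} (Ω : Opens (RN N)) (R : ℝ) : Opens (RN N) :=
  Ω ⊓ ⟨Metric.ball 0 R, Metric.isOpen_ball⟩

theorem volume_truncation_ne_top {N : ℕ} (Ω : Opens (RN N)) (R : ℝ) :
    volume (truncation Ω R : Set (RN N)) ≠ ⊤ :=
  ((measure_mono inter_subset_right).trans_lt
    (measure_ball_lt_top (x := (0 : RN N)) (r := R))).ne

/-- `w_{Ω ∩ B_R} = 𝓡_{Ω ∩ B_R}(1)`, the weak solution in `H¹₀(Ω ∩ B_R)` of `-Δw + w = 1`. (On the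
bounded set `Ω ∩ B_R` the right-hand side may be replaced by the indicator of this set.) -/
def wTrunc {N : ℕ} (Ω : Opens (RN N)) (R : ℝ) : L2 N :=
  resolventOp (truncation Ω R)
    (indicatorConstLp 2 (truncation Ω R).isOpen.measurableSet (volume_truncation_ne_top Ω R)
      (1 : ℝ))

/-- `w = w_Ω`, the a.e. limit of `w_{Ω ∩ B_R}` as `R → +∞`. -/
def IsWLimit {N : ℕ} (Ω : Opens (RN N)) (w : RN N → ℝ) : Prop :=
  ∀ R : ℕ → ℝ, Tendsto R atTop atTop →
    ∀ᵐ x, Tendsto (fun j => wTrunc Ω (R j) x) atTop (𝓝 (w x))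

/-- `H¹₀(Ω)` is contained in `L^q(ℝ^N)` and the inclusion is a (continuous) compact operator. -/
def CompactlyEmbedded {N : ℕ} (Ω : Opens (RN N)) (q : ℝ≥0∞) [Fact (1 ≤ q)] : Prop :=
  ∃ J : H10 Ω →L[ℝ] Lp ℝ q (volume : Measure (RN N)),
    (∀ U : H10 Ω, J U =ᵐ[volume] U.1.fst) ∧ IsCompactOperator J

/-- `L²(Ω)`, as the subspace of the functions in `L²(ℝ^N)` that vanish a.e. outside `Ω`. -/
def L2On {N : ℕ} (Ω : Opens (RN N)) : Submodule ℝ (L2 N) where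
  carrier := {f | ∀ᵐ x, x ∉ Ω → f x = 0}
  zero_mem' := by
    filter_upwards [Lp.coeFn_zero ℝ 2 (volume : Measure (RN N))] with x hx _
    simp
  add_mem' := by
    intro f g hf hg
    filter_upwards [hf, hg, Lp.coeFn_add f g] with x a b c hx
    exact c.trans (by simp [a hx, b hx])
  smul_mem' := by
    intro r f hf
    filter_upwards [hf, Lp.coeFn_smul r f] with x a c hx
    exact c.trans (by simp [a hx])

theorem L2On_isClosed {N : ℕ} (Ω : Opens (RN N)) : IsClosed (L2On Ω : Set (L2 N)) := by
  have : (L2On Ω : Set (L2 N)) =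
      (LpToLpRestrictCLM (RN N) ℝ ℝ volume 2 (Ω : Set (RN N))ᶜ) ⁻¹' {0} := by
    ext f
    have h := LpToLpRestrictCLM_coeFn (p := 2) (μ := (volume : Measure (RN N))) ℝ
      (Ω : Set (RN N))ᶜ f
    rw [mem_preimage, mem_singleton_iff, Lp.eq_zero_iff_ae_eq_zero]
    change (∀ᵐ x, x ∈ (Ω : Set (RN N))ᶜ → f x = 0) ↔ _
    rw [← ae_restrict_iff' Ω.isOpen.measurableSet.compl]
    constructor
    · intro hf
      filter_upwards [h, hf] with x a b
      simp [a, b]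
    · intro hf
      filter_upwards [h, hf] with x a b
      rw [← a, b]; rfl
  rw [this]
  exact isClosed_singleton.preimage (ContinuousLinearMap.continuous _)

instance {N : ℕ} (Ω : Opens (RN N)) : CompleteSpace (L2On Ω) :=
  (L2On_isClosed Ω).completeSpace_coe

/-- Elements of `H¹₀(Ω)` vanish a.e. outside `Ω`. -/
theorem H10.fst_mem_L2On {N : ℕ} {Ω : Opens (RN N)} {U : L2Pair N} (hU : U ∈ H10 Ω) :
    U.fst ∈ L2On Ω := by
  have hc : IsClosed {W : L2Pair N | W.fst ∈ L2On Ω} :=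
    (L2On_isClosed Ω).preimage (WithLp.fstL 2 ℝ (L2 N) (L2Vec N)).continuous
  refine closure_minimal (s := (testPairs Ω : Set (L2Pair N))) ?_ hc hU
  rintro W ⟨ψ, h1, -⟩
  change ∀ᵐ x, x ∉ Ω → W.fst x = 0
  filter_upwards [h1] with x hx hxΩ
  rw [hx]
  exact image_eq_zero_of_notMem_tsupport fun h => hxΩ (ψ.tsupport_subset h)

/-- The pairs `(u, f)` with `u ∈ H¹₀(Ω)`, `f ∈ L²(Ω)` and `-Δu = f` weakly. -/
def laplacianPairs {N : ℕ} (Ω : Opens (RN N)) : Submodule ℝ (L2On Ω × L2On Ω) where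
  carrier := {p | ∃ U ∈ H10 Ω, U.fst = p.1 ∧
    ∀ V ∈ H10 Ω, ⟪U.snd, V.snd⟫_ℝ = ⟪(p.2 : L2 N), V.fst⟫_ℝ}
  zero_mem' := ⟨0, Submodule.zero_mem _, rfl, by simp⟩
  add_mem' := by
    rintro p q ⟨U, hU, hU1, hU2⟩ ⟨W, hW, hW1, hW2⟩
    refine ⟨U + W, Submodule.add_mem _ hU hW, by simp [hU1, hW1], fun V hV => ?_⟩
    simp [inner_add_left, hU2 V hV, hW2 V hV]
  smul_mem' := by
    rintro r p ⟨U, hU, hU1, hU2⟩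
    refine ⟨r • U, Submodule.smul_mem _ _ hU, by simp [hU1], fun V hV => ?_⟩
    simp [inner_smul_left, hU2 V hV]

/-- The Dirichlet Laplacian `-Δ` on `L²(Ω)`, as an unbounded operator: `u` is in its domain iff
`u ∈ H¹₀(Ω)` and `-Δu = f` weakly for some `f ∈ L²(Ω)`, and then it maps `u` to `f`; see
`dirichletLaplacian_graph`. -/
def dirichletLaplacian {N : ℕ} (Ω : Opens (RN N)) : L2On Ω →ₗ.[ℝ] L2On Ω :=
  (laplacianPairs Ω).toLinearPMap

theorem dirichletLaplacian_graph {N : ℕ} (Ω : Opens (RN N)) :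
    (dirichletLaplacian Ω).graph = laplacianPairs Ω := by
  refine Submodule.toLinearPMap_graph_eq _ ?_
  rintro ⟨u, f⟩ ⟨U, hU, hU1, hU2⟩ (rfl : u = 0)
  have hfst : U.fst = 0 := by simpa using hU1
  have hg : U.snd = 0 := by
    have hw := H10.isWeakGradient hU
    have key : ∀ v : RN N, ∀ᵐ x, ⟪U.snd x, v⟫_ℝ = 0 := by
      intro v
      have hmem : MemLp (fun x => ⟪U.snd x, v⟫_ℝ) 2 (volume : Measure (RN N)) :=
        (Lp.memLp U.snd).inner_const v
      refine ae_eq_zero_of_integral_contDiff_smul_eq_zero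
        (hmem.locallyIntegrable (by norm_num)) ?_
      intro g hg1 hg2
      have h := hw ⟨g, hg1, hg2, subset_univ _⟩ v
      rw [hfst] at h
      have h0 : ∫ x, (0 : L2 N) x * ⟪∇ g x, v⟫_ℝ = 0 := by
        rw [integral_congr_ae (g := fun _ => (0 : ℝ)), integral_zero]
        filter_upwards [Lp.coeFn_zero ℝ 2 (volume : Measure (RN N))] with x hx
        simp
      have h' : ∫ x, (0 : L2 N) x * ⟪∇ g x, v⟫_ℝ = -∫ x, ⟪U.snd x, v⟫_ℝ * g x := h
      rw [h0] at h'
      simp only [smul_eq_mul, mul_comm (g _)]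
      linarith
    rw [Lp.eq_zero_iff_ae_eq_zero]
    have : ∀ᵐ x, ∀ i : Fin N, ⟪U.snd x, EuclideanSpace.single i (1 : ℝ)⟫_ℝ = 0 :=
      ae_all_iff.2 fun i => key _
    filter_upwards [this] with x hx
    ext i
    simpa [EuclideanSpace.inner_single_right] using hx i
  have hf : ∀ᵐ x, x ∈ (Ω : Set (RN N)) → (f : L2 N) x = 0 := by
    refine Ω.isOpen.ae_eq_zero_of_integral_contDiff_smul_eq_zero
      (((Lp.memLp (f : L2 N)).locallyIntegrable (by norm_num)).locallyIntegrableOn _) ?_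
    intro g hg1 hg2 hg3
    let φ : 𝓓(Ω, ℝ) := ⟨g, hg1, hg2, hg3⟩
    have h := hU2 _ (testFunction_mem_H10 φ)
    rw [hg, inner_zero_left, L2.inner_def] at h
    rw [h]
    refine integral_congr_ae ?_
    filter_upwards [(testFunction_memLp φ).coeFn_toLp] with x hx
    change g x • (f : L2 N) x = ⟪(f : L2 N) x, (testFunction_memLp φ).toLp φ x⟫_ℝ
    rw [hx]
    simp [φ]
  have : (f : L2 N) = 0 := by
    rw [Lp.eq_zero_iff_ae_eq_zero]
    filter_upwards [hf, f.2] with x a b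
    by_cases hx : x ∈ Ω
    · exact a hx
    · exact b hx
  exact Subtype.ext this

section Spectral

variable {H : Type*} [NormedAddCommGroup H] [InnerProductSpace ℝ H]

/-- The bounded operator `B` is `(A - z)⁻¹`. -/
def IsResolventAt (A : H →ₗ.[ℝ] H) (z : ℝ) (B : H →L[ℝ] H) : Prop :=
  (∀ f : H, ∃ h : B f ∈ A.domain, A ⟨B f, h⟩ - z • B f = f) ∧
    ∀ u : A.domain, B (A u - z • (u : H)) = u

/-- The spectrum of the (unbounded) operator `A`: the `z` for which `A - z` has no bounded
inverse. -/
def opSpectrum (A : H →ₗ.[ℝ] H) : Set ℝ :=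
  {z | ¬∃ B : H →L[ℝ] H, IsResolventAt A z B}

/-- `A` has compact resolvent: its resolvent set is not empty and all its resolvents are compact
operators. -/
def HasCompactResolvent (A : H →ₗ.[ℝ] H) : Prop :=
  (∃ z B, IsResolventAt A z B) ∧ ∀ z B, IsResolventAt A z B → IsCompactOperator B

/-- The space of the `u` in the domain of `A` with `A u = z u`. -/
def opEigenspace (A : H →ₗ.[ℝ] H) (z : ℝ) : Submodule ℝ H :=
  A.graph.comap (LinearMap.prod LinearMap.id (z • LinearMap.id))

theorem mem_opEigenspace (A : H →ₗ.[ℝ] H) (z : ℝ) (u : H) :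
    u ∈ opEigenspace A z ↔ ∃ h : u ∈ A.domain, A ⟨u, h⟩ = z • u := by
  simp [opEigenspace, LinearPMap.mem_graph_iff]

/-- The spectrum is discrete: it consists of eigenvalues of finite multiplicity and has no
accumulation point in `ℝ`. -/
def HasDiscreteSpectrum (A : H →ₗ.[ℝ] H) : Prop :=
  (∀ z ∈ opSpectrum A, opEigenspace A z ≠ ⊥ ∧ FiniteDimensional ℝ (opEigenspace A z)) ∧
    ∀ a b : ℝ, (opSpectrum A ∩ Icc a b).Finite

/-- The number of eigenvalues `≤ t`, counted with multiplicity. -/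
def eigenvalueCount (A : H →ₗ.[ℝ] H) (t : ℝ) : Cardinal :=
  Module.rank ℝ (⨆ s : Iic t, opEigenspace A s : Submodule ℝ H)

/-- The values `t` such that at least `k` eigenvalues, counted with multiplicity, are `≤ t`. -/
def eigenvalueBounds (A : H →ₗ.[ℝ] H) (k : ℕ) : Set ℝ :=
  {t | (k : Cardinal) ≤ eigenvalueCount A t}

end Spectral

/-- `λ_k(Ω)`, `k ≥ 1`: the `k`-th eigenvalue of the Dirichlet Laplacian, counted with
multiplicity. -/
def dirichletEigenvalue {N : ℕ} (k : ℕ) (Ω : Opens (RN N)) : ℝ :=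
  sInf (eigenvalueBounds (dirichletLaplacian Ω) k)

end

/-! Everything rests on a Hardy inequality for the torsion function `u`. Testing `-Δu = 1` with
`v²/u` and completing the square gives `∫ v²/u = ∫ (2 (v/u) ∇u·∇v - (v²/u²) |∇u|²) ≤ ∫ |∇v|²` for `v
∈ H¹₀(Ω)` (`IsTorsionFunction.lintegral_sq_div_le`). The test function is made admissible by a
smooth regularisation, using a chain rule for `K(v, u)` in `H¹₀` (`IsChainFunction.exists_mem_H10`).

If `P(Ω) < ∞`, then `u` is integrable and the inequality replaces boundedness of `Ω`. On `{u < δ}`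
it gives `∫ v² ≤ δ ‖∇v‖²`, while `{u ≥ δ}` has finite measure by Markov's inequality, so that
Rellich's argument applies there. Hence weakly null bounded sequences in `H¹₀(Ω)` tend to `0` in
`L²`. Cauchy–Schwarz gives `∫_s |v| ≤ ‖∇v‖ (∫_s u)^{1/2}`, which adds the `L¹` statement. The same
bound shows `∫ w_{Ω ∩ B_R} ≤ P(Ω)`; these functions increase with `R`, so monotone convergence
yields `w_Ω ∈ L¹`.

The resolvent `B = (-Δ + 1)⁻¹` on `L²(Ω)` is therefore compact, symmetric and injective. The
spectral theorem and the Fredholm alternative, transported by `μ = (λ + 1)⁻¹`, give the eigenbasis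
and the discrete spectrum (`IsShiftInverse.exists_eigenvalue_sequence`). Eigenvalues are positive
because, by the Hardy inequality, a zero gradient forces `v = 0`. There are infinitely many, counted
with multiplicity, since `L²(Ω)` is infinite-dimensional for nonempty `Ω`.

For (ii), the torsion function of a ball is an explicit paraboloid and `P(B_R) = R^{N+2} P(B_1)`, so
every `c > 0` is attained; and `P(Ω) = c > 0` forces `Ω ≠ ∅`. -/

open MeasureTheory Filter Topology TopologicalSpace Set
open scoped ENNReal InnerProductSpace Gradient Distributions ContDiff

noncomputable section

/-! ### Increasing enumeration of a family with finite sublevel sets -/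

section Enumeration

/-- A real-valued family on an infinite type with finite sublevel sets can be enumerated in
increasing order. -/
theorem exists_equiv_nat_monotone {ι : Type*} [Infinite ι] (f : ι → ℝ)
    (h : ∀ t, {i | f i ≤ t}.Finite) : ∃ σ : ℕ ≃ ι, Monotone (f ∘ σ) := by
  have hc : Countable ι := by
    rw [← Set.countable_univ_iff]
    have : (univ : Set ι) = ⋃ n : ℕ, {i | f i ≤ n} := by
      ext i
      simpa using exists_nat_ge (f i)
    rw [this]
    exact countable_iUnion fun n => (h n).countable
  obtain ⟨g, hg⟩ := exists_injective_nat ι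
  -- Ties between equal values are broken by `g`. In the resulting linear order initial segments lie
  -- in sublevel sets, hence are finite; with a least and no greatest element it is isomorphic to
  -- `ℕ`.
  let F : ι → ℝ ×ₗ ℕ := fun i => toLex (f i, g i)
  have hF : Function.Injective F := fun i j hij => hg (congrArg (fun p => (ofLex p).2) hij)
  let : LinearOrder ι := LinearOrder.lift' F hF
  have hle : ∀ {i j : ι}, i ≤ j → f i ≤ f j := by
    intro i j hij
    have : F i ≤ F j := hij
    rw [Prod.Lex.toLex_le_toLex] at this
    rcases this with h1 | h1
    · exact h1.le
    · exact h1.1.le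
  have hfin : ∀ i : ι, (Iic i).Finite := fun i => (h (f i)).subset fun j hj => hle hj
  let : LocallyFiniteOrder ι :=
    LocallyFiniteOrder.ofFiniteIcc fun a b => (hfin b).subset fun x hx => hx.2
  let : OrderBot ι := by
    let i₀ : ι := Classical.arbitrary ι
    have hm := (hfin i₀).exists_minimalFor id _ ⟨i₀, le_refl i₀⟩
    refine { bot := hm.choose, bot_le := fun a => ?_ }
    have hs := hm.choose_spec
    rcases le_total a i₀ with ha | ha
    · rcases le_total hm.choose a with hb | hb
      · exact hb
      · exact hs.2 ha hb
    · exact le_trans hs.1 ha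
  have : NoMaxOrder ι := by
    refine ⟨fun a => ?_⟩
    by_contra! hcon
    exact Set.infinite_univ ((hfin a).subset fun x _ => hcon x)
  let : SuccOrder ι := LinearLocallyFiniteOrder.succOrder ι
  let : PredOrder ι := LinearLocallyFiniteOrder.predOrder ι
  let e : ι ≃o ℕ := orderIsoNatOfLinearSuccPredArch
  exact ⟨e.symm.toEquiv, fun a b hab => hle (e.symm.monotone hab)⟩

end Enumeration

/-! ### Spectral theory of an unbounded operator with compact symmetric resolvent -/

section CompactResolvent

variable {H : Type*} [NormedAddCommGroup H] [InnerProductSpace ℝ H]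
  {A : H →ₗ.[ℝ] H} {B : H →L[ℝ] H}

theorem mem_opEigenspace_iff_graph {z : ℝ} {u : H} :
    u ∈ opEigenspace A z ↔ (u, z • u) ∈ A.graph := by
  simp [opEigenspace]

theorem isResolventAt_iff_graph {z : ℝ} {C : H →L[ℝ] H} :
    IsResolventAt A z C ↔
      (∀ f, (C f, f + z • C f) ∈ A.graph) ∧ ∀ u f, (u, f) ∈ A.graph → C (f - z • u) = u := by
  constructor
  · rintro ⟨h1, h2⟩
    refine ⟨fun f => ?_, fun u f h => ?_⟩
    · obtain ⟨h, e⟩ := h1 f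
      rw [LinearPMap.mem_graph_iff]
      exact ⟨⟨C f, h⟩, rfl, by rw [← sub_eq_iff_eq_add, e]⟩
    · rw [LinearPMap.mem_graph_iff] at h
      obtain ⟨y, rfl, rfl⟩ := h
      exact h2 y
  · rintro ⟨h1, h2⟩
    refine ⟨fun f => ?_, fun u => h2 _ _ (A.mem_graph u)⟩
    have := h1 f
    rw [LinearPMap.mem_graph_iff] at this
    obtain ⟨y, hy, e⟩ := this
    simp only at hy e
    refine ⟨hy ▸ y.2, ?_⟩
    have : (⟨C f, hy ▸ y.2⟩ : A.domain) = y := Subtype.ext hy.symm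
    rw [this, e]
    abel

/-- The bounded operator `B` is `(A + 1)⁻¹`, in terms of the graph of `A`. -/
def IsShiftInverse (A : H →ₗ.[ℝ] H) (B : H →L[ℝ] H) : Prop :=
  ∀ u f, (u, f) ∈ A.graph ↔ B (f + u) = u

namespace IsShiftInverse

theorem mem_opEigenspace_iff (hg : IsShiftInverse A B) {z : ℝ} {u : H} :
    u ∈ opEigenspace A z ↔ (z + 1) • B u = u := by
  rw [mem_opEigenspace_iff_graph, hg, ← map_smul, add_smul, one_smul]

/-- An element `f` of the kernel puts `(0, f)` on the graph of the linear map `A`. Injectivity is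
what removes the eigenvalue `0` of `B` from the spectral decomposition. -/
theorem eq_zero_of_apply_eq_zero (hg : IsShiftInverse A B) {f : H} (h : B f = 0) : f = 0 := by
  have : ((0 : H), f) ∈ A.graph := by rw [hg, add_zero, h]
  rw [LinearPMap.mem_graph_iff] at this
  obtain ⟨y, hy, e⟩ := this
  have : y = 0 := Subtype.ext hy
  simp only at e
  rw [← e, this, LinearPMap.map_zero]

theorem isResolventAt (hg : IsShiftInverse A B) : IsResolventAt A (-1) B := by
  rw [isResolventAt_iff_graph]
  refine ⟨fun f => ?_, fun u f h => ?_⟩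
  · rw [hg]; congr 1; simp
  · rw [hg] at h
    simpa using h

/-- Resolvent identity: any resolvent `C` at `z` equals `B ∘ (1 + (z + 1) C)`, and a compact
operator composed with a bounded one is compact. -/
theorem hasCompactResolvent (hg : IsShiftInverse A B) (hB : IsCompactOperator B) :
    HasCompactResolvent A := by
  refine ⟨⟨-1, B, hg.isResolventAt⟩, fun z C hC => ?_⟩
  rw [isResolventAt_iff_graph] at hC
  have : C = B ∘L (ContinuousLinearMap.id ℝ H + (z + 1) • C) := by
    ext f
    have := (hg _ _).1 (hC.1 f)
    conv_lhs => rw [← this]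
    simp [add_smul, add_assoc]
  rw [this]
  exact hB.comp_clm _

theorem opEigenspace_neg_one (hg : IsShiftInverse A B) : opEigenspace A (-1) = ⊥ := by
  rw [eq_bot_iff]
  intro u hu
  rw [hg.mem_opEigenspace_iff] at hu
  simpa using hu.symm

theorem opEigenspace_eq (hg : IsShiftInverse A B) {z : ℝ} (hz : z + 1 ≠ 0) :
    opEigenspace A z = Module.End.eigenspace (B : Module.End ℝ H) (z + 1)⁻¹ := by
  ext u
  rw [hg.mem_opEigenspace_iff, Module.End.mem_eigenspace_iff]
  change _ ↔ B u = _
  constructor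
  · intro h
    conv_rhs => rw [← h]
    rw [inv_smul_smul₀ hz]
  · intro h
    rw [h, smul_inv_smul₀ hz]

theorem finiteDimensional_opEigenspace (hg : IsShiftInverse A B) [CompleteSpace H]
    (hB : IsCompactOperator B) (z : ℝ) :
    FiniteDimensional ℝ (opEigenspace A z) := by
  by_cases hz : z + 1 = 0
  · obtain rfl : z = -1 := by linarith
    rw [hg.opEigenspace_neg_one]
    infer_instance
  · rw [hg.opEigenspace_eq hz]
    exact ContinuousLinearMap.finite_dimensional_eigenspace hB _ (inv_ne_zero hz)

/-- Fredholm alternative for `B`: if `(z + 1)⁻¹` is not an eigenvalue, then `(z + 1)⁻¹ - B` is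
invertible. The point `z = -1` is separate, since `B` itself is the resolvent there. -/
theorem mem_opSpectrum_iff (hg : IsShiftInverse A B) [CompleteSpace H] (hB : IsCompactOperator B)
    {z : ℝ} :
    z ∈ opSpectrum A ↔ opEigenspace A z ≠ ⊥ := by
  constructor
  · intro h hbot
    refine h ?_
    by_cases hz : z + 1 = 0
    · obtain rfl : z = -1 := by linarith
      exact ⟨B, hg.isResolventAt⟩
    · have hne : ¬ Module.End.HasEigenvalue (B : Module.End ℝ H) (z + 1)⁻¹ := by
        rw [Module.End.hasEigenvalue_iff, ← hg.opEigenspace_eq hz]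
        exact not_not.2 hbot
      have hr := (hB.hasEigenvalue_or_mem_resolventSet (inv_ne_zero hz)).resolve_left hne
      rw [spectrum.mem_resolventSet_iff] at hr
      obtain ⟨S, hS⟩ := hr
      have e1 : ∀ x, (S : H →L[ℝ] H) x = (z + 1)⁻¹ • x - B x := by
        intro x
        rw [hS]
        simp [Algebra.algebraMap_eq_smul_one]
      have e2 : ∀ x, (S : H →L[ℝ] H) ((↑S⁻¹ : H →L[ℝ] H) x) = x := by
        intro x
        have := congrArg (fun T : H →L[ℝ] H => T x) S.mul_inv
        exact this
      have e3 : ∀ x, (↑S⁻¹ : H →L[ℝ] H) ((S : H →L[ℝ] H) x) = x := by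
        intro x
        have := congrArg (fun T : H →L[ℝ] H => T x) S.inv_mul
        exact this
      -- With `S = (z + 1)⁻¹ - B`, formally `A - z = B⁻¹ - (z + 1) = (z + 1) B⁻¹ S`.
      refine ⟨(z + 1)⁻¹ • ((↑S⁻¹ : H →L[ℝ] H) ∘L B), ?_⟩
      rw [isResolventAt_iff_graph]
      refine ⟨fun f => ?_, fun u f h => ?_⟩
      · rw [hg]
        simp only [smul_apply, ContinuousLinearMap.comp_apply]
        set y := (↑S⁻¹ : H →L[ℝ] H) (B f) with hy
        have h1 := e2 (B f)
        rw [← hy, e1] at h1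
        have h2 : f + z • (z + 1)⁻¹ • y + (z + 1)⁻¹ • y = f + y := by
          rw [add_assoc, smul_smul, ← add_smul]
          congr 1
          rw [show z * (z + 1)⁻¹ + (z + 1)⁻¹ = 1 by field_simp, one_smul]
        rw [h2, map_add, ← h1]
        abel
      · rw [hg] at h
        simp only [smul_apply, ContinuousLinearMap.comp_apply]
        have h1 : B (f - z • u) = (z + 1) • (S : H →L[ℝ] H) u := by
          rw [e1, smul_sub, smul_inv_smul₀ hz, map_sub, map_smul]
          rw [map_add, ← eq_sub_iff_add_eq] at h
          rw [h, add_smul, one_smul]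
          abel
        rw [h1, map_smul, e3, inv_smul_smul₀ hz]
  · rintro h ⟨C, hC⟩
    rw [isResolventAt_iff_graph] at hC
    obtain ⟨u, hu, hu0⟩ := Submodule.exists_mem_ne_zero_of_ne_bot h
    rw [mem_opEigenspace_iff_graph] at hu
    have := hC.2 _ _ hu
    rw [sub_self, map_zero] at this
    exact hu0 this.symm

/-- By symmetry `⟪v, u⟫` equals both `(w + 1) ⟪v, B u⟫` and `(z + 1) ⟪v, B u⟫`, so `⟪v, B u⟫ = 0`
when `z ≠ w`. -/
theorem orthogonalFamily_opEigenspace (hg : IsShiftInverse A B)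
    (hs : (B : H →ₗ[ℝ] H).IsSymmetric) :
    OrthogonalFamily ℝ (fun z : ℝ => opEigenspace A z) fun z => (opEigenspace A z).subtypeₗᵢ := by
  rw [orthogonalFamily_iff_pairwise]
  intro z w hzw u hu
  rw [Submodule.mem_orthogonal]
  intro v hv
  rw [hg.mem_opEigenspace_iff] at hu
  rw [hg.mem_opEigenspace_iff] at hv
  have h1 : ⟪v, u⟫_ℝ = (w + 1) * ⟪v, B u⟫_ℝ := by
    conv_lhs => rw [← hv]
    rw [inner_smul_left]
    exact congrArg _ (hs v u)
  have h2 : ⟪v, u⟫_ℝ = (z + 1) * ⟪v, B u⟫_ℝ := by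
    conv_lhs => rw [← hu]
    rw [inner_smul_right]
  have h3 : (w - z) * ⟪v, B u⟫_ℝ = 0 := by linarith
  rcases mul_eq_zero.1 h3 with h | h
  · exact absurd (by linarith) hzw
  · rw [h1, h, mul_zero]

/-- Orthonormal bases of the eigenspaces are put together; completeness is the spectral theorem for
`B`. The index type needs no list of eigenvalues, as the fibre over any other `z` is `Fin 0`. -/
theorem exists_hilbertBasis (hg : IsShiftInverse A B)
    (hs : (B : H →ₗ[ℝ] H).IsSymmetric) [CompleteSpace H] (hB : IsCompactOperator B) :
    ∃ e : HilbertBasis (Σ z : ℝ, Fin (Module.finrank ℝ (opEigenspace A z))) ℝ H,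
      (∀ i, e i ∈ opEigenspace A i.1) ∧
        ∀ z, opEigenspace A z ≤ Submodule.span ℝ (e '' {i | i.1 = z}) := by
  have := hg.finiteDimensional_opEigenspace hB
  let b := fun z : ℝ => stdOrthonormalBasis ℝ (opEigenspace A z)
  let v : (Σ z : ℝ, Fin (Module.finrank ℝ (opEigenspace A z))) → H := fun i => (b i.1 i.2 : H)
  have hv : Orthonormal ℝ v :=
    (hg.orthogonalFamily_opEigenspace hs).orthonormal_sigma_orthonormal fun z => (b z).orthonormal
  have hspan : ∀ z, opEigenspace A z ≤ Submodule.span ℝ (v '' {i | i.1 = z}) := by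
    intro z u hu
    have h1 := (b z).sum_repr ⟨u, hu⟩
    have h2 : u = ∑ i, (b z).repr ⟨u, hu⟩ i • v ⟨z, i⟩ := by
      have := congrArg (Subtype.val) h1
      simpa [v] using this.symm
    rw [h2]
    exact Submodule.sum_mem _ fun i _ => Submodule.smul_mem _ _
      (Submodule.subset_span ⟨⟨z, i⟩, rfl, rfl⟩)
  have hbot : (Submodule.span ℝ (range v))ᗮ = ⊥ := by
    rw [eq_bot_iff, ← ContinuousLinearMap.orthogonalComplement_iSup_eigenspaces_eq_bot hB hs]
    refine Submodule.orthogonal_le (iSup_le fun μ => ?_)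
    by_cases hμ : μ = 0
    · intro u hu
      rw [Module.End.mem_eigenspace_iff, hμ, zero_smul] at hu
      rw [hg.eq_zero_of_apply_eq_zero hu]
      exact Submodule.zero_mem _
    -- Solving `μ = (z + 1)⁻¹` for `z`.
    · have := hg.opEigenspace_eq (z := μ⁻¹ - 1) (by simpa using hμ)
      rw [sub_add_cancel, inv_inv] at this
      rw [← this]
      exact (hspan _).trans (Submodule.span_mono (image_subset_range _ _))
  refine ⟨HilbertBasis.mkOfOrthogonalEqBot hv hbot, ?_, ?_⟩
  · intro i
    rw [HilbertBasis.coe_mkOfOrthogonalEqBot]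
    exact (b i.1 i.2).2
  · intro z
    rw [HilbertBasis.coe_mkOfOrthogonalEqBot]
    exact hspan z

/-- Infinitely many eigenvalues `≤ t` would give orthonormal `e i` whose images `(lam i + 1)⁻¹ • e
i` are at mutual distance at least `(t + 1)⁻¹`, against the compactness of `B`. -/
theorem finite_sublevel (hg : IsShiftInverse A B) {ι : Type*} {e : ι → H} (he : Orthonormal ℝ e)
    {lam : ι → ℝ}
    (hB : IsCompactOperator B) (hlam : ∀ i, 0 < lam i) (hmem : ∀ i, e i ∈ opEigenspace A (lam i))
    (t : ℝ) : {i | lam i ≤ t}.Finite := by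
  by_contra hinf
  have hinf : {i | lam i ≤ t}.Infinite := hinf
  obtain ⟨K, hK, hK'⟩ := hB.image_closedBall_subset_compact 1
  let s := hinf.natEmbedding
  have hBe : ∀ i, B (e i) = (lam i + 1)⁻¹ • e i := by
    intro i
    have := hg.mem_opEigenspace_iff.1 (hmem i)
    conv_rhs => rw [← this]
    rw [inv_smul_smul₀ (by have := hlam i; positivity)]
  obtain ⟨y, -, ψ, hψ, hlim⟩ := hK.tendsto_subseq (x := fun n => B (e (s n)))
    fun n => hK' ⟨e (s n), by simp [he.1], rfl⟩
  have ht : 0 < t + 1 := by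
    have h1 := hlam (s 0)
    have h2 : lam (s 0) ≤ t := (s 0).2
    linarith
  have hcs := hlim.cauchySeq
  rw [Metric.cauchySeq_iff'] at hcs
  obtain ⟨M, hM⟩ := hcs (t + 1)⁻¹ (by positivity)
  have h1 := hM (M + 1) (by omega)
  have hne : ((s (ψ (M + 1)) : ι)) ≠ s (ψ M) := by
    intro h
    have := hψ.injective (s.injective (Subtype.ext h))
    omega
  rw [dist_eq_norm] at h1
  simp only [Function.comp] at h1
  -- Pairing the difference with the unit vector `e i` leaves exactly `(lam i + 1)⁻¹`.
  have h2 : (t + 1)⁻¹ ≤ ‖B (e (s (ψ (M + 1)))) - B (e (s (ψ M)))‖ := by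
    set i := (s (ψ (M + 1)) : ι)
    set j := (s (ψ M) : ι)
    have h3 : ⟪e i, B (e i) - B (e j)⟫_ℝ = (lam i + 1)⁻¹ := by
      rw [hBe, hBe, inner_sub_right, inner_smul_right, inner_smul_right, he.2 hne,
        real_inner_self_eq_norm_sq, he.1]
      ring
    have h4 := real_inner_le_norm (e i) (B (e i) - B (e j))
    rw [h3, he.1, one_mul] at h4
    refine le_trans ?_ h4
    have : lam i ≤ t := (s (ψ (M + 1))).2
    have := hlam i
    exact inv_anti₀ (by positivity) (by linarith)
  linarith

theorem hasDiscreteSpectrum (hg : IsShiftInverse A B)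
    (hs : (B : H →ₗ[ℝ] H).IsSymmetric) [CompleteSpace H] (hB : IsCompactOperator B)
    (hpos : ∀ z u, u ≠ 0 → u ∈ opEigenspace A z → 0 < z) : HasDiscreteSpectrum A := by
  refine ⟨fun z hz => ⟨(hg.mem_opSpectrum_iff hB).1 hz, hg.finiteDimensional_opEigenspace hB z⟩,
    fun a b => ?_⟩
  obtain ⟨e, he1, he2⟩ := hg.exists_hilbertBasis hs hB
  have hfin := hg.finite_sublevel e.orthonormal hB
    (fun i => hpos _ _ (e.orthonormal.ne_zero i) (he1 i)) he1 b
  refine (hfin.image Sigma.fst).subset ?_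
  rintro z ⟨hz, -, hzb⟩
  rw [hg.mem_opSpectrum_iff hB] at hz
  have := hg.finiteDimensional_opEigenspace hB z
  have := Submodule.nontrivial_iff_ne_bot.2 hz
  exact ⟨⟨z, ⟨0, Module.finrank_pos⟩⟩, hzb, rfl⟩

theorem exists_eigenvalue_sequence (hg : IsShiftInverse A B)
    (hs : (B : H →ₗ[ℝ] H).IsSymmetric) [CompleteSpace H] (hB : IsCompactOperator B)
    (hpos : ∀ z u, u ≠ 0 → u ∈ opEigenspace A z → 0 < z) (hinf : ¬ FiniteDimensional ℝ H) :
    ∃ (lam : ℕ → ℝ) (e : HilbertBasis ℕ ℝ H), Monotone lam ∧ Tendsto lam atTop atTop ∧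
      (∀ n, 0 < lam n) ∧ (∀ n, e n ∈ opEigenspace A (lam n)) ∧ opSpectrum A = range lam ∧
      ∀ n, eigenvalueBounds A (n + 1) = Ici (lam n) := by
  obtain ⟨e, he1, he2⟩ := hg.exists_hilbertBasis hs hB
  have hp : ∀ i : (Σ z : ℝ, Fin (Module.finrank ℝ (opEigenspace A z))), 0 < i.1 :=
    fun i => hpos _ _ (e.orthonormal.ne_zero i) (he1 i)
  have : Infinite (Σ z : ℝ, Fin (Module.finrank ℝ (opEigenspace A z))) := by
    by_contra hcon
    rw [not_infinite_iff_finite] at hcon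
    have := Fintype.ofFinite (Σ z : ℝ, Fin (Module.finrank ℝ (opEigenspace A z)))
    exact hinf e.toOrthonormalBasis.toBasis.finiteDimensional_of_finite
  obtain ⟨σ, hσ⟩ := exists_equiv_nat_monotone
    (Sigma.fst : (Σ z : ℝ, Fin (Module.finrank ℝ (opEigenspace A z))) → ℝ)
    (hg.finite_sublevel e.orthonormal hB hp he1)
  set lam : ℕ → ℝ := fun n => (σ n).1 with hlam
  have hmono : Monotone lam := hσ
  have hort : Orthonormal ℝ (e ∘ σ) := e.orthonormal.comp σ σ.injective
  have hfin : ∀ t, {n | lam n ≤ t}.Finite :=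
    hg.finite_sublevel hort hB (fun n => hp (σ n)) (fun n => he1 (σ n))
  have htop : Tendsto lam atTop atTop := by
    refine tendsto_atTop_atTop_of_monotone hmono fun t => ?_
    obtain ⟨n, hn⟩ := (hfin t).exists_notMem
    exact ⟨n, (not_le.1 hn).le⟩
  have hr : range (e ∘ σ) = range e := σ.surjective.range_comp e
  have hbot : (Submodule.span ℝ (range (e ∘ σ)))ᗮ = ⊥ := by
    rw [hr, ← Submodule.orthogonal_closure, e.dense_span, Submodule.top_orthogonal_eq_bot]
  refine ⟨lam, HilbertBasis.mkOfOrthogonalEqBot hort hbot, hmono, htop, fun n => hp _, fun n => ?_,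
    ?_, fun n => ?_⟩
  · rw [HilbertBasis.coe_mkOfOrthogonalEqBot]
    exact he1 (σ n)
  · ext z
    rw [hg.mem_opSpectrum_iff hB]
    constructor
    · intro hz
      have := hg.finiteDimensional_opEigenspace hB z
      have := Submodule.nontrivial_iff_ne_bot.2 hz
      exact ⟨σ.symm ⟨z, ⟨0, Module.finrank_pos⟩⟩, by simp [hlam]⟩
    · rintro ⟨n, rfl⟩ h
      have h1 := he1 (σ n)
      have h2 : e (σ n) ∈ opEigenspace A (lam n) := h1
      rw [h, Submodule.mem_bot] at h2
      exact e.orthonormal.ne_zero _ h2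
  · ext t
    -- The eigenvalue count becomes the number of indices with `lam m ≤ t`, because the eigenspaces
    -- up to `t` are spanned by the corresponding basis vectors.
    have hsup : (⨆ s : Iic t, opEigenspace A s : Submodule ℝ H)
        = Submodule.span ℝ ((e ∘ σ) '' {m | lam m ≤ t}) := by
      refine le_antisymm (iSup_le fun s => (he2 s).trans (Submodule.span_mono ?_))
        (Submodule.span_le.2 ?_)
      · rintro _ ⟨i, hi, rfl⟩
        refine ⟨σ.symm i, ?_, by simp⟩
        have : i.1 ≤ t := hi.trans_le s.2
        simpa [hlam] using this
      · rintro _ ⟨m, hm, rfl⟩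
        exact Submodule.mem_iSup_of_mem (⟨lam m, hm⟩ : Iic t) (he1 (σ m))
    have hrank : eigenvalueCount A t = ((hfin t).toFinset.card : Cardinal) := by
      classical
      have himg : (e ∘ σ) '' {m | lam m ≤ t} = ↑((hfin t).toFinset.image (e ∘ σ)) := by simp
      rw [eigenvalueCount, hsup, rank_span_set ((hort.linearIndependent.linearIndepOn _).id_image),
          himg]
      exact Cardinal.mk_coe_finset.trans
        (congrArg _ (Finset.card_image_of_injective _ hort.linearIndependent.injective))
    -- Indices start at `0`: since `lam` is monotone, at least `n + 1` of its terms are `≤ t`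
    -- exactly when `lam n ≤ t`.
    change ((n + 1 : ℕ) : Cardinal) ≤ eigenvalueCount A t ↔ lam n ≤ t
    rw [hrank, Nat.cast_le]
    constructor
    · intro h
      by_contra hcon
      have : (hfin t).toFinset ⊆ Finset.range n := by
        intro m hm
        rw [Set.Finite.mem_toFinset] at hm
        rw [Finset.mem_range]
        by_contra hmn
        exact hcon ((hmono (not_lt.1 hmn)).trans hm)
      have := Finset.card_le_card this
      rw [Finset.card_range] at this
      omega
    · intro h
      have : Finset.range (n + 1) ⊆ (hfin t).toFinset := by
        intro m hm
        rw [Finset.mem_range] at hm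
        rw [Set.Finite.mem_toFinset]
        exact (hmono (by omega)).trans h
      have := Finset.card_le_card this
      rwa [Finset.card_range] at this

end IsShiftInverse

end CompactResolvent

/-! ### Convergence in `L²` through squared integrals -/

section LpTwo

variable {α E : Type*} [MeasurableSpace α] {μ : Measure α} [NormedAddCommGroup E]

theorem ENNReal.add_sq_le_four_mul (a b : ℝ≥0∞) : (a + b) ^ 2 ≤ 4 * (a ^ 2 + b ^ 2) := by
  have h : a + b ≤ 2 * max a b := by
    rw [two_mul]
    exact add_le_add (le_max_left _ _) (le_max_right _ _)
  calc (a + b) ^ 2 ≤ (2 * max a b) ^ 2 := by gcongr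
    _ = 4 * (max a b) ^ 2 := by ring
    _ ≤ 4 * (a ^ 2 + b ^ 2) := by
      gcongr
      rcases max_choice a b with h | h <;> rw [h]
      · exact le_self_add
      · exact le_add_self

theorem MeasureTheory.eLpNorm_two_sq (f : α → E) :
    eLpNorm f 2 μ ^ 2 = ∫⁻ x, ‖f x‖ₑ ^ 2 ∂μ := by
  have := eLpNorm_nnreal_pow_eq_lintegral (f := f) (μ := μ) (p := 2) (by norm_num)
  simpa using this

theorem MeasureTheory.Lp.enorm_sq_eq_lintegral (f : Lp E 2 μ) :
    ‖f‖ₑ ^ 2 = ∫⁻ x, ‖f x‖ₑ ^ 2 ∂μ := by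
  rw [Lp.enorm_def, eLpNorm_two_sq]

theorem ENNReal.tendsto_sq_zero_iff {ι : Type*} {l : Filter ι} {u : ι → ℝ≥0∞} :
    Tendsto (fun i => u i ^ 2) l (𝓝 0) ↔ Tendsto u l (𝓝 0) := by
  constructor
  · intro h
    have h1 := (ENNReal.continuous_rpow_const (y := (1 / 2 : ℝ))).tendsto 0
    have h2 := h1.comp h
    rw [ENNReal.zero_rpow_of_pos (by norm_num)] at h2
    refine h2.congr fun i => ?_
    simp only [Function.comp]
    rw [← ENNReal.rpow_natCast, ← ENNReal.rpow_mul]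
    norm_num
  · intro h
    have h1 := ((ENNReal.continuous_pow 2).tendsto 0).comp h
    simpa [Function.comp_def] using h1

theorem MeasureTheory.Lp.tendsto_two_iff {ι : Type*} {l : Filter ι} {F : ι → Lp E 2 μ}
    {f : Lp E 2 μ} :
    Tendsto F l (𝓝 f) ↔ Tendsto (fun i => ∫⁻ x, ‖F i x - f x‖ₑ ^ 2 ∂μ) l (𝓝 0) := by
  rw [Lp.tendsto_Lp_iff_tendsto_eLpNorm', ← ENNReal.tendsto_sq_zero_iff]
  simp only [eLpNorm_two_sq, Pi.sub_apply]

/-- Multiplication by uniformly bounded functions that converge a.e. preserves convergence in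
`L²`. -/
theorem tendsto_lintegral_smul_sub_smul [NormedSpace ℝ E] {F : ℕ → Lp E 2 μ} {f : Lp E 2 μ}
    (hF : Tendsto F atTop (𝓝 f)) {m : ℕ → α → ℝ} {m₀ : α → ℝ} {C : ℝ}
    (hm : ∀ n, AEStronglyMeasurable (m n) μ) (hm₀ : AEStronglyMeasurable m₀ μ)
    (hC : ∀ n x, |m n x| ≤ C) (hC₀ : ∀ x, |m₀ x| ≤ C)
    (hlim : ∀ᵐ x ∂μ, Tendsto (fun n => m n x) atTop (𝓝 (m₀ x))) :
    Tendsto (fun n => ∫⁻ x, ‖m n x • F n x - m₀ x • f x‖ₑ ^ 2 ∂μ) atTop (𝓝 0) := by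
  have hCn : ∀ n x, ‖m n x‖ₑ ≤ ENNReal.ofReal C := fun n x => by
    rw [← ofReal_norm]
    exact ENNReal.ofReal_le_ofReal (hC n x)
  have hD : ∀ n x, ‖m n x - m₀ x‖ₑ ≤ ENNReal.ofReal (2 * C) := fun n x => by
    rw [← ofReal_norm]
    refine ENNReal.ofReal_le_ofReal ?_
    have := norm_sub_le (m n x) (m₀ x)
    have h1 := hC n x
    have h2 := hC₀ x
    simp only [Real.norm_eq_abs] at *
    linarith
  have h1 : Tendsto (fun n => 4 * (ENNReal.ofReal C ^ 2 * ∫⁻ x, ‖F n x - f x‖ₑ ^ 2 ∂μ)) atTop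
      (𝓝 0) := by
    have := ENNReal.Tendsto.const_mul (a := ENNReal.ofReal C ^ 2) (Lp.tendsto_two_iff.1 hF)
      (Or.inr (by simp))
    have := ENNReal.Tendsto.const_mul (a := 4) this (Or.inr (by simp))
    simpa using this
  have h2 : Tendsto (fun n => 4 * ∫⁻ x, (‖m n x - m₀ x‖ₑ * ‖f x‖ₑ) ^ 2 ∂μ) atTop (𝓝 0) := by
    have : Tendsto (fun n => ∫⁻ x, (‖m n x - m₀ x‖ₑ * ‖f x‖ₑ) ^ 2 ∂μ) atTop
        (𝓝 (∫⁻ x, 0 ∂μ)) := by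
      refine tendsto_lintegral_of_dominated_convergence'
        (fun x => ENNReal.ofReal (2 * C) ^ 2 * ‖f x‖ₑ ^ 2) (fun n => ?_) (fun n => ?_) ?_ ?_
      · exact (((hm n).sub hm₀).enorm.mul (Lp.aestronglyMeasurable f).enorm).pow_const 2
      · refine Eventually.of_forall fun x => ?_
        simp only [mul_pow]
        gcongr
        exact hD n x
      · rw [lintegral_const_mul' _ _ (ENNReal.pow_ne_top ENNReal.ofReal_ne_top),
          ← Lp.enorm_sq_eq_lintegral]
        exact ENNReal.mul_ne_top (ENNReal.pow_ne_top ENNReal.ofReal_ne_top) (by simp)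
      · filter_upwards [hlim] with x hx
        have h3 : Tendsto (fun n => ‖m n x - m₀ x‖ₑ) atTop (𝓝 0) := by
          have := (hx.sub_const (m₀ x)).enorm
          simpa using this
        have h4 := ENNReal.Tendsto.mul_const (b := ‖f x‖ₑ) h3 (Or.inr (by simp))
        rw [zero_mul] at h4
        exact ENNReal.tendsto_sq_zero_iff.2 h4
    rw [lintegral_zero] at this
    have := ENNReal.Tendsto.const_mul (a := 4) this (Or.inr (by simp))
    simpa using this
  have h3 := h1.add h2
  rw [add_zero] at h3
  refine tendsto_of_tendsto_of_tendsto_of_le_of_le tendsto_const_nhds h3 (fun n => zero_le)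
    fun n => ?_
  have hmeas : AEMeasurable (fun x => ‖F n x - f x‖ₑ ^ 2) μ :=
    ((Lp.aestronglyMeasurable _).sub (Lp.aestronglyMeasurable _)).enorm.pow_const 2
  calc ∫⁻ x, ‖m n x • F n x - m₀ x • f x‖ₑ ^ 2 ∂μ
      ≤ ∫⁻ x, 4 * (ENNReal.ofReal C ^ 2 * ‖F n x - f x‖ₑ ^ 2)
          + 4 * (‖m n x - m₀ x‖ₑ * ‖f x‖ₑ) ^ 2 ∂μ := by
        refine lintegral_mono fun x => ?_
        -- The first summand is small by the uniform bound on `m n`, the second by dominated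
        -- convergence.
        have e : m n x • F n x - m₀ x • f x
            = m n x • (F n x - f x) + (m n x - m₀ x) • f x := by
          rw [smul_sub, sub_smul]; abel
        rw [e, ← mul_add]
        refine (pow_le_pow_left' (enorm_add_le _ _) 2).trans
          ((ENNReal.add_sq_le_four_mul _ _).trans ?_)
        rw [enorm_smul, enorm_smul, mul_pow]
        gcongr
        exact hCn n x
    _ = _ := by
        rw [lintegral_add_left' (by fun_prop), lintegral_const_mul' _ _ (by simp),
          lintegral_const_mul' _ _ (by simp), lintegral_const_mul' _ _ (by simp)]

theorem MeasureTheory.Lp.exists_subseq_tendsto_ae {F : ℕ → Lp E 2 μ} {f : Lp E 2 μ}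
    (hF : Tendsto F atTop (𝓝 f)) :
    ∃ ns : ℕ → ℕ, StrictMono ns ∧ ∀ᵐ x ∂μ, Tendsto (fun n => F (ns n) x) atTop (𝓝 (f x)) :=
  (tendstoInMeasure_of_tendsto_Lp hF).exists_seq_tendsto_ae

end LpTwo

/-! ### Approximation by test functions and the chain rule in `H¹₀` -/

section TestPairs

variable {N : ℕ}

/-- A test function together with its gradient, as an element of `H¹`. -/
def testPair {Ω : Opens (RN N)} (φ : 𝓓(Ω, ℝ)) : L2Pair N :=
  WithLp.toLp 2 ((testFunction_memLp φ).toLp φ, (testFunction_memLp_gradient φ).toLp _)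

theorem testPair_fst {Ω : Opens (RN N)} (φ : 𝓓(Ω, ℝ)) : (testPair φ).fst =ᵐ[volume] φ :=
  (testFunction_memLp φ).coeFn_toLp

theorem testPair_snd {Ω : Opens (RN N)} (φ : 𝓓(Ω, ℝ)) :
    (testPair φ).snd =ᵐ[volume] ∇ (φ : RN N → ℝ) :=
  (testFunction_memLp_gradient φ).coeFn_toLp

theorem L2Pair.ext_ae {U V : L2Pair N} (h1 : U.fst =ᵐ[volume] V.fst)
    (h2 : U.snd =ᵐ[volume] V.snd) : U = V := by
  have e1 : U.fst = V.fst := Lp.ext h1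
  have e2 : U.snd = V.snd := Lp.ext h2
  exact WithLp.ofLp_injective 2 (Prod.ext e1 e2)

theorem tendsto_L2Pair {ι : Type*} {l : Filter ι} {F : ι → L2Pair N} {U : L2Pair N}
    (h1 : Tendsto (fun i => (F i).fst) l (𝓝 U.fst))
    (h2 : Tendsto (fun i => (F i).snd) l (𝓝 U.snd)) : Tendsto F l (𝓝 U) :=
  ((WithLp.prod_continuous_toLp 2 (L2 N) (L2Vec N)).tendsto (U.fst, U.snd)).comp
    (h1.prodMk_nhds h2)

theorem continuous_L2Pair_fst : Continuous fun U : L2Pair N => U.fst :=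
  (WithLp.fstL 2 ℝ (L2 N) (L2Vec N)).continuous

theorem continuous_L2Pair_snd : Continuous fun U : L2Pair N => U.snd :=
  (WithLp.sndL 2 ℝ (L2 N) (L2Vec N)).continuous

/-- The closure in `H¹(ℝ^N)` of the nonnegative test functions on `Ω`. -/
def H10Nonneg (Ω : Opens (RN N)) : Set (L2Pair N) :=
  closure {U | ∃ φ : 𝓓(Ω, ℝ), (∀ x, 0 ≤ φ x) ∧ U = testPair φ}

theorem mem_H10_iff_mem_closure {Ω : Opens (RN N)} {U : L2Pair N} :
    U ∈ H10 Ω ↔ U ∈ closure (range (testPair (Ω := Ω))) := by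
  have : (testPairs Ω : Set (L2Pair N)) = range (testPair (Ω := Ω)) := by
    ext V
    constructor
    · rintro ⟨φ, h1, h2⟩
      exact ⟨φ, L2Pair.ext_ae ((testPair_fst φ).trans h1.symm) ((testPair_snd φ).trans h2.symm)⟩
    · rintro ⟨φ, rfl⟩
      exact ⟨φ, testPair_fst φ, testPair_snd φ⟩
  rw [← this]
  rfl

theorem exists_seq_testPair {Ω : Opens (RN N)} {U : L2Pair N} (hU : U ∈ H10 Ω) :
    ∃ φ : ℕ → 𝓓(Ω, ℝ), Tendsto (fun n => testPair (φ n)) atTop (𝓝 U) ∧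
      ∀ᵐ x, Tendsto (fun n => φ n x) atTop (𝓝 (U.fst x)) := by
  rw [mem_H10_iff_mem_closure, mem_closure_iff_seq_limit] at hU
  obtain ⟨u, hu, hlim⟩ := hU
  choose φ hφ using hu
  obtain rfl : (fun n => testPair (φ n)) = u := funext hφ
  obtain ⟨ns, hns, hae⟩ :=
    Lp.exists_subseq_tendsto_ae ((continuous_L2Pair_fst.tendsto U).comp hlim)
  refine ⟨fun n => φ (ns n), hlim.comp hns.tendsto_atTop, ?_⟩
  have h : ∀ᵐ x, ∀ n, (testPair (φ n)).fst x = φ n x := ae_all_iff.2 fun n => testPair_fst (φ n)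
  filter_upwards [hae, h] with x h1 h2
  refine h1.congr fun n => ?_
  exact h2 _

theorem H10_mono {Ω Ω' : Opens (RN N)} (h : Ω ≤ Ω') : H10 Ω ≤ H10 Ω' := by
  intro U hU
  rw [mem_H10_iff_mem_closure] at hU ⊢
  refine closure_mono ?_ hU
  rintro _ ⟨φ, rfl⟩
  exact ⟨⟨φ, φ.contDiff, φ.hasCompactSupport, φ.tsupport_subset.trans h⟩, rfl⟩

/-- The data needed to compose two `H¹₀` functions: a smooth function `K` of two variables, with
bounded partial derivatives `K₁` and `K₂`, which vanishes where the first variable does. -/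
structure IsChainFunction (K K₁ K₂ : ℝ × ℝ → ℝ) (C : ℝ) : Prop where
  contDiff : ContDiff ℝ ∞ K
  hasFDerivAt : ∀ p, HasFDerivAt K
    (K₁ p • ContinuousLinearMap.fst ℝ ℝ ℝ + K₂ p • ContinuousLinearMap.snd ℝ ℝ ℝ) p
  bound₁ : ∀ p, |K₁ p| ≤ C
  bound₂ : ∀ p, |K₂ p| ≤ C
  zero : ∀ b, K (0, b) = 0

namespace IsChainFunction

variable {K K₁ K₂ : ℝ × ℝ → ℝ} {C : ℝ}

theorem continuous₁ (hK : IsChainFunction K K₁ K₂ C) : Continuous K₁ := by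
  have : K₁ = fun p => fderiv ℝ K p (1, 0) := by
    ext p
    rw [(hK.hasFDerivAt p).fderiv]
    simp
  rw [this]
  exact (hK.contDiff.continuous_fderiv (by simp)).clm_apply continuous_const

theorem continuous₂ (hK : IsChainFunction K K₁ K₂ C) : Continuous K₂ := by
  have : K₂ = fun p => fderiv ℝ K p (0, 1) := by
    ext p
    rw [(hK.hasFDerivAt p).fderiv]
    simp
  rw [this]
  exact (hK.contDiff.continuous_fderiv (by simp)).clm_apply continuous_const

theorem nonneg_const (hK : IsChainFunction K K₁ K₂ C) : 0 ≤ C :=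
  (abs_nonneg _).trans (hK.bound₁ 0)

theorem abs_sub_le (hK : IsChainFunction K K₁ K₂ C) (p q : ℝ × ℝ) :
    |K p - K q| ≤ 2 * C * (|p.1 - q.1| + |p.2 - q.2|) := by
  have hC := hK.nonneg_const
  have h := convex_univ.norm_image_sub_le_of_norm_hasFDerivWithin_le (f := K) (C := 2 * C)
    (fun x _ => (hK.hasFDerivAt x).hasFDerivWithinAt) (fun x _ => ?_) (mem_univ q) (mem_univ p)
  · refine h.trans ?_
    gcongr
    rw [Prod.norm_def]
    exact max_le_add_of_nonneg (norm_nonneg _) (norm_nonneg _)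
  · refine (norm_add_le _ _).trans ?_
    rw [norm_smul, norm_smul, two_mul]
    gcongr
    · exact (mul_le_of_le_one_right (norm_nonneg _) (ContinuousLinearMap.norm_fst_le ..)).trans
        (hK.bound₁ x)
    · exact (mul_le_of_le_one_right (norm_nonneg _) (ContinuousLinearMap.norm_snd_le ..)).trans
        (hK.bound₂ x)

theorem abs_le (hK : IsChainFunction K K₁ K₂ C) (p : ℝ × ℝ) : |K p| ≤ 2 * C * |p.1| := by
  have := hK.abs_sub_le p (0, p.2)
  rw [hK.zero] at this
  simpa using this

theorem support_comp_subset (hK : IsChainFunction K K₁ K₂ C) {α : Type*} (f g : α → ℝ) :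
    Function.support (fun x => K (f x, g x)) ⊆ Function.support f := by
  intro x hx h0
  simp only [Function.mem_support] at hx
  exact hx (by rw [h0, hK.zero])

/-- The composition of test functions with a chain function. -/
def compTest (hK : IsChainFunction K K₁ K₂ C) {Ω Ω' : Opens (RN N)} (φ : 𝓓(Ω, ℝ))
    (ψ : 𝓓(Ω', ℝ)) : 𝓓(Ω, ℝ) where
  toFun x := K (φ x, ψ x)
  contDiff' := hK.contDiff.comp (φ.contDiff.prodMk ψ.contDiff)
  hasCompactSupport' := φ.hasCompactSupport.mono (hK.support_comp_subset φ ψ)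
  tsupport_subset' := (closure_mono (hK.support_comp_subset φ ψ)).trans φ.tsupport_subset

theorem compTest_apply (hK : IsChainFunction K K₁ K₂ C) {Ω Ω' : Opens (RN N)} (φ : 𝓓(Ω, ℝ))
    (ψ : 𝓓(Ω', ℝ)) (x : RN N) : hK.compTest φ ψ x = K (φ x, ψ x) := rfl

theorem gradient_compTest (hK : IsChainFunction K K₁ K₂ C) {Ω Ω' : Opens (RN N)} (φ : 𝓓(Ω, ℝ))
    (ψ : 𝓓(Ω', ℝ)) (x : RN N) :
    ∇ (hK.compTest φ ψ : RN N → ℝ) x = K₁ (φ x, ψ x) • ∇ φ x + K₂ (φ x, ψ x) • ∇ ψ x := by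
  have hφ : HasFDerivAt φ (fderiv ℝ φ x) x :=
    ((φ.contDiff.differentiable (by simp)) x).hasFDerivAt
  have hψ : HasFDerivAt ψ (fderiv ℝ ψ x) x :=
    ((ψ.contDiff.differentiable (by simp)) x).hasFDerivAt
  have h := HasFDerivAt.comp x (hK.hasFDerivAt (φ x, ψ x)) (hφ.prodMk hψ)
  change HasFDerivAt (hK.compTest φ ψ) _ x at h
  rw [gradient, h.fderiv, gradient, gradient, ← map_smul, ← map_smul, ← map_add]
  rfl

/-- The chain rule in `H¹₀`. -/
theorem exists_mem_H10 (hK : IsChainFunction K K₁ K₂ C) {Ω Ω' : Opens (RN N)} {U V : L2Pair N}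
    (hU : U ∈ H10 Ω) (hV : V ∈ H10 Ω') :
    ∃ W ∈ H10 Ω, (W.fst =ᵐ[volume] fun x => K (U.fst x, V.fst x)) ∧
      (W.snd =ᵐ[volume] fun x => K₁ (U.fst x, V.fst x) • U.snd x
        + K₂ (U.fst x, V.fst x) • V.snd x) ∧
      ((∀ p, 0 ≤ K p) → W ∈ H10Nonneg Ω) := by
  obtain ⟨φ, hφ, hφae⟩ := exists_seq_testPair hU
  obtain ⟨ψ, hψ, hψae⟩ := exists_seq_testPair hV
  have hC := hK.nonneg_const
  have mp : AEStronglyMeasurable (fun x => (U.fst x, V.fst x)) volume :=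
    (Lp.aestronglyMeasurable U.fst).prodMk (Lp.aestronglyMeasurable V.fst)
  have m1 : MemLp (fun x => K (U.fst x, V.fst x)) 2 (volume : Measure (RN N)) := by
    refine (Lp.memLp U.fst).of_le_mul (c := 2 * C)
      (hK.contDiff.continuous.comp_aestronglyMeasurable mp) (Eventually.of_forall fun x => ?_)
    exact hK.abs_le _
  have mK1 : AEStronglyMeasurable (fun x => K₁ (U.fst x, V.fst x)) volume :=
    hK.continuous₁.comp_aestronglyMeasurable mp
  have mK2 : AEStronglyMeasurable (fun x => K₂ (U.fst x, V.fst x)) volume :=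
    hK.continuous₂.comp_aestronglyMeasurable mp
  have m2 : MemLp (fun x => K₁ (U.fst x, V.fst x) • U.snd x) 2 (volume : Measure (RN N)) := by
    refine (Lp.memLp U.snd).of_le_mul (c := C) (mK1.smul (Lp.aestronglyMeasurable U.snd))
      (Eventually.of_forall fun x => ?_)
    rw [norm_smul]
    gcongr
    exact hK.bound₁ _
  have m3 : MemLp (fun x => K₂ (U.fst x, V.fst x) • V.snd x) 2 (volume : Measure (RN N)) := by
    refine (Lp.memLp V.snd).of_le_mul (c := C) (mK2.smul (Lp.aestronglyMeasurable V.snd))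
      (Eventually.of_forall fun x => ?_)
    rw [norm_smul]
    gcongr
    exact hK.bound₂ _
  let W : L2Pair N := WithLp.toLp 2 (m1.toLp _, m2.toLp _ + m3.toLp _)
  have hW1 : W.fst =ᵐ[volume] fun x => K (U.fst x, V.fst x) := m1.coeFn_toLp
  have hW2 : W.snd =ᵐ[volume] fun x => K₁ (U.fst x, V.fst x) • U.snd x
      + K₂ (U.fst x, V.fst x) • V.snd x := by
    filter_upwards [Lp.coeFn_add (m2.toLp _) (m3.toLp _), m2.coeFn_toLp, m3.coeFn_toLp]
      with x h1 h2 h3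
    exact h1.trans (by rw [Pi.add_apply, h2, h3])
  -- The compositions `K (φ n, ψ n)` are test functions on `Ω`, because `K` vanishes with its first
  -- variable. Their values converge by the Lipschitz bound, their gradients as products of bounded
  -- a.e. convergent factors with `L²`-convergent ones. If `K ≥ 0`, the same sequence shows
  -- membership in `H10Nonneg Ω`.
  have hlim : Tendsto (fun n => testPair (hK.compTest (φ n) (ψ n))) atTop (𝓝 W) := by
    have cφ1 := Lp.tendsto_two_iff.1 ((continuous_L2Pair_fst.tendsto U).comp hφ)
    have cψ1 := Lp.tendsto_two_iff.1 ((continuous_L2Pair_fst.tendsto V).comp hψ)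
    have cont : ∀ n, Continuous fun x => (φ n x, ψ n x) := fun n =>
      (φ n).continuous.prodMk (ψ n).continuous
    have hae : ∀ᵐ x, Tendsto (fun n => (φ n x, ψ n x)) atTop (𝓝 (U.fst x, V.fst x)) := by
      filter_upwards [hφae, hψae] with x h1 h2
      exact h1.prodMk_nhds h2
    have cφ2 := tendsto_lintegral_smul_sub_smul ((continuous_L2Pair_snd.tendsto U).comp hφ)
      (m := fun n x => K₁ (φ n x, ψ n x)) (m₀ := fun x => K₁ (U.fst x, V.fst x)) (C := C)
      (fun n => (hK.continuous₁.comp (cont n)).aestronglyMeasurable) mK1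
      (fun n x => hK.bound₁ _) (fun x => hK.bound₁ _)
      (hae.mono fun x hx => (hK.continuous₁.tendsto _).comp hx)
    have cψ2 := tendsto_lintegral_smul_sub_smul ((continuous_L2Pair_snd.tendsto V).comp hψ)
      (m := fun n x => K₂ (φ n x, ψ n x)) (m₀ := fun x => K₂ (U.fst x, V.fst x)) (C := C)
      (fun n => (hK.continuous₂.comp (cont n)).aestronglyMeasurable) mK2
      (fun n x => hK.bound₂ _) (fun x => hK.bound₂ _)
      (hae.mono fun x hx => (hK.continuous₂.tendsto _).comp hx)
    have lim_add : ∀ {u v : ℕ → ℝ≥0∞} {c : ℝ≥0∞}, c ≠ ⊤ → Tendsto u atTop (𝓝 0) →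
        Tendsto v atTop (𝓝 0) → Tendsto (fun n => c * (u n + v n)) atTop (𝓝 0) := by
      intro u v c hc hu hv
      have := ENNReal.Tendsto.const_mul (a := c) (hu.add hv) (Or.inr hc)
      simpa using this
    refine tendsto_L2Pair (Lp.tendsto_two_iff.2 ?_) (Lp.tendsto_two_iff.2 ?_)
    · refine tendsto_of_tendsto_of_tendsto_of_le_of_le tendsto_const_nhds
        (lim_add (c := ENNReal.ofReal (2 * C) ^ 2 * 4)
          (ENNReal.mul_ne_top (ENNReal.pow_ne_top ENNReal.ofReal_ne_top) (by simp)) cφ1 cψ1)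
              (fun n => zero_le) fun n => ?_
      have hm : AEMeasurable (fun x => ‖(testPair (φ n)).fst x - U.fst x‖ₑ ^ 2) volume :=
        ((Lp.aestronglyMeasurable _).sub (Lp.aestronglyMeasurable _)).enorm.pow_const 2
      simp only [Function.comp]
      rw [← lintegral_add_left' hm, ← lintegral_const_mul' _ _
        (ENNReal.mul_ne_top (ENNReal.pow_ne_top ENNReal.ofReal_ne_top) (by simp))]
      refine lintegral_mono_ae ?_
      filter_upwards [testPair_fst (φ n), testPair_fst (ψ n), hW1,
        testPair_fst (hK.compTest (φ n) (ψ n))] with x h1 h2 h3 h4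
      rw [h1, h2, h3, h4, compTest_apply]
      have h5 : ‖K (φ n x, ψ n x) - K (U.fst x, V.fst x)‖ₑ
          ≤ ENNReal.ofReal (2 * C) * (‖φ n x - U.fst x‖ₑ + ‖ψ n x - V.fst x‖ₑ) := by
        rw [← ofReal_norm, ← ofReal_norm, ← ofReal_norm, ← ENNReal.ofReal_add (norm_nonneg _)
          (norm_nonneg _), ← ENNReal.ofReal_mul (by positivity)]
        exact ENNReal.ofReal_le_ofReal (hK.abs_sub_le _ _)
      refine (pow_le_pow_left' h5 2).trans ?_
      rw [mul_pow, mul_assoc]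
      gcongr
      exact ENNReal.add_sq_le_four_mul _ _
    · refine tendsto_of_tendsto_of_tendsto_of_le_of_le tendsto_const_nhds
        (lim_add (c := 4) (by simp) cφ2 cψ2) (fun n => zero_le) fun n => ?_
      have hm : AEMeasurable (fun x => ‖K₁ (φ n x, ψ n x) • (testPair (φ n)).snd x
          - K₁ (U.fst x, V.fst x) • U.snd x‖ₑ ^ 2) volume :=
        ((((hK.continuous₁.comp (cont n)).aestronglyMeasurable).smul
          (Lp.aestronglyMeasurable _)).sub
          (mK1.smul (Lp.aestronglyMeasurable _))).enorm.pow_const 2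
      simp only [Function.comp]
      rw [← lintegral_add_left' hm, ← lintegral_const_mul' _ _ (by simp)]
      refine lintegral_mono_ae ?_
      filter_upwards [testPair_snd (φ n), testPair_snd (ψ n), hW2,
        testPair_snd (hK.compTest (φ n) (ψ n))] with x h1 h2 h3 h4
      rw [h1, h2, h3, h4, gradient_compTest, add_sub_add_comm]
      exact (pow_le_pow_left' (enorm_add_le _ _) 2).trans (ENNReal.add_sq_le_four_mul _ _)
  refine ⟨W, ?_, hW1, hW2, fun hpos => ?_⟩
  · rw [mem_H10_iff_mem_closure]
    exact mem_closure_of_tendsto hlim (Eventually.of_forall fun n => ⟨_, rfl⟩)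
  · exact mem_closure_of_tendsto hlim (Eventually.of_forall fun n => ⟨_, fun x => hpos _, rfl⟩)

end IsChainFunction

end TestPairs

/-! ### Smooth cutoffs and their derivative bounds -/

section SmoothCutoffs

/-- Outside `(0, 1)` the function takes its global minimum `0` or maximum `1`. -/
theorem Real.deriv_smoothTransition_eq_zero {x : ℝ} (hx : x ∉ Ioo (0 : ℝ) 1) :
    deriv Real.smoothTransition x = 0 := by
  rw [mem_Ioo, not_and_or, not_lt, not_lt] at hx
  rcases hx with hx | hx
  · refine IsLocalMin.deriv_eq_zero (Eventually.of_forall fun y => ?_)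
    rw [Real.smoothTransition.zero_of_nonpos hx]
    exact Real.smoothTransition.nonneg y
  · refine IsLocalMax.deriv_eq_zero (Eventually.of_forall fun y => ?_)
    rw [Real.smoothTransition.one_of_one_le hx]
    exact Real.smoothTransition.le_one y

theorem Real.contDiff_smoothTransition : ContDiff ℝ ∞ Real.smoothTransition :=
  Real.smoothTransition.contDiff

theorem Real.hasDerivAt_smoothTransition (x : ℝ) :
    HasDerivAt Real.smoothTransition (deriv Real.smoothTransition x) x :=
  ((Real.contDiff_smoothTransition.differentiable (by simp)) x).hasDerivAt

theorem Real.deriv_smoothTransition_nonneg (x : ℝ) : 0 ≤ deriv Real.smoothTransition x :=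
  Real.smoothTransition.monotone.deriv_nonneg

theorem Real.exists_deriv_smoothTransition_le :
    ∃ M, 0 ≤ M ∧ ∀ x, |deriv Real.smoothTransition x| ≤ M := by
  obtain ⟨M, hM⟩ := (isCompact_Icc (a := (0 : ℝ)) (b := 1)).exists_bound_of_continuousOn
    (Real.contDiff_smoothTransition.continuous_deriv (by simp)).continuousOn
  have h0 : 0 ≤ M := (norm_nonneg _).trans (hM 0 (by simp))
  refine ⟨M, h0, fun x => ?_⟩
  by_cases hx : x ∈ Ioo (0 : ℝ) 1
  · exact hM x (Ioo_subset_Icc_self hx)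
  · rw [Real.deriv_smoothTransition_eq_zero hx, abs_zero]
    exact h0

/-- A nonnegative smooth function which equals `s + η` for `s ≥ 0`. -/
def smoothShift (η s : ℝ) : ℝ := (s + η) * Real.smoothTransition (η⁻¹ * s + 1)

theorem contDiff_smoothShift (η : ℝ) : ContDiff ℝ ∞ (smoothShift η) :=
  (contDiff_id.add contDiff_const).mul
    (Real.contDiff_smoothTransition.comp ((contDiff_const.mul contDiff_id).add contDiff_const))

theorem hasDerivAt_smoothShift (η s : ℝ) : HasDerivAt (smoothShift η)
    (Real.smoothTransition (η⁻¹ * s + 1)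
      + (s + η) * (deriv Real.smoothTransition (η⁻¹ * s + 1) * η⁻¹)) s := by
  have h1 : HasDerivAt (fun s : ℝ => η⁻¹ * s + 1) η⁻¹ s := by
    simpa using ((hasDerivAt_id s).const_mul η⁻¹).add_const 1
  have h2 := (Real.hasDerivAt_smoothTransition (η⁻¹ * s + 1)).comp s h1
  have h3 := ((hasDerivAt_id s).add_const η).mul h2
  refine h3.congr_deriv ?_
  simp only [Function.comp, id, one_mul]

theorem smoothShift_nonneg {η : ℝ} (hη : 0 < η) (s : ℝ) : 0 ≤ smoothShift η s := by
  by_cases h : 0 ≤ s + η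
  · exact mul_nonneg h (Real.smoothTransition.nonneg _)
  · rw [smoothShift, Real.smoothTransition.zero_of_nonpos, mul_zero]
    have : η⁻¹ * s + 1 = η⁻¹ * (s + η) := by field_simp
    rw [this]
    exact mul_nonpos_of_nonneg_of_nonpos (by positivity) (not_le.1 h).le

theorem smoothShift_of_nonneg {η : ℝ} (hη : 0 < η) {s : ℝ} (hs : 0 ≤ s) :
    smoothShift η s = s + η := by
  rw [smoothShift, Real.smoothTransition.one_of_one_le, mul_one]
  have : 0 ≤ η⁻¹ * s := by positivity
  linarith

theorem deriv_smoothShift_of_nonneg {η : ℝ} (hη : 0 < η) {s : ℝ} (hs : 0 ≤ s) :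
    deriv (smoothShift η) s = 1 := by
  have : 0 ≤ η⁻¹ * s := by positivity
  rw [(hasDerivAt_smoothShift η s).deriv, Real.smoothTransition.one_of_one_le (by linarith),
    Real.deriv_smoothTransition_eq_zero (by simp [this])]
  simp

theorem exists_deriv_smoothShift_le {η : ℝ} (hη : 0 < η) :
    ∃ M, 0 ≤ M ∧ ∀ s, |deriv (smoothShift η) s| ≤ M := by
  obtain ⟨M, hM0, hM⟩ := Real.exists_deriv_smoothTransition_le
  refine ⟨1 + M, by positivity, fun s => ?_⟩
  rw [(hasDerivAt_smoothShift η s).deriv]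
  refine (abs_add_le _ _).trans (add_le_add ?_ ?_)
  · rw [abs_of_nonneg (Real.smoothTransition.nonneg _)]
    exact Real.smoothTransition.le_one _
  -- The factor `(s + η) η⁻¹` is the argument of the transition, which is at most `1` wherever the
  -- derivative does not vanish.
  · have e : (s + η) * (deriv Real.smoothTransition (η⁻¹ * s + 1) * η⁻¹)
        = (η⁻¹ * s + 1) * deriv Real.smoothTransition (η⁻¹ * s + 1) := by field_simp
    rw [e]
    by_cases hx : η⁻¹ * s + 1 ∈ Ioo (0 : ℝ) 1
    · rw [abs_mul, abs_of_pos hx.1]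
      exact (mul_le_mul hx.2.le (hM _) (abs_nonneg _) zero_le_one).trans (one_mul M).le
    · rw [Real.deriv_smoothTransition_eq_zero hx, mul_zero, abs_zero]
      exact hM0

end SmoothCutoffs

/-! ### The admissible nonlinearities -/

section ChainFunctions

theorem isChainFunction_comp_fst {g : ℝ → ℝ} (hg : ContDiff ℝ ∞ g) (h0 : g 0 = 0) {C : ℝ}
    (hC0 : 0 ≤ C) (hC : ∀ s, |deriv g s| ≤ C) :
    IsChainFunction (fun p => g p.1) (fun p => deriv g p.1) (fun _ => 0) C where
  contDiff := hg.comp contDiff_fst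
  hasFDerivAt p := by
    have h1 := ((hg.differentiable (by simp)) p.1).hasDerivAt.comp_hasFDerivAt p
      (hasFDerivAt_fst (𝕜 := ℝ) (p := p))
    rw [zero_smul, add_zero]
    exact h1
  bound₁ p := hC _
  bound₂ p := by simpa using hC0
  zero _ := h0

/-- Used for comparing two solutions through `g (a - b - η)`. Replacing `b + η` by the nonnegative
`smoothShift η b` changes nothing for `b ≥ 0`, and makes the function vanish at `a = 0` for every
`b`. -/
theorem isChainFunction_sub_shift {g : ℝ → ℝ} (hg : ContDiff ℝ ∞ g) (h0 : ∀ s ≤ 0, g s = 0)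
    {C M η : ℝ} (hη : 0 < η) (hC0 : 0 ≤ C) (hM0 : 0 ≤ M) (hC : ∀ s, |deriv g s| ≤ C)
    (hM : ∀ s, |deriv (smoothShift η) s| ≤ M) :
    IsChainFunction (fun p => g (p.1 - smoothShift η p.2))
      (fun p => deriv g (p.1 - smoothShift η p.2))
      (fun p => -(deriv g (p.1 - smoothShift η p.2) * deriv (smoothShift η) p.2))
      (C * (1 + M)) where
  contDiff := hg.comp (contDiff_fst.sub ((contDiff_smoothShift η).comp contDiff_snd))
  hasFDerivAt p := by
    have h1 := ((contDiff_smoothShift η).differentiable (by simp) p.2).hasDerivAt.comp_hasFDerivAt p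
      (hasFDerivAt_snd (𝕜 := ℝ) (p := p))
    have h2 := (hasFDerivAt_fst (𝕜 := ℝ) (p := p)).sub h1
    have h3 := HasDerivAt.comp_hasFDerivAt p
      ((hg.differentiable (by simp)) (p.1 - smoothShift η p.2)).hasDerivAt h2
    refine h3.congr_fderiv ?_
    ext <;> simp
  bound₁ p := (hC _).trans (by nlinarith)
  bound₂ p := by
    rw [abs_neg, abs_mul]
    exact (mul_le_mul (hC _) (hM _) (abs_nonneg _) hC0).trans (by nlinarith)
  zero b := h0 _ (by simpa using smoothShift_nonneg hη b)

/-- The function `(a, b) ↦ a² / (F(b) + η a²)` where `F = η + smoothShift η`. -/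
theorem isChainFunction_sq_div {M η : ℝ} (hη : 0 < η) (hM0 : 0 ≤ M)
    (hM : ∀ s, |deriv (smoothShift η) s| ≤ M) :
    IsChainFunction (fun p => p.1 ^ 2 / (η + smoothShift η p.2 + η * p.1 ^ 2))
      (fun p => 2 * p.1 * (η + smoothShift η p.2) / (η + smoothShift η p.2 + η * p.1 ^ 2) ^ 2)
      (fun p => -(p.1 ^ 2 * deriv (smoothShift η) p.2)
        / (η + smoothShift η p.2 + η * p.1 ^ 2) ^ 2)
      (1 / η + M / η ^ 2) where
  contDiff := by
    refine (contDiff_fst.pow 2).div ((contDiff_const.add ((contDiff_smoothShift η).comp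
      contDiff_snd)).add (contDiff_const.mul (contDiff_fst.pow 2))) fun p => ?_
    have := smoothShift_nonneg hη p.2
    positivity
  hasFDerivAt p := by
    have hpos : η + smoothShift η p.2 + η * p.1 ^ 2 ≠ 0 := by
      have := smoothShift_nonneg hη p.2
      positivity
    have h1 := ((contDiff_smoothShift η).differentiable (by simp) p.2).hasDerivAt.comp_hasFDerivAt p
      (hasFDerivAt_snd (𝕜 := ℝ) (p := p))
    have h2 := (hasFDerivAt_fst (𝕜 := ℝ) (p := p)).pow 2
    have h3 := (h1.const_add η).add (h2.const_mul η)
    have h4 := h2.mul ((hasDerivAt_inv hpos).comp_hasFDerivAt p h3)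
    have h5 : (fun p : ℝ × ℝ => p.1 ^ 2 / (η + smoothShift η p.2 + η * p.1 ^ 2))
        = fun p => p.1 ^ 2 * (η + smoothShift η p.2 + η * p.1 ^ 2)⁻¹ := by
      ext; rw [div_eq_mul_inv]
    rw [h5]
    refine h4.congr_fderiv ?_
    ext
    · simp
      field_simp
      ring
    · simp
      field_simp
  bound₁ p := by
    have hF : 0 ≤ smoothShift η p.2 := smoothShift_nonneg hη p.2
    set F := smoothShift η p.2
    have hD : 0 < η + F + η * p.1 ^ 2 := by positivity
    have h1 : |2 * p.1 * (η + F) / (η + F + η * p.1 ^ 2) ^ 2| ≤ 1 / η := by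
      rw [abs_div, abs_of_pos (by positivity : 0 < (η + F + η * p.1 ^ 2) ^ 2),
        div_le_div_iff₀ (by positivity) hη, abs_mul, abs_mul, abs_two,
        abs_of_pos (by positivity : 0 < η + F)]
      -- From `2 |a| ≤ 1 + a²`: the term `η a²` in the denominator absorbs the growth of the
      -- numerator, so the partial derivatives stay bounded for unbounded `a`.
      have h2 : 2 * |p.1| * η ≤ η + F + η * p.1 ^ 2 := by
        nlinarith [sq_abs p.1, mul_nonneg hη.le (sq_nonneg (|p.1| - 1))]
      have h3 : η + F ≤ η + F + η * p.1 ^ 2 := by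
        have : 0 ≤ η * p.1 ^ 2 := by positivity
        linarith
      calc 2 * |p.1| * (η + F) * η = (2 * |p.1| * η) * (η + F) := by ring
        _ ≤ (η + F + η * p.1 ^ 2) * (η + F + η * p.1 ^ 2) :=
          mul_le_mul h2 h3 (by positivity) hD.le
        _ = 1 * (η + F + η * p.1 ^ 2) ^ 2 := by ring
    have : 0 ≤ M / η ^ 2 := by positivity
    linarith
  bound₂ p := by
    have hF : 0 ≤ smoothShift η p.2 := smoothShift_nonneg hη p.2
    set F := smoothShift η p.2
    have hD : 0 < η + F + η * p.1 ^ 2 := by positivity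
    have h1 : |-(p.1 ^ 2 * deriv (smoothShift η) p.2) / (η + F + η * p.1 ^ 2) ^ 2|
        ≤ M / η ^ 2 := by
      rw [abs_div, abs_of_pos (by positivity : 0 < (η + F + η * p.1 ^ 2) ^ 2),
        div_le_div_iff₀ (by positivity) (by positivity), abs_neg, abs_mul,
        abs_of_nonneg (sq_nonneg p.1)]
      have h2 : η ^ 2 * p.1 ^ 2 ≤ (η + F + η * p.1 ^ 2) ^ 2 := by
        have h3 : η ≤ η + F + η * p.1 ^ 2 := by
          have : 0 ≤ η * p.1 ^ 2 := by positivity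
          linarith
        have h4 : η * p.1 ^ 2 ≤ η + F + η * p.1 ^ 2 := by linarith
        calc η ^ 2 * p.1 ^ 2 = η * (η * p.1 ^ 2) := by ring
          _ ≤ (η + F + η * p.1 ^ 2) * (η + F + η * p.1 ^ 2) :=
            mul_le_mul h3 h4 (by positivity) hD.le
          _ = _ := by ring
      calc p.1 ^ 2 * |deriv (smoothShift η) p.2| * η ^ 2
          = |deriv (smoothShift η) p.2| * (η ^ 2 * p.1 ^ 2) := by ring
        _ ≤ M * (η + F + η * p.1 ^ 2) ^ 2 :=
          mul_le_mul (hM _) h2 (by positivity) hM0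
    have : 0 ≤ 1 / η := by positivity
    linarith
  zero b := by simp

end ChainFunctions

/-! ### The torsion function and its Hardy inequality -/

section Torsion

variable {N : ℕ} {Ω : Opens (RN N)} {U V W : L2Pair N}

namespace IsTorsionFunction

theorem inner_testPair (hU : IsTorsionFunction Ω U) (φ : 𝓓(Ω, ℝ)) :
    ⟪U.snd, (testPair φ).snd⟫_ℝ = ∫ x, φ x := by
  rw [← hU.2 φ, L2.inner_def]
  refine integral_congr_ae ?_
  filter_upwards [testPair_snd φ] with x hx
  rw [hx]

/-- For nonnegative test functions this is an equality. Fatou's lemma carries it to the closure as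
an inequality, with no prior knowledge that `W` is integrable. -/
theorem lintegral_le_inner (hU : IsTorsionFunction Ω U) (hW : W ∈ H10Nonneg Ω) :
    (∀ᵐ x, 0 ≤ W.fst x) ∧ ∫⁻ x, ENNReal.ofReal (W.fst x) ≤ ENNReal.ofReal ⟪U.snd, W.snd⟫_ℝ := by
  rw [H10Nonneg, mem_closure_iff_seq_limit] at hW
  obtain ⟨u, hu, hlim⟩ := hW
  choose φ hφ0 hφ using hu
  obtain rfl : u = fun n => testPair (φ n) := funext hφ
  obtain ⟨ns, hns, hae⟩ :=
    Lp.exists_subseq_tendsto_ae ((continuous_L2Pair_fst.tendsto W).comp hlim)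
  have hae' : ∀ᵐ x, Tendsto (fun n => φ (ns n) x) atTop (𝓝 (W.fst x)) := by
    have h : ∀ᵐ x, ∀ n, (testPair (φ n)).fst x = φ n x :=
      ae_all_iff.2 fun n => testPair_fst (φ n)
    filter_upwards [hae, h] with x h1 h2
    refine h1.congr fun n => ?_
    exact h2 _
  refine ⟨hae'.mono fun x hx => ge_of_tendsto' hx fun n => hφ0 _ x, ?_⟩
  have h1 : Tendsto (fun n => ENNReal.ofReal ⟪U.snd, (testPair (φ (ns n))).snd⟫_ℝ) atTop
      (𝓝 (ENNReal.ofReal ⟪U.snd, W.snd⟫_ℝ)) := by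
    refine (ENNReal.continuous_ofReal.tendsto _).comp ?_
    exact ((continuous_const.inner continuous_L2Pair_snd).tendsto W).comp
      (hlim.comp hns.tendsto_atTop)
  have h2 : ∀ n, ∫⁻ x, ENNReal.ofReal (φ (ns n) x)
      = ENNReal.ofReal ⟪U.snd, (testPair (φ (ns n))).snd⟫_ℝ := by
    intro n
    rw [hU.inner_testPair, ofReal_integral_eq_lintegral_ofReal
      ((φ (ns n)).continuous.integrable_of_hasCompactSupport (φ (ns n)).hasCompactSupport)
      (Eventually.of_forall (hφ0 _))]
  calc ∫⁻ x, ENNReal.ofReal (W.fst x)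
      = ∫⁻ x, liminf (fun n => ENNReal.ofReal (φ (ns n) x)) atTop := by
        refine lintegral_congr_ae ?_
        filter_upwards [hae'] with x hx
        exact (((ENNReal.continuous_ofReal.tendsto _).comp hx).liminf_eq).symm
    _ ≤ liminf (fun n => ∫⁻ x, ENNReal.ofReal (φ (ns n) x)) atTop :=
        lintegral_liminf_le fun n => ((φ (ns n)).continuous.measurable).ennreal_ofReal
    _ = _ := by
        simp only [h2]
        exact h1.liminf_eq

/-- With `θ` the smooth transition, the test function `W = θ(-u) ≥ 0` gives `∫ W ≤ -∫ θ'(-u) |∇u|² ≤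
0`. So `θ(-u) = 0`, which means `u ≥ 0`. -/
theorem nonneg (hU : IsTorsionFunction Ω U) : ∀ᵐ x, 0 ≤ U.fst x := by
  obtain ⟨M, hM0, hM⟩ := Real.exists_deriv_smoothTransition_le
  have hd : ∀ s, HasDerivAt (fun s => Real.smoothTransition (-s))
      (-deriv Real.smoothTransition (-s)) s := by
    intro s
    exact ((Real.hasDerivAt_smoothTransition (-s)).comp s (hasDerivAt_neg s)).congr_deriv (by simp)
  have hK := isChainFunction_comp_fst (g := fun s => Real.smoothTransition (-s)) (C := M)
    (Real.contDiff_smoothTransition.comp contDiff_neg) (by simp) hM0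
    (fun s => by rw [(hd s).deriv, abs_neg]; exact hM _)
  obtain ⟨W, -, hW1, hW2, hW3⟩ := hK.exists_mem_H10 hU.1 hU.1
  obtain ⟨hW0, hWi⟩ := hU.lintegral_le_inner (hW3 fun p => Real.smoothTransition.nonneg _)
  have hle : ⟪U.snd, W.snd⟫_ℝ ≤ 0 := by
    rw [L2.inner_def]
    refine integral_nonpos_of_ae ?_
    filter_upwards [hW2] with x hx
    rw [hx, (hd _).deriv, zero_smul, add_zero, inner_smul_right, neg_mul]
    exact neg_nonpos.2 (mul_nonneg (Real.deriv_smoothTransition_nonneg _) real_inner_self_nonneg)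
  rw [ENNReal.ofReal_of_nonpos hle, nonpos_iff_eq_zero, lintegral_eq_zero_iff'
    (Lp.aestronglyMeasurable W.fst).aemeasurable.ennreal_ofReal] at hWi
  filter_upwards [hW0, hWi, hW1] with x h0 h1 h2
  have h3 : W.fst x = 0 := le_antisymm (ENNReal.ofReal_eq_zero.1 h1) h0
  rw [h2, Real.smoothTransition.zero_iff_nonpos] at h3
  linarith

/-- The torsion equation is tested with `v² / (F + η v²)`, a bounded substitute for `v²/u`, where `F
= u + 2η`. One `η` in `F` is explicit in the chain function, the other comes from `smoothShift η u =
u + η`. -/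
theorem lintegral_sq_div_add_le (hU : IsTorsionFunction Ω U) (hV : V ∈ H10 Ω) {η : ℝ}
    (hη : 0 < η) :
    ∫⁻ x, ENNReal.ofReal (V.fst x ^ 2 / (U.fst x + η * (2 + V.fst x ^ 2)))
      ≤ ENNReal.ofReal (‖V.snd‖ ^ 2) := by
  obtain ⟨M, hM0, hM⟩ := exists_deriv_smoothShift_le hη
  have hK := isChainFunction_sq_div hη hM0 hM
  obtain ⟨W, -, hW1, hW2, hW3⟩ := hK.exists_mem_H10 hV hU.1
  obtain ⟨-, hWi⟩ := hU.lintegral_le_inner (hW3 fun p => by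
    have := smoothShift_nonneg hη p.2
    positivity)
  have h1 : ∫⁻ x, ENNReal.ofReal (V.fst x ^ 2 / (U.fst x + η * (2 + V.fst x ^ 2)))
      = ∫⁻ x, ENNReal.ofReal (W.fst x) := by
    refine lintegral_congr_ae ?_
    filter_upwards [hW1, hU.nonneg] with x h1 h2
    rw [h1, smoothShift_of_nonneg hη h2]
    congr 2
    ring
  rw [h1]
  refine hWi.trans (ENNReal.ofReal_le_ofReal ?_)
  rw [← real_inner_self_eq_norm_sq, L2.inner_def, L2.inner_def]
  refine integral_mono_ae (L2.integrable_inner _ _) (L2.integrable_inner _ _) ?_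
  filter_upwards [hW2, hU.nonneg] with x h1 h2
  rw [h1, smoothShift_of_nonneg hη h2, deriv_smoothShift_of_nonneg hη h2, inner_add_right,
    inner_smul_right, inner_smul_right]
  set v := V.fst x
  set F := η + (U.fst x + η) with hF
  set p := U.snd x
  set q := V.snd x
  have hFpos : 0 < F := by positivity
  have hD : 0 < F + η * v ^ 2 := by positivity
  -- With `D = F + η v²`, the integrand is `(2 v F p·q - v² |p|²) / D²`. The square bounds the
  -- numerator by `F² |q|² ≤ D² |q|²`.
  have h3 : 0 ≤ ‖F • q - v • p‖ ^ 2 := sq_nonneg _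
  rw [norm_sub_sq_real, norm_smul, norm_smul, inner_smul_left, inner_smul_right,
    real_inner_comm] at h3
  simp only [Real.norm_eq_abs, mul_pow, sq_abs, conj_trivial] at h3
  have h4 : F ^ 2 ≤ (F + η * v ^ 2) ^ 2 := by
    have : 0 ≤ η * v ^ 2 := by positivity
    gcongr
    linarith
  have h5 : F ^ 2 * ‖q‖ ^ 2 ≤ (F + η * v ^ 2) ^ 2 * ‖q‖ ^ 2 := by gcongr
  rw [real_inner_self_eq_norm_sq, real_inner_self_eq_norm_sq, div_mul_eq_mul_div,
    div_mul_eq_mul_div, ← add_div, div_le_iff₀ (by positivity)]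
  linarith

/-- A Hardy type inequality with respect to the torsion function. -/
theorem lintegral_sq_div_le (hU : IsTorsionFunction Ω U) (hV : V ∈ H10 Ω) :
    ∫⁻ x, ‖V.fst x‖ₑ ^ 2 / ENNReal.ofReal (U.fst x) ≤ ‖V.snd‖ₑ ^ 2 := by
  let η : ℕ → ℝ := fun n => 1 / ((n : ℝ) + 1)
  have hη : ∀ n, 0 < η n := fun n => by positivity
  have hη0 : Tendsto η atTop (𝓝 0) := tendsto_one_div_add_atTop_nhds_zero_nat
  have e : ‖V.snd‖ₑ ^ 2 = ENNReal.ofReal (‖V.snd‖ ^ 2) := by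
    rw [← ofReal_norm, ENNReal.ofReal_pow (norm_nonneg _)]
  have mV := (Lp.aestronglyMeasurable V.fst).aemeasurable
  have mU := (Lp.aestronglyMeasurable U.fst).aemeasurable
  calc ∫⁻ x, ‖V.fst x‖ₑ ^ 2 / ENNReal.ofReal (U.fst x)
      = ∫⁻ x, liminf (fun n => ENNReal.ofReal
          (V.fst x ^ 2 / (U.fst x + η n * (2 + V.fst x ^ 2)))) atTop := by
        refine lintegral_congr_ae ?_
        filter_upwards [hU.nonneg] with x hx
        refine (Tendsto.liminf_eq ?_).symm
        have h1 : ∀ n, ENNReal.ofReal (V.fst x ^ 2 / (U.fst x + η n * (2 + V.fst x ^ 2)))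
            = ‖V.fst x‖ₑ ^ 2 / ENNReal.ofReal (U.fst x + η n * (2 + V.fst x ^ 2)) := by
          intro n
          have := hη n
          rw [ENNReal.ofReal_div_of_pos (by positivity), ← ofReal_norm,
            ← ENNReal.ofReal_pow (norm_nonneg _), Real.norm_eq_abs, sq_abs]
        simp only [h1]
        -- The limit is also correct where `u = 0`: in `ℝ≥0∞` the quotient there is `⊤` for `v ≠ 0`
        -- and `0` for `v = 0`.
        refine ENNReal.Tendsto.const_div ?_ (Or.inr (by simp))
        refine (ENNReal.continuous_ofReal.tendsto _).comp ?_
        have := (hη0.mul_const (2 + V.fst x ^ 2)).const_add (U.fst x)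
        simpa using this
    _ ≤ liminf (fun n => ∫⁻ x, ENNReal.ofReal
          (V.fst x ^ 2 / (U.fst x + η n * (2 + V.fst x ^ 2)))) atTop := by
        refine lintegral_liminf_le' fun n => ?_
        fun_prop
    _ ≤ liminf (fun _ : ℕ => ‖V.snd‖ₑ ^ 2) atTop := by
        rw [e]
        exact liminf_le_liminf (Eventually.of_forall fun n =>
          hU.lintegral_sq_div_add_le hV (hη n))
    _ = _ := liminf_const _

/-- The Hardy integral is finite, so `v = 0` a.e. on `{u = 0}`, the only place where dividing by `u`
could not be undone. -/
theorem ae_enorm_sq_eq (hU : IsTorsionFunction Ω U) (hV : V ∈ H10 Ω) :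
    ∀ᵐ x, ‖V.fst x‖ₑ ^ 2
      = ‖V.fst x‖ₑ ^ 2 / ENNReal.ofReal (U.fst x) * ENNReal.ofReal (U.fst x) := by
  have mV := (Lp.aestronglyMeasurable V.fst).aemeasurable
  have mU := (Lp.aestronglyMeasurable U.fst).aemeasurable
  have h : ∀ᵐ x, ‖V.fst x‖ₑ ^ 2 / ENNReal.ofReal (U.fst x) < ⊤ := by
    refine ae_lt_top' (by fun_prop) ((hU.lintegral_sq_div_le hV).trans_lt ?_).ne
    exact ENNReal.pow_lt_top enorm_lt_top
  filter_upwards [h] with x hx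
  by_cases h0 : ENNReal.ofReal (U.fst x) = 0
  · have : ‖V.fst x‖ₑ ^ 2 = 0 := by
      by_contra hne
      rw [h0, ENNReal.div_zero hne] at hx
      exact lt_irrefl _ hx
    rw [this, ENNReal.zero_div, zero_mul]
  · rw [ENNReal.div_mul_cancel h0 ENNReal.ofReal_ne_top]

/-- Replaces the Poincaré inequality, both for the uniqueness of the torsion function and for the
positivity of the eigenvalues. -/
theorem fst_eq_zero_of_snd_eq_zero (hU : IsTorsionFunction Ω U) (hV : V ∈ H10 Ω)
    (h : V.snd = 0) : V.fst = 0 := by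
  have mV := (Lp.aestronglyMeasurable V.fst).aemeasurable
  have mU := (Lp.aestronglyMeasurable U.fst).aemeasurable
  have h1 := hU.lintegral_sq_div_le hV
  rw [h, enorm_zero, zero_pow two_ne_zero, nonpos_iff_eq_zero,
    lintegral_eq_zero_iff' (by fun_prop)] at h1
  rw [Lp.eq_zero_iff_ae_eq_zero]
  filter_upwards [h1, hU.ae_enorm_sq_eq hV] with x h2 h3
  have h2' : ‖V.fst x‖ₑ ^ 2 / ENNReal.ofReal (U.fst x) = 0 := h2
  rw [h2', zero_mul] at h3
  simpa using h3

/-- Since `v² = (v²/u) u`, the Hardy inequality makes the mass of `v²` uniformly small where `u` is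
small, a set that may have infinite measure. -/
theorem setLIntegral_enorm_sq_le (hU : IsTorsionFunction Ω U) (hV : V ∈ H10 Ω) (δ : ℝ) :
    ∫⁻ x in {x | U.fst x < δ}, ‖V.fst x‖ₑ ^ 2 ≤ ENNReal.ofReal δ * ‖V.snd‖ₑ ^ 2 := by
  have hmeas : MeasurableSet {x | U.fst x < δ} :=
    measurableSet_lt (Lp.stronglyMeasurable U.fst).measurable measurable_const
  calc ∫⁻ x in {x | U.fst x < δ}, ‖V.fst x‖ₑ ^ 2
      ≤ ∫⁻ x in {x | U.fst x < δ},
          ENNReal.ofReal δ * (‖V.fst x‖ₑ ^ 2 / ENNReal.ofReal (U.fst x)) := by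
        refine lintegral_mono_ae ?_
        filter_upwards [ae_restrict_of_ae (hU.ae_enorm_sq_eq hV), ae_restrict_mem hmeas]
          with x h1 h2
        refine h1.le.trans ?_
        rw [mul_comm]
        have h2' : U.fst x ≤ δ := le_of_lt h2
        gcongr
    _ ≤ ENNReal.ofReal δ * ∫⁻ x, ‖V.fst x‖ₑ ^ 2 / ENNReal.ofReal (U.fst x) := by
        rw [lintegral_const_mul' _ _ ENNReal.ofReal_ne_top]
        gcongr
        exact Measure.restrict_le_self
    _ ≤ _ := by
        gcongr
        exact hU.lintegral_sq_div_le hV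

/-- Cauchy–Schwarz for `|v| = (v²/u)^{1/2} u^{1/2}`, followed by the Hardy inequality. -/
theorem setLIntegral_enorm_le (hU : IsTorsionFunction Ω U) (hV : V ∈ H10 Ω) (s : Set (RN N)) :
    ∫⁻ x in s, ‖V.fst x‖ₑ
      ≤ ‖V.snd‖ₑ * (∫⁻ x in s, ENNReal.ofReal (U.fst x)) ^ (1 / 2 : ℝ) := by
  have mV := (Lp.aestronglyMeasurable V.fst).aemeasurable
  have mU := (Lp.aestronglyMeasurable U.fst).aemeasurable
  have hsq : ∀ a : ℝ≥0∞, (a ^ (1 / 2 : ℝ)) ^ (2 : ℝ) = a := fun a => by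
    rw [← ENNReal.rpow_mul]; norm_num
  have hsq' : ∀ a : ℝ≥0∞, (a ^ 2) ^ (1 / 2 : ℝ) = a := fun a => by
    rw [← ENNReal.rpow_natCast, ← ENNReal.rpow_mul]; norm_num
  calc ∫⁻ x in s, ‖V.fst x‖ₑ
      = ∫⁻ x in s, ((fun x => (‖V.fst x‖ₑ ^ 2 / ENNReal.ofReal (U.fst x)) ^ (1 / 2 : ℝ))
          * fun x => ENNReal.ofReal (U.fst x) ^ (1 / 2 : ℝ)) x := by
        refine lintegral_congr_ae (ae_restrict_of_ae ?_)
        filter_upwards [hU.ae_enorm_sq_eq hV] with x hx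
        rw [Pi.mul_apply, ← ENNReal.mul_rpow_of_nonneg _ _ (by norm_num), ← hx, hsq']
    _ ≤ (∫⁻ x in s, ((‖V.fst x‖ₑ ^ 2 / ENNReal.ofReal (U.fst x)) ^ (1 / 2 : ℝ)) ^ (2 : ℝ))
          ^ (1 / (2 : ℝ))
        * (∫⁻ x in s, (ENNReal.ofReal (U.fst x) ^ (1 / 2 : ℝ)) ^ (2 : ℝ)) ^ (1 / (2 : ℝ)) :=
        ENNReal.lintegral_mul_le_Lp_mul_Lq _ Real.HolderConjugate.two_two
          (AEMeasurable.restrict (by fun_prop)) (AEMeasurable.restrict (by fun_prop))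
    _ ≤ _ := by
        simp only [hsq]
        gcongr
        conv_rhs => rw [← hsq' ‖V.snd‖ₑ]
        gcongr
        exact (lintegral_mono' Measure.restrict_le_self le_rfl).trans (hU.lintegral_sq_div_le hV)

theorem inner_eq_of_tests {A B : L2Vec N}
    (h : ∀ φ : 𝓓(Ω, ℝ), ⟪A, (testPair φ).snd⟫_ℝ = ⟪B, (testPair φ).snd⟫_ℝ) (hV : V ∈ H10 Ω) :
    ⟪A, V.snd⟫_ℝ = ⟪B, V.snd⟫_ℝ := by
  rw [mem_H10_iff_mem_closure] at hV
  have hc : IsClosed {W : L2Pair N | ⟪A, W.snd⟫_ℝ = ⟪B, W.snd⟫_ℝ} :=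
    isClosed_eq (continuous_const.inner continuous_L2Pair_snd)
      (continuous_const.inner continuous_L2Pair_snd)
  refine closure_minimal (s := range (testPair (Ω := Ω))) ?_ hc hV
  rintro _ ⟨φ, rfl⟩
  exact h φ

theorem unique (hU : IsTorsionFunction Ω U) (hV : IsTorsionFunction Ω V) : U.fst = V.fst := by
  have hD : U - V ∈ H10 Ω := Submodule.sub_mem _ hU.1 hV.1
  have h := inner_eq_of_tests (A := U.snd) (B := V.snd) (Ω := Ω)
    (fun φ => by rw [hU.inner_testPair, hV.inner_testPair]) hD
  have h2 : (U - V).snd = 0 := by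
    rw [← inner_self_eq_zero (𝕜 := ℝ)]
    conv_lhs => rw [WithLp.sub_snd, inner_sub_left]
    rw [WithLp.sub_snd] at h
    exact sub_eq_zero.2 h
  have h3 := hU.fst_eq_zero_of_snd_eq_zero hD h2
  rw [WithLp.sub_fst] at h3
  exact sub_eq_zero.1 h3

/-- By uniqueness the infimum runs over a single value, and `u` vanishes a.e. outside `Ω`. -/
theorem torsionalRigidity_eq (hU : IsTorsionFunction Ω U) :
    torsionalRigidity Ω = ∫⁻ x, ENNReal.ofReal (U.fst x) := by
  have h : ∫⁻ x in (Ω : Set (RN N)), ENNReal.ofReal (U.fst x)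
      = ∫⁻ x, ENNReal.ofReal (U.fst x) := by
    rw [← lintegral_indicator Ω.isOpen.measurableSet]
    refine lintegral_congr_ae ?_
    filter_upwards [H10.fst_mem_L2On hU.1] with x hx
    by_cases hxΩ : x ∈ (Ω : Set (RN N))
    · rw [indicator_of_mem hxΩ]
    · rw [indicator_of_notMem hxΩ, hx hxΩ, ENNReal.ofReal_zero]
  rw [← h]
  refine le_antisymm (iInf₂_le U hU) (le_iInf₂ fun V hV => ?_)
  rw [hU.unique hV]

end IsTorsionFunction

theorem exists_isTorsionFunction (h : torsionalRigidity Ω < ⊤) :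
    ∃ U, IsTorsionFunction Ω U ∧ ∫⁻ x, ENNReal.ofReal (U.fst x) < ⊤ := by
  have h0 := h
  rw [torsionalRigidity, iInf_lt_iff] at h
  obtain ⟨U, hU⟩ := h
  rw [iInf_lt_iff] at hU
  obtain ⟨hU, -⟩ := hU
  refine ⟨U, hU, ?_⟩
  rw [← hU.torsionalRigidity_eq]
  exact h0

end Torsion

/-! ### Weak sequential compactness and compact operators -/

section WeakSequences

variable {H F : Type*} [NormedAddCommGroup H] [InnerProductSpace ℝ H] [CompleteSpace H]
  [SeparableSpace H] [NormedAddCommGroup F] [NormedSpace ℝ F]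

/-- Bounded sequences in a separable Hilbert space have weakly convergent subsequences. -/
theorem exists_subseq_tendsto_inner {M : ℝ} {x : ℕ → H} (hx : ∀ n, ‖x n‖ ≤ M) :
    ∃ a : H, ‖a‖ ≤ M ∧ ∃ ns : ℕ → ℕ, StrictMono ns ∧
      ∀ y, Tendsto (fun n => ⟪x (ns n), y⟫_ℝ) atTop (𝓝 ⟪a, y⟫_ℝ) := by
  have h := WeakDual.isSeqCompact_closedBall ℝ H 0 M
  obtain ⟨ℓ, hℓ, ns, hns, hlim⟩ := h
    (x := fun n => StrongDual.toWeakDual (InnerProductSpace.toDual ℝ H (x n)))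
    (fun n => by
      have h1 : InnerProductSpace.toDual ℝ H (x n) ∈ Metric.closedBall (0 : StrongDual ℝ H) M := by
        rw [mem_closedBall_zero_iff, LinearIsometryEquiv.norm_map]
        exact hx n
      exact h1)
  let ℓ' : StrongDual ℝ H := WeakDual.toStrongDual ℓ
  have hℓ' : ‖ℓ'‖ ≤ M := by
    have : ℓ' ∈ Metric.closedBall (0 : StrongDual ℝ H) M := hℓ
    rwa [mem_closedBall_zero_iff] at this
  refine ⟨(InnerProductSpace.toDual ℝ H).symm ℓ', ?_, ns, hns, fun y => ?_⟩
  · rw [LinearIsometryEquiv.norm_map]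
    exact hℓ'
  · rw [InnerProductSpace.toDual_symm_apply]
    exact ((WeakDual.eval_continuous y).tendsto ℓ).comp hlim

/-- A bounded operator that maps bounded weakly null sequences to null sequences is compact. -/
theorem isCompactOperator_of_tendsto_of_weakly_null (T : H →L[ℝ] F)
    (hT : ∀ (M : ℝ) (x : ℕ → H), (∀ n, ‖x n‖ ≤ M) →
      (∀ y, Tendsto (fun n => ⟪x n, y⟫_ℝ) atTop (𝓝 0)) →
        Tendsto (fun n => T (x n)) atTop (𝓝 0)) : IsCompactOperator T := by
  refine ⟨T '' Metric.closedBall 0 1, ?_, mem_of_superset (Metric.closedBall_mem_nhds 0 one_pos)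
    (subset_preimage_image _ _)⟩
  refine IsSeqCompact.isCompact fun y hy => ?_
  choose x hx hxy using hy
  obtain ⟨a, ha, ns, hns, hlim⟩ := exists_subseq_tendsto_inner
    (x := x) (M := 1) fun n => by simpa using hx n
  refine ⟨T a, ⟨a, by simpa using ha, rfl⟩, ns, hns, ?_⟩
  -- The bound `2` is `1 + 1`, for a point and a weak limit both in the unit ball.
  have h := hT 2 (fun n => x (ns n) - a) (fun n => ?_) (fun z => ?_)
  · have h1 := h.add_const (T a)
    rw [zero_add] at h1
    refine h1.congr fun n => ?_
    rw [map_sub, sub_add_cancel]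
    exact hxy _
  · have h1 := norm_sub_le (x (ns n)) a
    have h2 : ‖x (ns n)‖ ≤ 1 := by simpa using hx (ns n)
    linarith
  · have h1 := (hlim z).sub_const ⟪a, z⟫_ℝ
    rw [sub_self] at h1
    refine h1.congr fun n => ?_
    rw [inner_sub_left]

end WeakSequences

/-! ### Translation estimates in `H¹₀` -/

section Translations

variable {N : ℕ}

theorem ENNReal.sq_lintegral_le {α : Type*} [MeasurableSpace α] (μ : Measure α) {f : α → ℝ≥0∞}
    (hf : AEMeasurable f μ) : (∫⁻ x, f x ∂μ) ^ 2 ≤ μ univ * ∫⁻ x, f x ^ 2 ∂μ := by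
  have h := ENNReal.lintegral_mul_le_Lp_mul_Lq μ Real.HolderConjugate.two_two
    (aemeasurable_const (b := (1 : ℝ≥0∞))) hf
  have hsq : ∀ a : ℝ≥0∞, (a ^ (1 / 2 : ℝ)) ^ 2 = a := fun a => by
    rw [← ENNReal.rpow_natCast, ← ENNReal.rpow_mul]; norm_num
  refine (pow_le_pow_left' (le_trans (le_of_eq ?_) h) 2).trans (le_of_eq ?_)
  · simp
  · rw [mul_pow, hsq, hsq]
    simp

theorem testFunction_enorm_translate_sub_le {Ω : Opens (RN N)} (φ : 𝓓(Ω, ℝ)) (h x : RN N) :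
    ‖φ (x + h) - φ x‖ₑ ≤ ∫⁻ t in Ioc (0 : ℝ) 1, ‖h‖ₑ * ‖∇ (φ : RN N → ℝ) (x + t • h)‖ₑ := by
  have hd : ∀ t : ℝ, HasDerivAt (fun t : ℝ => φ (x + t • h))
      ⟪∇ (φ : RN N → ℝ) (x + t • h), h⟫_ℝ t := by
    intro t
    have h1 : HasDerivAt (fun t : ℝ => x + t • h) h t := by
      simpa using ((hasDerivAt_id t).smul_const h).const_add x
    have h2 := ((φ.contDiff.differentiable (by simp)) (x + t • h)).hasFDerivAt.comp_hasDerivAt t h1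
    rw [gradient, InnerProductSpace.toDual_symm_apply]
    exact h2
  have hc : Continuous fun t : ℝ => ⟪∇ (φ : RN N → ℝ) (x + t • h), h⟫_ℝ :=
    ((testFunction_continuous_gradient φ).comp (by fun_prop)).inner continuous_const
  have hi := intervalIntegral.integral_eq_sub_of_hasDerivAt (a := 0) (b := 1)
    (fun t _ => hd t) (hc.intervalIntegrable 0 1)
  rw [one_smul, zero_smul, add_zero, intervalIntegral.integral_of_le zero_le_one] at hi
  rw [← hi]
  refine (enorm_integral_le_lintegral_enorm _).trans (lintegral_mono fun t => ?_)
  rw [← ofReal_norm, ← ofReal_norm, ← ofReal_norm, ← ENNReal.ofReal_mul (norm_nonneg _), mul_comm]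
  exact ENNReal.ofReal_le_ofReal (norm_inner_le_norm _ _)

/-- The increment is integrated along the segment from `x` to `x + h`; Cauchy–Schwarz on the unit
interval, Tonelli and translation invariance then give the constant `1`. -/
theorem testFunction_lintegral_translate_sub_le {Ω : Opens (RN N)} (φ : 𝓓(Ω, ℝ)) (h : RN N) :
    ∫⁻ x, ‖φ (x + h) - φ x‖ₑ ^ 2 ≤ ‖h‖ₑ ^ 2 * ∫⁻ x, ‖∇ (φ : RN N → ℝ) x‖ₑ ^ 2 := by
  have hc : Continuous fun p : RN N × ℝ => ‖∇ (φ : RN N → ℝ) (p.1 + p.2 • h)‖ₑ ^ 2 :=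
    (ENNReal.continuous_pow 2).comp
      (continuous_enorm.comp ((testFunction_continuous_gradient φ).comp (by fun_prop)))
  have hc' : ∀ x, Continuous fun t : ℝ => ‖∇ (φ : RN N → ℝ) (x + t • h)‖ₑ := fun x =>
    continuous_enorm.comp ((testFunction_continuous_gradient φ).comp (by fun_prop))
  calc ∫⁻ x, ‖φ (x + h) - φ x‖ₑ ^ 2
      ≤ ∫⁻ x, ‖h‖ₑ ^ 2 * ∫⁻ t in Ioc (0 : ℝ) 1, ‖∇ (φ : RN N → ℝ) (x + t • h)‖ₑ ^ 2 := by
        refine lintegral_mono fun x => ?_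
        refine (pow_le_pow_left' (testFunction_enorm_translate_sub_le φ h x) 2).trans ?_
        rw [lintegral_const_mul' _ _ enorm_ne_top, mul_pow]
        gcongr
        refine (ENNReal.sq_lintegral_le _ (hc' x).aemeasurable).trans (le_of_eq ?_)
        simp
    _ = ‖h‖ₑ ^ 2 * ∫⁻ t in Ioc (0 : ℝ) 1, ∫⁻ x, ‖∇ (φ : RN N → ℝ) (x + t • h)‖ₑ ^ 2 := by
        rw [lintegral_const_mul' _ _ (ENNReal.pow_ne_top enorm_ne_top),
          lintegral_lintegral_swap hc.measurable.aemeasurable]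
    _ = _ := by
        congr 1
        have : ∀ t : ℝ, ∫⁻ x, ‖∇ (φ : RN N → ℝ) (x + t • h)‖ₑ ^ 2
            = ∫⁻ x, ‖∇ (φ : RN N → ℝ) x‖ₑ ^ 2 := fun t =>
          lintegral_add_right_eq_self (fun x => ‖∇ (φ : RN N → ℝ) x‖ₑ ^ 2) (t • h)
        simp [this]

/-- Translations are Lipschitz in `L²` on `H¹₀`. -/
theorem H10.lintegral_translate_sub_le {Ω : Opens (RN N)} {U : L2Pair N} (hU : U ∈ H10 Ω)
    (h : RN N) :
    ∫⁻ x, ‖U.fst (x + h) - U.fst x‖ₑ ^ 2 ≤ ‖h‖ₑ ^ 2 * ‖U.snd‖ₑ ^ 2 := by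
  have hτ : MeasurePreserving (fun x : RN N => x + h) volume volume :=
    measurePreserving_add_right volume h
  -- Written with the translation isometry of `L²`, the inequality is a closed condition on the
  -- pair, so it suffices to check test functions.
  have key : ∀ f : L2 N, ∫⁻ x, ‖f (x + h) - f x‖ₑ ^ 2
      = ‖Lp.compMeasurePreserving _ hτ f - f‖ₑ ^ 2 := by
    intro f
    rw [Lp.enorm_sq_eq_lintegral]
    refine lintegral_congr_ae ?_
    filter_upwards [Lp.coeFn_sub (Lp.compMeasurePreserving _ hτ f) f,
      Lp.coeFn_compMeasurePreserving f hτ] with x h1 h2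
    rw [h1, Pi.sub_apply, h2]
    rfl
  rw [key]
  rw [mem_H10_iff_mem_closure] at hU
  have hc : IsClosed {W : L2Pair N |
      ‖Lp.compMeasurePreserving _ hτ W.fst - W.fst‖ₑ ^ 2 ≤ ‖h‖ₑ ^ 2 * ‖W.snd‖ₑ ^ 2} := by
    refine isClosed_le ?_ ?_
    · have h1 : Continuous (Lp.compMeasurePreserving (E := ℝ) (p := 2) _ hτ) :=
        (Lp.isometry_compMeasurePreserving hτ).continuous
      exact (ENNReal.continuous_pow 2).comp (continuous_enorm.comp
        ((h1.comp continuous_L2Pair_fst).sub continuous_L2Pair_fst))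
    · exact (ENNReal.continuous_const_mul (ENNReal.pow_ne_top enorm_ne_top)).comp
        ((ENNReal.continuous_pow 2).comp (continuous_enorm.comp continuous_L2Pair_snd))
  refine closure_minimal (s := range (testPair (Ω := Ω))) ?_ hc hU
  rintro _ ⟨φ, rfl⟩
  change ‖Lp.compMeasurePreserving _ hτ (testPair φ).fst - (testPair φ).fst‖ₑ ^ 2
    ≤ ‖h‖ₑ ^ 2 * ‖(testPair φ).snd‖ₑ ^ 2
  rw [← key, Lp.enorm_sq_eq_lintegral]
  refine le_trans (le_of_eq ?_) ((testFunction_lintegral_translate_sub_le φ h).trans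
    (le_of_eq ?_))
  · refine lintegral_congr_ae ?_
    filter_upwards [testPair_fst φ, hτ.quasiMeasurePreserving.ae (testPair_fst φ)] with x h1 h2
    rw [h1, h2]
  · congr 1
    refine lintegral_congr_ae ?_
    filter_upwards [testPair_snd φ] with x h1
    rw [h1]

end Translations

/-! ### Approximation by averages over small balls -/

section BallAverages

variable {N : ℕ}

/-- The mean value of `f` over the ball of radius `r` about `x`. -/
def ballMean (r : ℝ) (f : RN N → ℝ) (x : RN N) : ℝ :=
  (volume.real (Metric.ball (0 : RN N) r))⁻¹ * ∫ h in Metric.ball (0 : RN N) r, f (x + h)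

theorem volume_ball_real_pos {r : ℝ} (hr : 0 < r) :
    0 < volume.real (Metric.ball (0 : RN N) r) :=
  ENNReal.toReal_pos (Metric.measure_ball_pos _ _ hr).ne' measure_ball_lt_top.ne

theorem integrableOn_ball_translate (f : L2 N) (r : ℝ) (x : RN N) :
    IntegrableOn (fun h => f (x + h)) (Metric.ball (0 : RN N) r) := by
  have h1 : MemLp (fun h => f (x + h)) 2 volume :=
    (Lp.memLp f).comp_measurePreserving (measurePreserving_add_left volume x)
  have : IsFiniteMeasure (volume.restrict (Metric.ball (0 : RN N) r)) :=
    ⟨by simpa using measure_ball_lt_top⟩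
  exact (h1.restrict _).integrable (by norm_num)

/-- As an inner product with a fixed indicator, the mean at each point converges along weakly
convergent sequences and is bounded by the `L²` norm. -/
theorem ballMean_eq_inner (f : L2 N) (r : ℝ) (x : RN N) :
    ballMean r f x = (volume.real (Metric.ball (0 : RN N) r))⁻¹
      * ⟪indicatorConstLp 2 (measurableSet_ball (x := x) (ε := r)) measure_ball_lt_top.ne (1 : ℝ),
          f⟫_ℝ := by
  rw [ballMean, L2.inner_indicatorConstLp_one]
  congr 1
  have h := (measurePreserving_add_left volume x).setIntegral_preimage_emb
    (MeasurableEquiv.addLeft x).measurableEmbedding f (Metric.ball x r)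
  have hb : (fun h : RN N => x + h) ⁻¹' Metric.ball x r = Metric.ball 0 r := by
    ext y
    simp [dist_eq_norm]
  rw [← h]
  change _ = ∫ y in (fun h : RN N => x + h) ⁻¹' Metric.ball x r, f (x + y)
  rw [hb]

theorem abs_ballMean_le (f : L2 N) (r : ℝ) (x : RN N) :
    |ballMean r f x| ≤ (volume.real (Metric.ball (0 : RN N) r))⁻¹
      * (volume.real (Metric.ball (0 : RN N) r) ^ (1 / 2 : ℝ) * ‖f‖) := by
  rw [ballMean_eq_inner, abs_mul, abs_of_nonneg (by positivity)]
  gcongr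
  refine (norm_inner_le_norm (𝕜 := ℝ) _ _).trans (le_of_eq ?_)
  rw [norm_indicatorConstLp (by norm_num) (by norm_num)]
  have : volume.real (Metric.ball x r) = volume.real (Metric.ball (0 : RN N) r) := by
    simp only [Measure.real]
    rw [Measure.addHaar_ball_center]
  simp [this]

theorem stronglyMeasurable_ballMean (f : L2 N) (r : ℝ) : StronglyMeasurable (ballMean r f) := by
  have h : StronglyMeasurable fun p : RN N × RN N => f (p.1 + p.2) :=
    (Lp.stronglyMeasurable f).comp_measurable (measurable_fst.add measurable_snd)
  exact h.integral_prod_right.const_mul _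

/-- `u - ballMean r u` averages the increments over `|h| < r`. Cauchy–Schwarz moves the square
inside the average, and each translation contributes at most `r² ‖∇u‖²`. -/
theorem H10.lintegral_sub_ballMean_le {Ω : Opens (RN N)} {U : L2Pair N} (hU : U ∈ H10 Ω) {r : ℝ}
    (hr : 0 < r) :
    ∫⁻ x, ‖U.fst x - ballMean r U.fst x‖ₑ ^ 2 ≤ ENNReal.ofReal r ^ 2 * ‖U.snd‖ₑ ^ 2 := by
  set B := Metric.ball (0 : RN N) r
  have hv := volume_ball_real_pos (N := N) hr
  have hvtop : volume B ≠ ⊤ := measure_ball_lt_top.ne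
  have hv0 : volume B ≠ 0 := (Metric.measure_ball_pos _ _ hr).ne'
  have hfin : IsFiniteMeasure (volume.restrict B) := ⟨by simpa using hvtop.lt_top⟩
  have hmeas : Measurable fun p : RN N × RN N => ‖U.fst (p.1 + p.2) - U.fst p.1‖ₑ := by
    have h1 : Measurable (U.fst : RN N → ℝ) := (Lp.stronglyMeasurable U.fst).measurable
    exact ((h1.comp (measurable_fst.add measurable_snd)).sub (h1.comp measurable_fst)).enorm
  have hpt : ∀ x, ‖U.fst x - ballMean r U.fst x‖ₑ ^ 2
      ≤ (volume B)⁻¹ * ∫⁻ h in B, ‖U.fst (x + h) - U.fst x‖ₑ ^ 2 := by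
    intro x
    have h1 : U.fst x - ballMean r U.fst x
        = -((volume.real B)⁻¹ * ∫ h in B, (U.fst (x + h) - U.fst x)) := by
      rw [integral_sub (integrableOn_ball_translate _ _ _) (integrable_const _), ballMean,
        setIntegral_const, mul_sub, smul_eq_mul, inv_mul_cancel_left₀ hv.ne']
      ring
    have h2 : ‖(volume.real B)⁻¹‖ₑ = (volume B)⁻¹ := by
      rw [Real.enorm_of_nonneg (by positivity), ENNReal.ofReal_inv_of_pos hv, Measure.real,
        ENNReal.ofReal_toReal hvtop]
    rw [h1, enorm_neg, enorm_mul, h2, mul_pow]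
    calc (volume B)⁻¹ ^ 2 * ‖∫ h in B, (U.fst (x + h) - U.fst x)‖ₑ ^ 2
        ≤ (volume B)⁻¹ ^ 2 * (volume B * ∫⁻ h in B, ‖U.fst (x + h) - U.fst x‖ₑ ^ 2) := by
          gcongr
          refine (pow_le_pow_left' (enorm_integral_le_lintegral_enorm _) 2).trans ?_
          refine (ENNReal.sq_lintegral_le _
            (hmeas.comp (measurable_const.prodMk measurable_id)).aemeasurable).trans ?_
          simp
      _ = _ := by
          rw [sq, ← mul_assoc, mul_assoc (volume B)⁻¹, ENNReal.inv_mul_cancel hv0 hvtop, mul_one]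
  calc ∫⁻ x, ‖U.fst x - ballMean r U.fst x‖ₑ ^ 2
      ≤ ∫⁻ x, (volume B)⁻¹ * ∫⁻ h in B, ‖U.fst (x + h) - U.fst x‖ₑ ^ 2 := lintegral_mono hpt
    _ = (volume B)⁻¹ * ∫⁻ h in B, ∫⁻ x, ‖U.fst (x + h) - U.fst x‖ₑ ^ 2 := by
        rw [lintegral_const_mul' _ _ (ENNReal.inv_ne_top.2 hv0),
          lintegral_lintegral_swap (hmeas.pow_const 2).aemeasurable]
    _ ≤ (volume B)⁻¹ * ∫⁻ _ in B, ENNReal.ofReal r ^ 2 * ‖U.snd‖ₑ ^ 2 := by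
        gcongr (volume B)⁻¹ * ?_
        refine setLIntegral_mono measurable_const fun h hh => ?_
        refine (H10.lintegral_translate_sub_le hU h).trans ?_
        gcongr
        rw [← ofReal_norm]
        exact ENNReal.ofReal_le_ofReal (mem_ball_zero_iff.1 hh).le
    _ = _ := by
        rw [setLIntegral_const, mul_comm _ (volume B), ← mul_assoc,
          ENNReal.inv_mul_cancel hv0 hvtop, one_mul]

end BallAverages

/-! ### Compactness of the embeddings into `L²` and `L¹` -/

section CompactEmbedding

variable {N : ℕ}

theorem ENNReal.tendsto_zero_of_le_add {u c : ℕ → ℝ≥0∞} {a : ℕ → ℕ → ℝ≥0∞}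
    (hc : Tendsto c atTop (𝓝 0)) (ha : ∀ k, Tendsto (a k) atTop (𝓝 0))
    (h : ∀ k n, u n ≤ c k + a k n) : Tendsto u atTop (𝓝 0) := by
  rw [ENNReal.tendsto_nhds_zero] at hc ⊢
  intro ε hε
  obtain ⟨k, hk⟩ := (hc (ε / 2) (ENNReal.half_pos hε.ne')).exists
  filter_upwards [ENNReal.tendsto_nhds_zero.1 (ha k) (ε / 2) (ENNReal.half_pos hε.ne')] with n hn
  exact (h k n).trans ((add_le_add hk hn).trans (ENNReal.add_halves ε).le)

theorem tendsto_ofReal_one_div_add : Tendsto (fun k : ℕ => ENNReal.ofReal (1 / ((k : ℝ) + 1)))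
    atTop (𝓝 0) := by
  have := (ENNReal.continuous_ofReal.tendsto 0).comp
    (tendsto_one_div_add_atTop_nhds_zero_nat (𝕜 := ℝ))
  simpa [Function.comp_def] using this

theorem tendsto_ballMean_of_weakly_null {f : ℕ → L2 N}
    (hf : ∀ g : L2 N, Tendsto (fun n => ⟪f n, g⟫_ℝ) atTop (𝓝 0)) (r : ℝ) (x : RN N) :
    Tendsto (fun n => ballMean r (f n) x) atTop (𝓝 0) := by
  simp only [ballMean_eq_inner]
  have := (hf (indicatorConstLp 2 (measurableSet_ball (x := x) (ε := r))
    measure_ball_lt_top.ne (1 : ℝ))).const_mul (volume.real (Metric.ball (0 : RN N) r))⁻¹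
  rw [mul_zero] at this
  refine this.congr fun n => ?_
  rw [real_inner_comm]

theorem tendsto_setLIntegral_ballMean {f : ℕ → L2 N} {M : ℝ} (hM : ∀ n, ‖f n‖ ≤ M)
    (hf : ∀ g : L2 N, Tendsto (fun n => ⟪f n, g⟫_ℝ) atTop (𝓝 0)) (r : ℝ) {E : Set (RN N)}
    (hE : volume E ≠ ⊤) :
    Tendsto (fun n => ∫⁻ x in E, ‖ballMean r (f n) x‖ₑ ^ 2) atTop (𝓝 0) := by
  set c : ℝ := (volume.real (Metric.ball (0 : RN N) r))⁻¹
    * (volume.real (Metric.ball (0 : RN N) r) ^ (1 / 2 : ℝ) * M)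
  have h := tendsto_lintegral_of_dominated_convergence (μ := volume.restrict E)
    (F := fun n x => ‖ballMean r (f n) x‖ₑ ^ 2) (f := fun _ => 0)
    (fun _ => ENNReal.ofReal c ^ 2) (fun n => ?_) (fun n => ?_) ?_ ?_
  · simpa using h
  · exact (stronglyMeasurable_ballMean (f n) r).measurable.enorm.pow_const 2
  · refine Eventually.of_forall fun x => ?_
    change ‖ballMean r (f n) x‖ₑ ^ 2 ≤ ENNReal.ofReal c ^ 2
    gcongr
    rw [← ofReal_norm]
    refine ENNReal.ofReal_le_ofReal ((abs_ballMean_le (f n) r x).trans ?_)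
    exact mul_le_mul_of_nonneg_left (mul_le_mul_of_nonneg_left (hM n) (by positivity))
      (by positivity)
  · rw [setLIntegral_const]
    exact ENNReal.mul_ne_top (ENNReal.pow_ne_top ENNReal.ofReal_ne_top) hE
  · refine Eventually.of_forall fun x => ?_
    refine ENNReal.tendsto_sq_zero_iff.2 ?_
    have := (tendsto_ballMean_of_weakly_null hf r x).enorm
    simpa using this

theorem norm_fst_le_of_norm_le {V : L2Pair N} {M : ℝ} (h : ‖V‖ ≤ M) : ‖V.fst‖ ≤ M :=
  (WithLp.norm_fst_le ..).trans h

theorem enorm_snd_le_of_norm_le {V : L2Pair N} {M : ℝ} (h : ‖V‖ ≤ M) :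
    ‖V.snd‖ₑ ≤ ENNReal.ofReal M := by
  rw [← ofReal_norm]
  exact ENNReal.ofReal_le_ofReal ((WithLp.norm_snd_le ..).trans h)

/-- Rellich's theorem on sets of finite measure. -/
theorem tendsto_setLIntegral_enorm_sq_of_weakly_null {Ω : Opens (RN N)} {V : ℕ → L2Pair N} {M : ℝ}
    (hV : ∀ n, V n ∈ H10 Ω) (hM : ∀ n, ‖V n‖ ≤ M)
    (hw : ∀ g : L2 N, Tendsto (fun n => ⟪(V n).fst, g⟫_ℝ) atTop (𝓝 0)) {E : Set (RN N)}
    (hE : volume E ≠ ⊤) :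
    Tendsto (fun n => ∫⁻ x in E, ‖(V n).fst x‖ₑ ^ 2) atTop (𝓝 0) := by
  let r : ℕ → ℝ := fun k => 1 / ((k : ℝ) + 1)
  have hr : ∀ k, 0 < r k := fun k => by positivity
  -- The error of averaging at scale `r k` is uniform in `n`; at a fixed scale the averages tend to
  -- `0` pointwise and boundedly, hence in `L²(E)`.
  refine ENNReal.tendsto_zero_of_le_add
    (c := fun k => 4 * (ENNReal.ofReal (r k) ^ 2 * ENNReal.ofReal M ^ 2))
    (a := fun k n => 4 * ∫⁻ x in E, ‖ballMean (r k) (V n).fst x‖ₑ ^ 2) ?_ (fun k => ?_)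
    fun k n => ?_
  · have h1 := ENNReal.tendsto_sq_zero_iff.2 tendsto_ofReal_one_div_add
    have h2 := ENNReal.Tendsto.mul_const (b := ENNReal.ofReal M ^ 2) h1
      (Or.inr (ENNReal.pow_ne_top ENNReal.ofReal_ne_top))
    have h3 := ENNReal.Tendsto.const_mul (a := 4) h2 (Or.inr (by simp))
    rw [zero_mul, mul_zero] at h3
    exact h3
  · have h1 := tendsto_setLIntegral_ballMean (fun n => norm_fst_le_of_norm_le (hM n)) hw (r k) hE
    have h3 := ENNReal.Tendsto.const_mul (a := 4) h1 (Or.inr (by simp))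
    simpa using h3
  · have hm1 : Measurable (ballMean (r k) (V n).fst) :=
      (stronglyMeasurable_ballMean (V n).fst (r k)).measurable
    have hm2 : Measurable ((V n).fst : RN N → ℝ) := (Lp.stronglyMeasurable (V n).fst).measurable
    calc ∫⁻ x in E, ‖(V n).fst x‖ₑ ^ 2
        ≤ ∫⁻ x in E, (4 * ‖(V n).fst x - ballMean (r k) (V n).fst x‖ₑ ^ 2
            + 4 * ‖ballMean (r k) (V n).fst x‖ₑ ^ 2) := by
          refine lintegral_mono fun x => ?_
          rw [← mul_add]
          conv_lhs => rw [← sub_add_cancel ((V n).fst x) (ballMean (r k) (V n).fst x)]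
          exact (pow_le_pow_left' (enorm_add_le _ _) 2).trans (ENNReal.add_sq_le_four_mul _ _)
      _ = 4 * (∫⁻ x in E, ‖(V n).fst x - ballMean (r k) (V n).fst x‖ₑ ^ 2)
            + 4 * ∫⁻ x in E, ‖ballMean (r k) (V n).fst x‖ₑ ^ 2 := by
          rw [lintegral_add_left (by fun_prop), lintegral_const_mul' _ _ (by simp),
            lintegral_const_mul' _ _ (by simp)]
      _ ≤ _ := by
          gcongr
          refine (lintegral_mono' Measure.restrict_le_self le_rfl).trans
            ((H10.lintegral_sub_ballMean_le (hV n) (hr k)).trans ?_)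
          gcongr
          exact enorm_snd_le_of_norm_le (hM n)

variable {Ω : Opens (RN N)} {U : L2Pair N}

namespace IsTorsionFunction

theorem volume_superlevel_lt_top (hfin : ∫⁻ x, ENNReal.ofReal (U.fst x) < ⊤) {δ : ℝ}
    (hδ : 0 < δ) : volume {x | U.fst x < δ}ᶜ < ⊤ := by
  have mU := (Lp.stronglyMeasurable U.fst).measurable.ennreal_ofReal
  have h := meas_ge_le_lintegral_div mU.aemeasurable (μ := volume)
    (ENNReal.ofReal_pos.2 hδ).ne' ENNReal.ofReal_ne_top
  refine (measure_mono fun x hx => ?_).trans_lt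
    (h.trans_lt (ENNReal.div_lt_top hfin.ne (ENNReal.ofReal_pos.2 hδ).ne'))
  exact ENNReal.ofReal_le_ofReal (not_lt.1 hx)

theorem measurableSet_sublevel (U : L2Pair N) (δ : ℝ) : MeasurableSet {x | U.fst x < δ} :=
  measurableSet_lt (Lp.stronglyMeasurable U.fst).measurable measurable_const


/-- The space is split at `u = δ`: the Hardy inequality handles `{u < δ}` uniformly in `n`,
Rellich's theorem the complement, which has finite measure. -/
theorem tendsto_lintegral_enorm_sq (hU : IsTorsionFunction Ω U)
    (hfin : ∫⁻ x, ENNReal.ofReal (U.fst x) < ⊤) {V : ℕ → L2Pair N} {M : ℝ}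
    (hV : ∀ n, V n ∈ H10 Ω) (hM : ∀ n, ‖V n‖ ≤ M)
    (hw : ∀ g : L2 N, Tendsto (fun n => ⟪(V n).fst, g⟫_ℝ) atTop (𝓝 0)) :
    Tendsto (fun n => ∫⁻ x, ‖(V n).fst x‖ₑ ^ 2) atTop (𝓝 0) := by
  let δ : ℕ → ℝ := fun k => 1 / ((k : ℝ) + 1)
  have hδ : ∀ k, 0 < δ k := fun k => by positivity
  refine ENNReal.tendsto_zero_of_le_add
    (c := fun k => ENNReal.ofReal (δ k) * ENNReal.ofReal M ^ 2)
    (a := fun k n => ∫⁻ x in {x | U.fst x < δ k}ᶜ, ‖(V n).fst x‖ₑ ^ 2) ?_ (fun k => ?_)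
    fun k n => ?_
  · have h2 := ENNReal.Tendsto.mul_const (b := ENNReal.ofReal M ^ 2) tendsto_ofReal_one_div_add
      (Or.inr (ENNReal.pow_ne_top ENNReal.ofReal_ne_top))
    rw [zero_mul] at h2
    exact h2
  · exact tendsto_setLIntegral_enorm_sq_of_weakly_null hV hM hw
      (volume_superlevel_lt_top hfin (hδ k)).ne
  · rw [← lintegral_add_compl _ (measurableSet_sublevel U (δ k))]
    gcongr
    refine (hU.setLIntegral_enorm_sq_le (hV n) (δ k)).trans ?_
    gcongr
    exact enorm_snd_le_of_norm_le (hM n)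

theorem tendsto_setLIntegral_sublevel (hfin : ∫⁻ x, ENNReal.ofReal (U.fst x) < ⊤) :
    Tendsto (fun k : ℕ => ∫⁻ x in {x | U.fst x < 1 / ((k : ℝ) + 1)}, ENNReal.ofReal (U.fst x))
      atTop (𝓝 0) := by
  have mU := (Lp.stronglyMeasurable U.fst).measurable.ennreal_ofReal
  have h := tendsto_lintegral_of_dominated_convergence (μ := volume)
    (F := fun (k : ℕ) => indicator {x | U.fst x < 1 / ((k : ℝ) + 1)}
      fun x => ENNReal.ofReal (U.fst x)) (f := fun _ => 0)
    (fun x => ENNReal.ofReal (U.fst x)) (fun n => ?_) (fun n => ?_) hfin.ne ?_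
  · simp only [lintegral_zero] at h
    refine h.congr fun k => ?_
    rw [lintegral_indicator (measurableSet_sublevel U _)]
  · exact mU.indicator (measurableSet_sublevel U _)
  · exact Eventually.of_forall (indicator_le_self _ _)
  · refine Eventually.of_forall fun x => ?_
    refine tendsto_of_tendsto_of_tendsto_of_le_of_le tendsto_const_nhds tendsto_ofReal_one_div_add
      (fun k => zero_le) fun k => ?_
    refine indicator_apply_le' (fun hy => ?_) fun _ => zero_le
    exact ENNReal.ofReal_le_ofReal (le_of_lt hy)

/-- The same splitting in `L¹`: below the level the bound contains `(∫_{u < δ} u)^{1/2}`, which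
tends to `0` with `δ`; above it Cauchy–Schwarz on a set of finite measure reduces to the `L²`
convergence. -/
theorem tendsto_lintegral_enorm (hU : IsTorsionFunction Ω U)
    (hfin : ∫⁻ x, ENNReal.ofReal (U.fst x) < ⊤) {V : ℕ → L2Pair N} {M : ℝ}
    (hV : ∀ n, V n ∈ H10 Ω) (hM : ∀ n, ‖V n‖ ≤ M)
    (hw : ∀ g : L2 N, Tendsto (fun n => ⟪(V n).fst, g⟫_ℝ) atTop (𝓝 0)) :
    Tendsto (fun n => ∫⁻ x, ‖(V n).fst x‖ₑ) atTop (𝓝 0) := by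
  refine ENNReal.tendsto_zero_of_le_add
    (c := fun k => ENNReal.ofReal M * (∫⁻ x in {x | U.fst x < 1 / ((k : ℝ) + 1)},
      ENNReal.ofReal (U.fst x)) ^ (1 / 2 : ℝ))
    (a := fun k n => ∫⁻ x in {x | U.fst x < 1 / ((k : ℝ) + 1)}ᶜ, ‖(V n).fst x‖ₑ) ?_ (fun k => ?_)
    fun k n => ?_
  · have h1 := ((ENNReal.continuous_rpow_const (y := (1 / 2 : ℝ))).tendsto 0).comp
      (tendsto_setLIntegral_sublevel hfin)
    rw [ENNReal.zero_rpow_of_pos (by norm_num)] at h1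
    have h2 := ENNReal.Tendsto.const_mul (a := ENNReal.ofReal M) h1 (Or.inr ENNReal.ofReal_ne_top)
    rw [mul_zero] at h2
    exact h2
  · have hE := volume_superlevel_lt_top hfin (δ := 1 / ((k : ℝ) + 1)) (by positivity)
    rw [← ENNReal.tendsto_sq_zero_iff]
    have h1 := ENNReal.Tendsto.const_mul (hU.tendsto_lintegral_enorm_sq hfin hV hM hw)
      (Or.inr hE.ne)
    rw [mul_zero] at h1
    refine tendsto_of_tendsto_of_tendsto_of_le_of_le tendsto_const_nhds h1 (fun _ => zero_le)
      fun n => ?_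
    refine (ENNReal.sq_lintegral_le _
      (Lp.aestronglyMeasurable _).aemeasurable.enorm.restrict).trans ?_
    rw [Measure.restrict_apply_univ]
    gcongr
    exact Measure.restrict_le_self
  · rw [← lintegral_add_compl _ (measurableSet_sublevel U (1 / ((k : ℝ) + 1)))]
    gcongr
    refine (hU.setLIntegral_enorm_le (hV n) _).trans ?_
    gcongr
    exact enorm_snd_le_of_norm_le (hM n)

end IsTorsionFunction

theorem separableSpace_H10 (Ω : Opens (RN N)) : SeparableSpace (H10 Ω) := by
  have : Fact ((2 : ℝ≥0∞) ≠ ⊤) := ⟨by simp⟩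
  have h1 : SecondCountableTopology (L2 N) := Lp.SecondCountableTopology
  have h2 : SecondCountableTopology (L2Vec N) := Lp.SecondCountableTopology
  have h3 : SecondCountableTopology (L2Pair N) :=
    WithLp.secondCountableTopology 2 (L2 N) (L2Vec N)
  have h4 : SecondCountableTopology (H10 Ω) :=
    TopologicalSpace.Subtype.secondCountableTopology _
  exact SecondCountableTopology.to_separableSpace

theorem weakly_null_fst {x : ℕ → H10 Ω}
    (hx : ∀ y, Tendsto (fun n => ⟪x n, y⟫_ℝ) atTop (𝓝 0)) (g : L2 N) :
    Tendsto (fun n => ⟪(x n).1.fst, g⟫_ℝ) atTop (𝓝 0) := by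
  refine (hx (ContinuousLinearMap.adjoint (H10.toL2 Ω) g)).congr fun n => ?_
  rw [ContinuousLinearMap.adjoint_inner_right]
  rfl

theorem isCompactOperator_toL2 (h : torsionalRigidity Ω < ⊤) :
    IsCompactOperator (H10.toL2 Ω) := by
  obtain ⟨U, hU, hfin⟩ := exists_isTorsionFunction h
  have := separableSpace_H10 Ω
  refine isCompactOperator_of_tendsto_of_weakly_null _ fun M x hM hx => ?_
  rw [Lp.tendsto_two_iff]
  refine (hU.tendsto_lintegral_enorm_sq hfin (V := fun n => (x n).1) (M := M)
    (fun n => (x n).2) hM (weakly_null_fst hx)).congr fun n => lintegral_congr_ae ?_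
  filter_upwards [Lp.coeFn_zero ℝ 2 (volume : Measure (RN N))] with y hy
  rw [hy]
  simp [H10.toL2]

theorem compactlyEmbedded_two (h : torsionalRigidity Ω < ⊤) : CompactlyEmbedded Ω 2 :=
  ⟨H10.toL2 Ω, fun _ => EventuallyEq.rfl, isCompactOperator_toL2 h⟩

theorem isCompactOperator_resolventOp (h : torsionalRigidity Ω < ⊤) :
    IsCompactOperator (resolventOp Ω) :=
  (isCompactOperator_toL2 h).comp_clm _

theorem IsTorsionFunction.memLp_one (hU : IsTorsionFunction Ω U)
    (hfin : ∫⁻ x, ENNReal.ofReal (U.fst x) < ⊤) {V : L2Pair N} (hV : V ∈ H10 Ω) :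
    MemLp V.fst 1 volume := by
  refine ⟨Lp.aestronglyMeasurable _, ?_⟩
  rw [eLpNorm_one_eq_lintegral_enorm, ← setLIntegral_univ]
  refine (hU.setLIntegral_enorm_le hV univ).trans_lt ?_
  rw [setLIntegral_univ]
  exact ENNReal.mul_lt_top enorm_lt_top (ENNReal.rpow_lt_top_of_nonneg (by norm_num) hfin.ne)

theorem compactlyEmbedded_one (h : torsionalRigidity Ω < ⊤) : CompactlyEmbedded Ω 1 := by
  obtain ⟨U, hU, hfin⟩ := exists_isTorsionFunction h
  have := separableSpace_H10 Ω
  let J₀ : H10 Ω →ₗ[ℝ] Lp ℝ 1 (volume : Measure (RN N)) :=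
    { toFun := fun V => (hU.memLp_one hfin V.2).toLp _
      map_add' := fun V W => by
        rw [← MemLp.toLp_add]
        exact MemLp.toLp_congr _ _ (Lp.coeFn_add V.1.fst W.1.fst)
      map_smul' := fun c V => by
        rw [RingHom.id_apply, ← MemLp.toLp_const_smul]
        exact MemLp.toLp_congr _ _ (Lp.coeFn_smul c V.1.fst) }
  have hJ₀ : ∀ V : H10 Ω, ‖J₀ V‖ₑ = ∫⁻ x, ‖V.1.fst x‖ₑ := by
    intro V
    change ‖(hU.memLp_one hfin V.2).toLp _‖ₑ = _
    rw [Lp.enorm_toLp, eLpNorm_one_eq_lintegral_enorm]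
  -- The embedding constant into `L¹` is `P(Ω)^{1/2}`.
  let C : ℝ := ((∫⁻ x, ENNReal.ofReal (U.fst x)) ^ (1 / 2 : ℝ)).toReal
  have hC : ENNReal.ofReal C = (∫⁻ x, ENNReal.ofReal (U.fst x)) ^ (1 / 2 : ℝ) :=
    ENNReal.ofReal_toReal (ENNReal.rpow_lt_top_of_nonneg (by norm_num) hfin.ne).ne
  have hbound : ∀ V, ‖J₀ V‖ ≤ C * ‖V‖ := by
    intro V
    have h1 : ‖J₀ V‖ₑ ≤ ENNReal.ofReal (C * ‖V‖) := by
      rw [hJ₀, ← setLIntegral_univ, ENNReal.ofReal_mul ENNReal.toReal_nonneg, hC, mul_comm]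
      refine (hU.setLIntegral_enorm_le V.2 univ).trans ?_
      rw [setLIntegral_univ]
      gcongr
      exact enorm_snd_le_of_norm_le le_rfl
    rw [← ofReal_norm] at h1
    exact (ENNReal.ofReal_le_ofReal_iff
      (mul_nonneg ENNReal.toReal_nonneg (norm_nonneg _))).1 h1
  refine ⟨J₀.mkContinuous C hbound, fun V => (hU.memLp_one hfin V.2).coeFn_toLp, ?_⟩
  refine isCompactOperator_of_tendsto_of_weakly_null _ fun M x hM hx => ?_
  rw [tendsto_zero_iff_norm_tendsto_zero]
  have h1 := hU.tendsto_lintegral_enorm hfin (V := fun n => (x n).1) (M := M)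
    (fun n => (x n).2) hM (weakly_null_fst hx)
  have h2 := (ENNReal.tendsto_toReal (ENNReal.zero_ne_top)).comp h1
  refine h2.congr fun n => ?_
  simp only [Function.comp]
  rw [← hJ₀, toReal_enorm]
  rfl

end CompactEmbedding

/-! ### The Dirichlet Laplacian and its resolvent on `L²(Ω)` -/

section DirichletSpectrum

variable {N : ℕ} {Ω : Opens (RN N)}

theorem resolventOp_mem_L2On (f : L2 N) : resolventOp Ω f ∈ L2On Ω := by
  obtain ⟨U, hU, h1, -⟩ := (resolventOp_eq_iff Ω f _).1 rfl
  rw [← h1]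
  exact H10.fst_mem_L2On hU

theorem resolventOp_comp_subtypeL_mem (f : L2On Ω) :
    ((resolventOp Ω).comp (L2On Ω).subtypeL) f ∈ L2On Ω := by
  rw [ContinuousLinearMap.comp_apply]
  exact resolventOp_mem_L2On _

/-- The resolvent operator as an operator on `L²(Ω)`. -/
def resolventOn (Ω : Opens (RN N)) : L2On Ω →L[ℝ] L2On Ω :=
  ((resolventOp Ω).comp (L2On Ω).subtypeL).codRestrict (L2On Ω) resolventOp_comp_subtypeL_mem

theorem resolventOn_coe (f : L2On Ω) : (resolventOn Ω f : L2 N) = resolventOp Ω f := rfl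

/-- The weak forms of `-Δu = f` and `-Δu + u = f + u` differ by the same term `⟪u, v⟫` on both
sides. -/
theorem isShiftInverse_resolventOn (Ω : Opens (RN N)) :
    IsShiftInverse (dirichletLaplacian Ω) (resolventOn Ω) := by
  intro u f
  rw [dirichletLaplacian_graph, ← Subtype.coe_inj, resolventOn_coe, resolventOp_eq_iff]
  refine exists_congr fun U => and_congr_right fun hU => and_congr_right fun h1 => ?_
  refine forall₂_congr fun V hV => ?_
  rw [Submodule.coe_add, inner_add_left, ← h1]
  exact add_left_inj _ |>.symm

theorem isSymmetric_resolventOn (Ω : Opens (RN N)) :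
    ((resolventOn Ω : L2On Ω →L[ℝ] L2On Ω) : L2On Ω →ₗ[ℝ] L2On Ω).IsSymmetric := by
  intro f g
  change ⟪(resolventOp Ω f : L2 N), (g : L2 N)⟫_ℝ = ⟪(f : L2 N), resolventOp Ω g⟫_ℝ
  exact (ContinuousLinearMap.adjoint_inner_right (H10.toL2 Ω) _ _).symm.trans
    (ContinuousLinearMap.adjoint_inner_left (H10.toL2 Ω) _ _)

theorem isCompactOperator_resolventOn (h : torsionalRigidity Ω < ⊤) :
    IsCompactOperator (resolventOn Ω) :=
  ((isCompactOperator_resolventOp h).comp_clm (L2On Ω).subtypeL).codRestrict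
    resolventOp_comp_subtypeL_mem (L2On_isClosed Ω)

/-- Testing the eigenvalue equation with `u` gives `‖∇u‖² = z ‖u‖²`, and the Hardy inequality
excludes `∇u = 0`. -/
theorem eigenvalue_pos (h : torsionalRigidity Ω < ⊤) (z : ℝ) (u : L2On Ω) (hu : u ≠ 0)
    (hz : u ∈ opEigenspace (dirichletLaplacian Ω) z) : 0 < z := by
  obtain ⟨T, hT, -⟩ := exists_isTorsionFunction h
  rw [mem_opEigenspace_iff_graph, dirichletLaplacian_graph] at hz
  obtain ⟨U, hU, h1, h2⟩ := hz
  have h1' : U.fst = (u : L2 N) := h1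
  have h3 : ⟪U.snd, U.snd⟫_ℝ = z * ⟪U.fst, U.fst⟫_ℝ := by
    rw [h2 U hU, h1']
    exact inner_smul_left _ _ _
  have h4 : U.fst ≠ 0 := by
    rw [h1']
    simpa using hu
  have h5 : U.snd ≠ 0 := fun h => h4 (hT.fst_eq_zero_of_snd_eq_zero hU h)
  have h6 : 0 < ⟪U.snd, U.snd⟫_ℝ := real_inner_self_pos.2 h5
  have h7 : 0 < ⟪U.fst, U.fst⟫_ℝ := real_inner_self_pos.2 h4
  rw [h3] at h6
  exact (pos_iff_pos_of_mul_pos h6).2 h7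

/-- A ball in `Ω` contains infinitely many disjoint nonempty open sets, whose indicators are
orthogonal. The condition `1 ≤ N` is needed, as `ℝ⁰` is a point. -/
theorem not_finiteDimensional_L2On (hN : 1 ≤ N) (hΩ : (Ω : Set (RN N)).Nonempty) :
    ¬ FiniteDimensional ℝ (L2On Ω) := by
  intro hfd
  have : Nonempty (Fin N) := ⟨⟨0, hN⟩⟩
  obtain ⟨x, hx⟩ := hΩ
  obtain ⟨r, hr, hball⟩ := Metric.isOpen_iff.1 Ω.isOpen x hx
  have hinf : (Metric.ball x r).Infinite := fun hf =>
    (Metric.measure_ball_pos volume x hr).ne' (hf.measure_zero volume)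
  have := hinf.to_subtype
  obtain ⟨A, hA, hAo, hdisj⟩ := exists_seq_infinite_isOpen_pairwise_disjoint (Metric.ball x r)
  let E : ℕ → Set (RN N) := fun n => Subtype.val '' A n
  have hEo : ∀ n, IsOpen (E n) := fun n =>
    Metric.isOpen_ball.isOpenMap_subtype_val _ (hAo n)
  have hEsub : ∀ n, E n ⊆ Metric.ball x r := fun n => Subtype.coe_image_subset _ _
  have hEtop : ∀ n, volume (E n) ≠ ⊤ := fun n =>
    ((measure_mono (hEsub n)).trans_lt measure_ball_lt_top).ne
  have hE0 : ∀ n, volume (E n) ≠ 0 := fun n =>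
    ((hEo n).measure_pos volume ((hA n).nonempty.image _)).ne'
  have hEd : ∀ m n, m ≠ n → E m ∩ E n = ∅ := fun m n hmn =>
    ((disjoint_image_iff Subtype.val_injective).2 (hdisj hmn)).inter_eq
  let v : ℕ → L2On Ω := fun n => ⟨indicatorConstLp 2 (hEo n).measurableSet (hEtop n) (1 : ℝ), by
    filter_upwards [indicatorConstLp_coeFn (p := 2) (hs := (hEo n).measurableSet)
      (hμs := hEtop n) (c := (1 : ℝ))] with y hy hyΩ
    rw [hy, indicator_of_notMem fun h => hyΩ (hball (hEsub n h))]⟩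
  have hinner : ∀ m n, ⟪v m, v n⟫_ℝ = volume.real (E m ∩ E n) := by
    intro m n
    change ⟪indicatorConstLp 2 (hEo m).measurableSet (hEtop m) (1 : ℝ),
      indicatorConstLp 2 (hEo n).measurableSet (hEtop n) (1 : ℝ)⟫_ℝ = _
    rw [L2.inner_indicatorConstLp_one_indicatorConstLp_one _ _ (hEtop m) (hEtop n)]
    simp
  have hli : LinearIndependent ℝ v := by
    refine linearIndependent_of_ne_zero_of_inner_eq_zero (𝕜 := ℝ) (fun n h0 => ?_)
      fun m n hmn => ?_
    · have := hinner n n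
      rw [h0, inner_zero_left, inter_self] at this
      exact (ENNReal.toReal_pos (hE0 n) (hEtop n)).ne this
    · change ⟪v m, v n⟫_ℝ = 0
      rw [hinner, hEd m n hmn, measureReal_empty]
  have := hli.finite
  exact not_finite ℕ

end DirichletSpectrum

/-! ### Monotonicity and `L¹` bounds of the truncated solutions -/

section TruncatedSolutions

variable {N : ℕ} {Ω : Opens (RN N)}

theorem exists_wTrunc (Ω : Opens (RN N)) (R : ℝ) :
    ∃ W ∈ H10 (truncation Ω R), W.fst = wTrunc Ω R ∧ ∀ V ∈ H10 (truncation Ω R),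
      ⟪W.snd, V.snd⟫_ℝ + ⟪W.fst, V.fst⟫_ℝ = ∫ x in (truncation Ω R : Set (RN N)), V.fst x := by
  obtain ⟨W, hW, h1, h2⟩ := (resolventOp_eq_iff (truncation Ω R) _ _).1
    (rfl : resolventOp (truncation Ω R) _ = wTrunc Ω R)
  refine ⟨W, hW, h1, fun V hV => ?_⟩
  rw [h2 V hV, L2.inner_indicatorConstLp_one]

/-- Tested with `V = -θ(-w) ≤ 0`, `θ` the smooth transition, the left side has two nonnegative terms
and the right side is `≤ 0`. So `∫ w V = 0` with `w V ≥ 0`, impossible if `w < 0` on a set of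
positive measure. -/
theorem wTrunc_nonneg (Ω : Opens (RN N)) (R : ℝ) : ∀ᵐ x, 0 ≤ wTrunc Ω R x := by
  obtain ⟨W, hW, hWw, hWeq⟩ := exists_wTrunc Ω R
  rw [← hWw]
  obtain ⟨M, hM0, hM⟩ := Real.exists_deriv_smoothTransition_le
  have hd : ∀ s, HasDerivAt (fun s => -Real.smoothTransition (-s))
      (deriv Real.smoothTransition (-s)) s := by
    intro s
    exact (((Real.hasDerivAt_smoothTransition (-s)).comp s (hasDerivAt_neg s)).neg).congr_deriv
      (by simp)
  have hK := isChainFunction_comp_fst (g := fun s => -Real.smoothTransition (-s)) (C := M)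
    (Real.contDiff_smoothTransition.comp contDiff_neg).neg (by simp) hM0
    (fun s => by rw [(hd s).deriv]; exact hM _)
  obtain ⟨V, hV, hV1, hV2, -⟩ := hK.exists_mem_H10 hW hW
  have heq := hWeq V hV
  have h1 : 0 ≤ ⟪W.snd, V.snd⟫_ℝ := by
    rw [L2.inner_def]
    refine integral_nonneg_of_ae ?_
    filter_upwards [hV2] with x hx
    rw [hx, (hd _).deriv, zero_smul, add_zero, inner_smul_right]
    exact mul_nonneg (Real.deriv_smoothTransition_nonneg _) real_inner_self_nonneg
  have h2 : ∫ x in (truncation Ω R : Set (RN N)), V.fst x ≤ 0 := by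
    refine integral_nonpos_of_ae (ae_restrict_of_ae ?_)
    filter_upwards [hV1] with x hx
    rw [hx]
    exact neg_nonpos.2 (Real.smoothTransition.nonneg _)
  have h3 : ∀ᵐ x, 0 ≤ ⟪W.fst x, V.fst x⟫_ℝ := by
    filter_upwards [hV1] with x hx
    rw [hx]
    change 0 ≤ -Real.smoothTransition (-W.fst x) * W.fst x
    rcases le_total 0 (W.fst x) with h | h
    · rw [Real.smoothTransition.zero_of_nonpos (by linarith)]
      simp
    · exact mul_nonneg_of_nonpos_of_nonpos
        (neg_nonpos.2 (Real.smoothTransition.nonneg _)) h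
  have h4 : ⟪W.fst, V.fst⟫_ℝ = 0 := by
    have : 0 ≤ ⟪W.fst, V.fst⟫_ℝ := by
      rw [L2.inner_def]
      exact integral_nonneg_of_ae h3
    linarith
  rw [L2.inner_def, integral_eq_zero_iff_of_nonneg_ae h3 (L2.integrable_inner _ _)] at h4
  filter_upwards [h4, hV1] with x h5 h6
  by_contra hneg
  rw [not_le] at hneg
  have h5' : ⟪W.fst x, V.fst x⟫_ℝ = 0 := h5
  rw [h6] at h5'
  have h7 : -Real.smoothTransition (-W.fst x) * W.fst x = 0 := h5'
  have h8 := Real.smoothTransition.pos_of_pos (x := -W.fst x) (by linarith)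
  exact (mul_pos_of_neg_of_neg (by linarith) hneg).ne' h7

theorem truncation_mono {R R' : ℝ} (h : R ≤ R') : truncation Ω R ≤ truncation Ω R' :=
  inf_le_inf_left _ fun _ hx => Metric.ball_subset_ball h hx

theorem truncation_le (R : ℝ) : truncation Ω R ≤ Ω := inf_le_left

/-- Weak comparison: both equations are tested with `θ(W - Z - η)`, which is admissible on the
smaller set because it vanishes with `W`. In the difference two nonnegative terms add up to `0`, so
`W - Z ≤ η`; then `η → 0`. -/
theorem wTrunc_mono (Ω : Opens (RN N)) {R R' : ℝ} (hRR : R ≤ R') :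
    ∀ᵐ x, wTrunc Ω R x ≤ wTrunc Ω R' x := by
  obtain ⟨W, hW, hWw, hWeq⟩ := exists_wTrunc Ω R
  obtain ⟨Z, hZ, hZw, hZeq⟩ := exists_wTrunc Ω R'
  have hZ0 := wTrunc_nonneg Ω R'
  rw [← hZw] at hZ0
  rw [← hWw, ← hZw]
  obtain ⟨C, hC0, hC⟩ := Real.exists_deriv_smoothTransition_le
  have key : ∀ η : ℝ, 0 < η → ∀ᵐ x, W.fst x - Z.fst x ≤ η := by
    intro η hη
    obtain ⟨M, hM0, hM⟩ := exists_deriv_smoothShift_le hη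
    have hK := isChainFunction_sub_shift Real.contDiff_smoothTransition
      (fun s hs => Real.smoothTransition.zero_of_nonpos hs) hη hC0 hM0 hC hM
    obtain ⟨V, hV, hV1, hV2, -⟩ := hK.exists_mem_H10 hW hZ
    have e1 := hWeq V hV
    have e2 := hZeq V (H10_mono (truncation_mono hRR) hV)
    -- The right-hand sides agree, as `V` vanishes a.e. outside the smaller set.
    have e3 : ∫ x in (truncation Ω R' : Set (RN N)), V.fst x
        = ∫ x in (truncation Ω R : Set (RN N)), V.fst x := by
      refine setIntegral_eq_of_subset_of_ae_sdiff_eq_zero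
        (truncation Ω R').isOpen.measurableSet.nullMeasurableSet (truncation_mono hRR) ?_
      filter_upwards [H10.fst_mem_L2On hV] with x hx hx'
      exact hx hx'.2
    have h1 : 0 ≤ ⟪W.snd - Z.snd, V.snd⟫_ℝ := by
      rw [L2.inner_def]
      refine integral_nonneg_of_ae ?_
      filter_upwards [hV2, hZ0, Lp.coeFn_sub W.snd Z.snd] with x hx hx0 hx1
      rw [hx, hx1, deriv_smoothShift_of_nonneg hη hx0, mul_one, neg_smul, ← sub_eq_add_neg,
        ← smul_sub, Pi.sub_apply, inner_smul_right]
      exact mul_nonneg (Real.deriv_smoothTransition_nonneg _) real_inner_self_nonneg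
    have h3 : ∀ᵐ x, 0 ≤ ⟪(W.fst - Z.fst : L2 N) x, V.fst x⟫_ℝ := by
      filter_upwards [hV1, hZ0, Lp.coeFn_sub W.fst Z.fst] with x hx hx0 hx1
      rw [hx, hx1, smoothShift_of_nonneg hη hx0, Pi.sub_apply]
      change 0 ≤ Real.smoothTransition (W.fst x - (Z.fst x + η)) * (W.fst x - Z.fst x)
      rcases le_total 0 (W.fst x - Z.fst x) with h | h
      · exact mul_nonneg (Real.smoothTransition.nonneg _) h
      · rw [Real.smoothTransition.zero_of_nonpos (by linarith), zero_mul]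
    have h4 : ⟪W.fst - Z.fst, V.fst⟫_ℝ = 0 := by
      have h5 : 0 ≤ ⟪W.fst - Z.fst, V.fst⟫_ℝ := by
        rw [L2.inner_def]
        exact integral_nonneg_of_ae h3
      rw [inner_sub_left] at h1 h5 ⊢
      linarith
    rw [L2.inner_def, integral_eq_zero_iff_of_nonneg_ae h3 (L2.integrable_inner _ _)] at h4
    filter_upwards [h4, hV1, hZ0, Lp.coeFn_sub W.fst Z.fst] with x h5 hx hx0 hx1
    by_contra hlt
    rw [not_le] at hlt
    have h5' : ⟪(W.fst - Z.fst : L2 N) x, V.fst x⟫_ℝ = 0 := h5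
    rw [hx, hx1, smoothShift_of_nonneg hη hx0, Pi.sub_apply] at h5'
    have h7 : Real.smoothTransition (W.fst x - (Z.fst x + η)) * (W.fst x - Z.fst x) = 0 := h5'
    have h8 := Real.smoothTransition.pos_of_pos (x := W.fst x - (Z.fst x + η)) (by linarith)
    exact (mul_pos h8 (hη.trans hlt)).ne' h7
  have hall : ∀ᵐ x, ∀ n : ℕ, W.fst x - Z.fst x ≤ 1 / ((n : ℝ) + 1) :=
    ae_all_iff.2 fun n => key _ (by positivity)
  filter_upwards [hall] with x hx
  have := ge_of_tendsto' (tendsto_one_div_add_atTop_nhds_zero_nat (𝕜 := ℝ)) hx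
  linarith

/-- Testing the equation with `w` itself gives `‖∇w‖² ≤ ∫ w ≤ ‖∇w‖ P^{1/2}`. Hence `‖∇w‖ ≤ P^{1/2}`,
and a second use of the `L¹` bound gives `P`. -/
theorem IsTorsionFunction.lintegral_wTrunc_le {U : L2Pair N} (hU : IsTorsionFunction Ω U)
    (hfin : ∫⁻ x, ENNReal.ofReal (U.fst x) < ⊤) (R : ℝ) :
    ∫⁻ x, ‖wTrunc Ω R x‖ₑ ≤ ∫⁻ x, ENNReal.ofReal (U.fst x) := by
  obtain ⟨W, hW, hWw, hWeq⟩ := exists_wTrunc Ω R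
  rw [← hWw]
  have hW' : W ∈ H10 Ω := H10_mono (truncation_le R) hW
  set P := ∫⁻ x, ENNReal.ofReal (U.fst x) with hP
  have hPtop : P ^ (1 / 2 : ℝ) ≠ ⊤ := (ENNReal.rpow_lt_top_of_nonneg (by norm_num) hfin.ne).ne
  have h1 : ∫⁻ x, ‖W.fst x‖ₑ ≤ ‖W.snd‖ₑ * P ^ (1 / 2 : ℝ) := by
    have := hU.setLIntegral_enorm_le hW' univ
    rwa [setLIntegral_univ, setLIntegral_univ] at this
  have h2 : ‖W.snd‖ ^ 2 ≤ ‖W.snd‖ * (P ^ (1 / 2 : ℝ)).toReal := by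
    have h3 := hWeq W hW
    rw [real_inner_self_eq_norm_sq, real_inner_self_eq_norm_sq] at h3
    have h4 : ∫ x in (truncation Ω R : Set (RN N)), W.fst x
        ≤ ‖W.snd‖ * (P ^ (1 / 2 : ℝ)).toReal := by
      refine (Real.le_norm_self _).trans ?_
      rw [← toReal_enorm, ← toReal_enorm, ← ENNReal.toReal_mul]
      refine ENNReal.toReal_mono (ENNReal.mul_ne_top enorm_ne_top hPtop) ?_
      refine (enorm_integral_le_lintegral_enorm _).trans (le_trans ?_ h1)
      exact lintegral_mono' Measure.restrict_le_self le_rfl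
    nlinarith [sq_nonneg ‖W.fst‖]
  have h3 : ‖W.snd‖ ≤ (P ^ (1 / 2 : ℝ)).toReal := by
    rcases (norm_nonneg W.snd).eq_or_lt with h | h
    · rw [← h]
      exact ENNReal.toReal_nonneg
    · rw [sq] at h2
      exact le_of_mul_le_mul_left h2 h
  have h4 : ‖W.snd‖ₑ ≤ P ^ (1 / 2 : ℝ) := by
    rw [← ofReal_norm, ← ENNReal.ofReal_toReal hPtop]
    exact ENNReal.ofReal_le_ofReal h3
  refine h1.trans ((mul_le_mul_left h4 _).trans (le_of_eq ?_))
  rw [← ENNReal.rpow_add_of_nonneg _ _ (by norm_num) (by norm_num)]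
  norm_num

theorem exists_isWLimit (h : torsionalRigidity Ω < ⊤) :
    ∃ w : RN N → ℝ, IsWLimit Ω w ∧ Integrable w volume := by
  obtain ⟨U, hU, hfin⟩ := exists_isTorsionFunction h
  have hmono : ∀ᵐ x, Monotone fun n : ℕ => wTrunc Ω n x := by
    have : ∀ᵐ x, ∀ n : ℕ, wTrunc Ω (n : ℝ) x ≤ wTrunc Ω ((n + 1 : ℕ) : ℝ) x :=
      ae_all_iff.2 fun n => wTrunc_mono Ω (by simp)
    filter_upwards [this] with x hx
    exact monotone_nat_of_le_succ hx
  have hnn : ∀ᵐ x, ∀ n : ℕ, 0 ≤ wTrunc Ω (n : ℝ) x := ae_all_iff.2 fun n => wTrunc_nonneg Ω _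
  have hmeas : ∀ n : ℕ, AEMeasurable (fun x => ‖wTrunc Ω (n : ℝ) x‖ₑ) volume := fun n =>
    (Lp.aestronglyMeasurable _).aemeasurable.enorm
  have hsup : ∫⁻ x, ⨆ n : ℕ, ‖wTrunc Ω (n : ℝ) x‖ₑ < ⊤ := by
    rw [lintegral_iSup' hmeas]
    · exact (iSup_le fun n : ℕ => hU.lintegral_wTrunc_le hfin (n : ℝ)).trans_lt hfin
    · filter_upwards [hmono, hnn] with x h1 h2 m n hmn
      change ‖wTrunc Ω (m : ℝ) x‖ₑ ≤ ‖wTrunc Ω (n : ℝ) x‖ₑ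
      rw [Real.enorm_of_nonneg (h2 m), Real.enorm_of_nonneg (h2 n)]
      exact ENNReal.ofReal_le_ofReal (h1 hmn)
  have hbdd : ∀ᵐ x, BddAbove (range fun n : ℕ => wTrunc Ω n x) := by
    filter_upwards [ae_lt_top' (AEMeasurable.iSup hmeas) hsup.ne] with x hx
    refine ⟨(⨆ n : ℕ, ‖wTrunc Ω (n : ℝ) x‖ₑ).toReal, ?_⟩
    rintro _ ⟨n, rfl⟩
    refine (Real.le_norm_self _).trans ?_
    rw [← toReal_enorm]
    exact ENNReal.toReal_mono hx.ne (le_iSup (fun n : ℕ => ‖wTrunc Ω (n : ℝ) x‖ₑ) n)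
  let w : RN N → ℝ := fun x => ⨆ n : ℕ, wTrunc Ω n x
  have hlim : ∀ᵐ x, Tendsto (fun n : ℕ => wTrunc Ω n x) atTop (𝓝 (w x)) := by
    filter_upwards [hmono, hbdd] with x h1 h2
    exact tendsto_atTop_ciSup h1 h2
  refine ⟨w, fun R hR => ?_, ?_, ?_⟩
  -- An arbitrary sequence of radii is squeezed between its integer floors and ceilings, so only
  -- countably many null sets occur.
  · have hlow : ∀ᵐ x, ∀ j, 0 ≤ R j → wTrunc Ω (⌊R j⌋₊ : ℝ) x ≤ wTrunc Ω (R j) x := by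
      refine ae_all_iff.2 fun j => ?_
      by_cases hj : 0 ≤ R j
      · filter_upwards [wTrunc_mono Ω (Nat.floor_le hj)] with x hx _
        exact hx
      · exact Eventually.of_forall fun x hx => absurd hx hj
    have hup : ∀ᵐ x, ∀ j, wTrunc Ω (R j) x ≤ wTrunc Ω (⌈R j⌉₊ : ℝ) x :=
      ae_all_iff.2 fun j => wTrunc_mono Ω (Nat.le_ceil _)
    filter_upwards [hlow, hup, hlim] with x h1 h2 h3
    refine tendsto_of_tendsto_of_tendsto_of_le_of_le'
      (h3.comp (tendsto_nat_floor_atTop.comp hR)) (h3.comp (tendsto_nat_ceil_atTop.comp hR)) ?_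
      (Eventually.of_forall h2)
    filter_upwards [hR.eventually_ge_atTop 0] with j hj
    exact h1 j hj
  · exact aestronglyMeasurable_of_tendsto_ae atTop (fun n : ℕ => Lp.aestronglyMeasurable _) hlim
  · refine lt_of_le_of_lt (lintegral_mono_ae ?_) hsup
    filter_upwards [hlim] with x hx
    refine le_of_tendsto' hx.enorm fun n => ?_
    exact le_iSup (fun n : ℕ => ‖wTrunc Ω (n : ℝ) x‖ₑ) n

end TruncatedSolutions

/-! ### Torsion of balls -/

section Ball

variable {N : ℕ}

/-- The open ball of radius `R` about the origin. -/
def openBall (N : ℕ) (R : ℝ) : Opens (RN N) := ⟨Metric.ball 0 R, Metric.isOpen_ball⟩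

/-- The function `(R² - |x|²) / (2 N)`. -/
def paraboloid (R : ℝ) (x : RN N) : ℝ := (2 * (N : ℝ))⁻¹ * (R ^ 2 - ‖x‖ ^ 2)

theorem paraboloid_pos_iff (hN : 1 ≤ N) {R : ℝ} (hR : 0 < R) {x : RN N} :
    0 < paraboloid R x ↔ x ∈ Metric.ball (0 : RN N) R := by
  have hN' : 0 < (2 * (N : ℝ))⁻¹ := by
    have : (0 : ℝ) < N := by exact_mod_cast hN
    positivity
  rw [paraboloid, mul_pos_iff_of_pos_left hN', mem_ball_zero_iff, sub_pos,
    sq_lt_sq₀ (norm_nonneg _) hR.le]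

theorem contDiff_paraboloid (R : ℝ) : ContDiff ℝ ∞ (paraboloid R : RN N → ℝ) :=
  contDiff_const.mul (contDiff_const.sub (contDiff_norm_sq ℝ))

theorem hasFDerivAt_paraboloid (R : ℝ) (x : RN N) :
    HasFDerivAt (paraboloid R) (-(N : ℝ)⁻¹ • innerSL ℝ x) x := by
  have h := ((hasStrictFDerivAt_norm_sq x).hasFDerivAt.const_sub (R ^ 2)).const_mul
    (2 * (N : ℝ))⁻¹
  refine h.congr_fderiv ?_
  ext v
  simp
  ring

/-- A smooth approximation of the positive part, vanishing for `s ≤ 1 / (n + 1)`. -/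
def smoothPos (n : ℕ) (s : ℝ) : ℝ := s * Real.smoothTransition (((n : ℝ) + 1) * s - 1)

theorem contDiff_smoothPos (n : ℕ) : ContDiff ℝ ∞ (smoothPos n) :=
  contDiff_id.mul (Real.contDiff_smoothTransition.comp
    ((contDiff_const.mul contDiff_id).sub contDiff_const))

theorem hasDerivAt_smoothPos (n : ℕ) (s : ℝ) : HasDerivAt (smoothPos n)
    (Real.smoothTransition (((n : ℝ) + 1) * s - 1)
      + s * (deriv Real.smoothTransition (((n : ℝ) + 1) * s - 1) * ((n : ℝ) + 1))) s := by
  have h1 : HasDerivAt (fun s : ℝ => ((n : ℝ) + 1) * s - 1) ((n : ℝ) + 1) s := by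
    simpa using ((hasDerivAt_id s).const_mul ((n : ℝ) + 1)).sub_const 1
  have h2 := (Real.hasDerivAt_smoothTransition (((n : ℝ) + 1) * s - 1)).comp s h1
  refine ((hasDerivAt_id s).mul h2).congr_deriv ?_
  simp only [Function.comp, id, one_mul]

theorem smoothPos_eq_zero {n : ℕ} {s : ℝ} (hs : s ≤ 1 / ((n : ℝ) + 1)) : smoothPos n s = 0 := by
  have hn : (0 : ℝ) < (n : ℝ) + 1 := by positivity
  rw [le_div_iff₀ hn] at hs
  rw [smoothPos, Real.smoothTransition.zero_of_nonpos (by linarith), mul_zero]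

theorem exists_deriv_smoothPos_le : ∃ M, 0 ≤ M ∧ ∀ n s, |deriv (smoothPos n) s| ≤ M := by
  obtain ⟨M, hM0, hM⟩ := Real.exists_deriv_smoothTransition_le
  -- Uniform in `n`: the derivative of the transition is nonzero only for `1 < (n + 1) s < 2`,
  -- whence the factor `2`.
  refine ⟨1 + 2 * M, by positivity, fun n s => ?_⟩
  rw [(hasDerivAt_smoothPos n s).deriv]
  refine (abs_add_le _ _).trans (add_le_add ?_ ?_)
  · rw [abs_of_nonneg (Real.smoothTransition.nonneg _)]
    exact Real.smoothTransition.le_one _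
  · by_cases hx : ((n : ℝ) + 1) * s - 1 ∈ Ioo (0 : ℝ) 1
    · have e : s * (deriv Real.smoothTransition (((n : ℝ) + 1) * s - 1) * ((n : ℝ) + 1))
          = (((n : ℝ) + 1) * s) * deriv Real.smoothTransition (((n : ℝ) + 1) * s - 1) := by ring
      rw [e, abs_mul, abs_of_pos (by linarith [hx.1])]
      exact mul_le_mul (by linarith [hx.2]) (hM _) (abs_nonneg _) (by norm_num)
    · rw [Real.deriv_smoothTransition_eq_zero hx, zero_mul, mul_zero, abs_zero]
      positivity

theorem deriv_smoothPos_of_nonpos {n : ℕ} {s : ℝ} (hs : s ≤ 0) : deriv (smoothPos n) s = 0 := by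
  have hn : (0 : ℝ) < (n : ℝ) + 1 := by positivity
  have h1 : ((n : ℝ) + 1) * s - 1 ≤ 0 := by nlinarith
  rw [(hasDerivAt_smoothPos n s).deriv, Real.smoothTransition.zero_of_nonpos h1,
    Real.deriv_smoothTransition_eq_zero (fun h => not_lt.2 h1 h.1)]
  ring

theorem eventually_two_le {s : ℝ} (hs : 0 < s) :
    ∀ᶠ n : ℕ in atTop, 1 ≤ ((n : ℝ) + 1) * s - 1 := by
  have h : Tendsto (fun n : ℕ => ((n : ℝ) + 1) * s) atTop atTop :=
    (tendsto_natCast_atTop_atTop.atTop_add tendsto_const_nhds).atTop_mul_const hs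
  filter_upwards [h.eventually_ge_atTop 2] with n hn
  linarith

theorem tendsto_deriv_smoothPos (s : ℝ) :
    Tendsto (fun n => deriv (smoothPos n) s) atTop (𝓝 (indicator (Ioi 0) 1 s)) := by
  rcases lt_or_ge 0 s with hs | hs
  · rw [indicator_of_mem (mem_Ioi.2 hs), Pi.one_apply]
    refine tendsto_const_nhds.congr' ?_
    filter_upwards [eventually_two_le hs] with n hn
    rw [(hasDerivAt_smoothPos n s).deriv, Real.smoothTransition.one_of_one_le hn,
      Real.deriv_smoothTransition_eq_zero (fun h => not_lt.2 hn h.2)]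
    ring
  · rw [indicator_of_notMem (by simpa using hs)]
    simp only [deriv_smoothPos_of_nonpos hs]
    exact tendsto_const_nhds

theorem tendsto_smoothTransition_mul_sub (s : ℝ) :
    Tendsto (fun n : ℕ => Real.smoothTransition (((n : ℝ) + 1) * s - 1)) atTop
      (𝓝 (indicator (Ioi 0) 1 s)) := by
  rcases lt_or_ge 0 s with hs | hs
  · rw [indicator_of_mem (mem_Ioi.2 hs), Pi.one_apply]
    refine tendsto_const_nhds.congr' ?_
    filter_upwards [eventually_two_le hs] with n hn
    rw [Real.smoothTransition.one_of_one_le hn]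
  · rw [indicator_of_notMem (by simpa using hs)]
    refine tendsto_const_nhds.congr fun n => ?_
    have hn : (0 : ℝ) < (n : ℝ) + 1 := by positivity
    rw [Real.smoothTransition.zero_of_nonpos (by nlinarith)]

theorem support_smoothPos_paraboloid_subset (R : ℝ) (n : ℕ) :
    Function.support (fun x : RN N => smoothPos n (paraboloid R x))
      ⊆ {x | 1 / ((n : ℝ) + 1) ≤ paraboloid R x} := by
  intro x hx
  by_contra h
  exact hx (smoothPos_eq_zero (not_le.1 h).le)

theorem closure_subset_superlevel_paraboloid (R : ℝ) (n : ℕ) :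
    tsupport (fun x : RN N => smoothPos n (paraboloid R x))
      ⊆ {x | 1 / ((n : ℝ) + 1) ≤ paraboloid R x} :=
  closure_minimal (support_smoothPos_paraboloid_subset R n)
    (isClosed_le continuous_const (contDiff_paraboloid R).continuous)

theorem superlevel_paraboloid_subset_ball (hN : 1 ≤ N) {R : ℝ} (hR : 0 < R) (n : ℕ) :
    {x : RN N | 1 / ((n : ℝ) + 1) ≤ paraboloid R x} ⊆ Metric.ball 0 R := fun x hx =>
  (paraboloid_pos_iff hN hR).1 (lt_of_lt_of_le (by positivity) hx)

/-- Test functions on the ball which approximate its torsion function. -/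
def ballTest (hN : 1 ≤ N) {R : ℝ} (hR : 0 < R) (n : ℕ) : 𝓓(openBall N R, ℝ) where
  toFun x := smoothPos n (paraboloid R x)
  contDiff' := (contDiff_smoothPos n).comp (contDiff_paraboloid R)
  hasCompactSupport' := (isCompact_closedBall (0 : RN N) R).of_isClosed_subset
    (isClosed_tsupport _) ((closure_subset_superlevel_paraboloid R n).trans
      ((superlevel_paraboloid_subset_ball hN hR n).trans Metric.ball_subset_closedBall))
  tsupport_subset' := (closure_subset_superlevel_paraboloid R n).trans
      (superlevel_paraboloid_subset_ball hN hR n)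

theorem ballTest_apply (hN : 1 ≤ N) {R : ℝ} (hR : 0 < R) (n : ℕ) (x : RN N) :
    ballTest hN hR n x = smoothPos n (paraboloid R x) := rfl

theorem gradient_ballTest (hN : 1 ≤ N) {R : ℝ} (hR : 0 < R) (n : ℕ) (x : RN N) :
    ∇ (ballTest hN hR n : RN N → ℝ) x
      = deriv (smoothPos n) (paraboloid R x) • (-(N : ℝ)⁻¹ • x) := by
  have h := (hasDerivAt_smoothPos n (paraboloid R x)).differentiableAt.hasDerivAt.comp_hasFDerivAt x
    (hasFDerivAt_paraboloid R x)
  change HasFDerivAt (ballTest hN hR n) _ x at h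
  rw [gradient, h.fderiv, map_smul, map_smul]
  congr 2
  rw [LinearIsometryEquiv.symm_apply_eq]
  rfl

/-- The torsion function of the ball of radius `R` about the origin. -/
def ballTorsion (R : ℝ) (x : RN N) : ℝ := max (paraboloid R x) 0

theorem continuous_ballTorsion (R : ℝ) : Continuous (ballTorsion R : RN N → ℝ) :=
  (contDiff_paraboloid R).continuous.max continuous_const

theorem hasCompactSupport_ballTorsion (hN : 1 ≤ N) {R : ℝ} (hR : 0 < R) :
    HasCompactSupport (ballTorsion R : RN N → ℝ) := by
  refine HasCompactSupport.intro (isCompact_closedBall (0 : RN N) R) fun x hx => ?_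
  refine max_eq_right (not_lt.1 fun h => hx ?_)
  exact Metric.ball_subset_closedBall ((paraboloid_pos_iff hN hR).1 h)

theorem memLp_ball_gradient (R : ℝ) :
    MemLp (indicator (Metric.ball (0 : RN N) R) fun x => -(N : ℝ)⁻¹ • x) 2 volume := by
  rw [memLp_indicator_iff_restrict measurableSet_ball]
  have : IsFiniteMeasure (volume.restrict (Metric.ball (0 : RN N) R)) :=
    ⟨by simpa using measure_ball_lt_top⟩
  refine MemLp.of_bound (by fun_prop) (‖-(N : ℝ)⁻¹‖ * R) ?_
  filter_upwards [ae_restrict_mem measurableSet_ball] with x hx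
  rw [norm_smul]
  gcongr
  exact (mem_ball_zero_iff.1 hx).le

/-- Integration by parts in each coordinate; `N` is the divergence of `x`. -/
theorem integral_inner_gradient {Ω : Opens (RN N)} (φ : 𝓓(Ω, ℝ)) :
    ∫ x, ⟪x, ∇ (φ : RN N → ℝ) x⟫_ℝ = -((N : ℝ) * ∫ x, φ x) := by
  have hφ : Continuous fun x => fderiv ℝ φ x := φ.contDiff.continuous_fderiv (by simp)
  have hcs : ∀ i : Fin N, HasCompactSupport fun x => fderiv ℝ φ x (EuclideanSpace.single i 1) :=
    fun i => (φ.hasCompactSupport.fderiv ℝ).comp_left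
      (g := fun L : RN N →L[ℝ] ℝ => L (EuclideanSpace.single i 1)) rfl
  have hci : ∀ i : Fin N, Continuous fun x : RN N => x i := fun i => by fun_prop
  have hxi : ∀ i : Fin N, Integrable
      (fun x : RN N => x i * fderiv ℝ φ x (EuclideanSpace.single i 1)) volume := fun i =>
    ((hci i).mul (hφ.clm_apply continuous_const)).integrable_of_hasCompactSupport
      (hcs i).mul_left
  have hcoord : ∀ i : Fin N,
      ∫ x : RN N, x i * fderiv ℝ φ x (EuclideanSpace.single i 1) = -∫ x, φ x := by
    intro i
    have hd : ∀ x : RN N, HasFDerivAt (fun x : RN N => x i)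
        (EuclideanSpace.proj (𝕜 := ℝ) i : RN N →L[ℝ] ℝ) x := fun x =>
      (EuclideanSpace.proj (𝕜 := ℝ) i : RN N →L[ℝ] ℝ).hasFDerivAt
    have h1 : ∀ x : RN N, fderiv ℝ (fun x : RN N => x i) x (EuclideanSpace.single i 1) = 1 := by
      intro x
      rw [(hd x).fderiv]
      simp
    rw [integral_mul_fderiv_eq_neg_fderiv_mul_of_integrable (f := fun x : RN N => x i)
      (g := φ) ?_ (hxi i) ?_ (fun x _ => (hd x).differentiableAt)
      (fun x _ => (φ.contDiff.differentiable (by simp)) x)]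
    · simp only [h1, one_mul]
    · simp only [h1, one_mul]
      exact φ.continuous.integrable_of_hasCompactSupport φ.hasCompactSupport
    · exact ((hci i).mul φ.continuous).integrable_of_hasCompactSupport
        φ.hasCompactSupport.mul_left
  have hclm : ∀ (L : RN N →L[ℝ] ℝ) (x : RN N),
      L x = ∑ i, x i * L (EuclideanSpace.single i 1) := by
    intro L x
    conv_lhs => rw [← (EuclideanSpace.basisFun (Fin N) ℝ).sum_repr x]
    simp
  have hsum : ∀ x : RN N, ⟪x, ∇ (φ : RN N → ℝ) x⟫_ℝ
      = ∑ i, x i * fderiv ℝ φ x (EuclideanSpace.single i 1) := by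
    intro x
    rw [real_inner_comm, gradient, InnerProductSpace.toDual_symm_apply]
    exact hclm _ x
  simp only [hsum]
  rw [integral_finsetSum _ fun i _ => hxi i]
  simp [hcoord]

/-- The equation is the divergence identity for `-x/N`. Membership in `H¹₀` comes from the test
functions `smoothPos n ∘ paraboloid`, whose values and gradients are bounded multipliers of those of
the paraboloid, converging to the indicator of the ball. -/
theorem exists_isTorsionFunction_ball (hN : 1 ≤ N) {R : ℝ} (hR : 0 < R) :
    ∃ U : L2Pair N, IsTorsionFunction (openBall N R) U ∧ U.fst =ᵐ[volume] ballTorsion R := by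
  have m1 : MemLp (ballTorsion R : RN N → ℝ) 2 volume :=
    (continuous_ballTorsion R).memLp_of_hasCompactSupport (hasCompactSupport_ballTorsion hN hR)
  have m2 := memLp_ball_gradient (N := N) R
  let U : L2Pair N := WithLp.toLp 2 (m1.toLp _, m2.toLp _)
  have hU1 : U.fst =ᵐ[volume] ballTorsion R := m1.coeFn_toLp
  have hU2 : U.snd =ᵐ[volume] indicator (Metric.ball (0 : RN N) R) fun x => -(N : ℝ)⁻¹ • x :=
    m2.coeFn_toLp
  have hN0 : (N : ℝ) ≠ 0 := by
    have : N ≠ 0 := by omega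
    exact_mod_cast this
  obtain ⟨M, hM0, hM⟩ := exists_deriv_smoothPos_le
  have hind : ∀ s : ℝ, |indicator (Ioi (0 : ℝ)) (1 : ℝ → ℝ) s| ≤ 1 := by
    intro s
    by_cases h : s ∈ Ioi (0 : ℝ)
    · rw [indicator_of_mem h, Pi.one_apply, abs_one]
    · rw [indicator_of_notMem h, abs_zero]; exact zero_le_one
  have hq : Continuous (paraboloid R : RN N → ℝ) := (contDiff_paraboloid R).continuous
  have hm₀ : AEStronglyMeasurable
      (fun x : RN N => indicator (Ioi (0 : ℝ)) (1 : ℝ → ℝ) (paraboloid R x)) volume :=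
    ((measurable_one.indicator measurableSet_Ioi).comp hq.measurable).aestronglyMeasurable
  have hlim : Tendsto (fun n => testPair (ballTest hN hR n)) atTop (𝓝 U) := by
    refine tendsto_L2Pair (Lp.tendsto_two_iff.2 ?_) (Lp.tendsto_two_iff.2 ?_)
    · have h := tendsto_lintegral_smul_sub_smul (F := fun _ => U.fst) (f := U.fst)
        tendsto_const_nhds
        (m := fun n x => Real.smoothTransition (((n : ℝ) + 1) * paraboloid R x - 1))
        (m₀ := fun x => indicator (Ioi (0 : ℝ)) (1 : ℝ → ℝ) (paraboloid R x)) (C := 1)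
        (fun n => (Real.smoothTransition.continuous.comp
          ((continuous_const.mul hq).sub continuous_const)).aestronglyMeasurable) hm₀
        (fun n x => by
          rw [abs_of_nonneg (Real.smoothTransition.nonneg _)]
          exact Real.smoothTransition.le_one _)
        (fun x => hind _)
        (Eventually.of_forall fun x => tendsto_smoothTransition_mul_sub _)
      refine h.congr fun n => lintegral_congr_ae ?_
      filter_upwards [hU1, testPair_fst (ballTest hN hR n)] with x h1 h2
      rw [h1, h2, ballTest_apply, ballTorsion, smoothPos]
      rcases lt_or_ge 0 (paraboloid R x) with hs | hs
      · rw [max_eq_left hs.le, indicator_of_mem (mem_Ioi.2 hs), Pi.one_apply, one_smul,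
          smul_eq_mul, mul_comm]
      · have hn : (0 : ℝ) < (n : ℝ) + 1 := by positivity
        rw [max_eq_right hs, Real.smoothTransition.zero_of_nonpos (by nlinarith)]
        simp
    · have h := tendsto_lintegral_smul_sub_smul (F := fun _ => U.snd) (f := U.snd)
        tendsto_const_nhds
        (m := fun n x => deriv (smoothPos n) (paraboloid R x))
        (m₀ := fun x => indicator (Ioi (0 : ℝ)) (1 : ℝ → ℝ) (paraboloid R x)) (C := 1 + M)
        (fun n => (((contDiff_smoothPos n).continuous_deriv (by simp)).comp
          hq).aestronglyMeasurable) hm₀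
        (fun n x => (hM n _).trans (by linarith)) (fun x => (hind _).trans (by linarith))
        (Eventually.of_forall fun x => tendsto_deriv_smoothPos _)
      refine h.congr fun n => lintegral_congr_ae ?_
      filter_upwards [hU2, testPair_snd (ballTest hN hR n)] with x h1 h2
      rw [h1, h2, gradient_ballTest]
      by_cases hx : x ∈ Metric.ball (0 : RN N) R
      · have hs := (paraboloid_pos_iff hN hR).2 hx
        rw [indicator_of_mem hx, indicator_of_mem (mem_Ioi.2 hs), Pi.one_apply, one_smul]
      · have hs : paraboloid R x ≤ 0 := not_lt.1 fun h => hx ((paraboloid_pos_iff hN hR).1 h)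
        rw [indicator_of_notMem hx, deriv_smoothPos_of_nonpos hs]
        simp
  refine ⟨U, ⟨?_, fun φ => ?_⟩, hU1⟩
  · rw [mem_H10_iff_mem_closure]
    exact mem_closure_of_tendsto hlim (Eventually.of_forall fun n => ⟨_, rfl⟩)
  · have h1 : ∫ x, ⟪U.snd x, ∇ (φ : RN N → ℝ) x⟫_ℝ
        = ∫ x, -(N : ℝ)⁻¹ * ⟪x, ∇ (φ : RN N → ℝ) x⟫_ℝ := by
      refine integral_congr_ae ?_
      filter_upwards [hU2] with x hx
      rw [hx]
      by_cases hxb : x ∈ Metric.ball (0 : RN N) R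
      · rw [indicator_of_mem hxb, inner_smul_left]
        rfl
      · have hg : ∇ (φ : RN N → ℝ) x = 0 := by
          have hx' : x ∉ tsupport φ := fun h => hxb (φ.tsupport_subset h)
          rw [gradient, fderiv_of_notMem_tsupport ℝ hx', map_zero]
        rw [hg, inner_zero_right, inner_zero_right, mul_zero]
    rw [h1, integral_const_mul, integral_inner_gradient]
    field_simp

theorem ballTorsion_smul {R : ℝ} (hR : 0 < R) (x : RN N) :
    ballTorsion R (R • x) = R ^ 2 * ballTorsion 1 x := by
  rw [ballTorsion, ballTorsion, mul_max_of_nonneg _ _ (sq_nonneg R), mul_zero, paraboloid,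
    paraboloid, norm_smul, Real.norm_of_nonneg hR.le]
  congr 1
  ring

/-- Dilation contributes `R^N` from the volume and `R²` from the quadratic profile. -/
theorem integral_ballTorsion {R : ℝ} (hR : 0 < R) :
    ∫ x : RN N, ballTorsion R x = R ^ (N + 2) * ∫ x : RN N, ballTorsion 1 x := by
  have h := Measure.integral_comp_smul (volume : Measure (RN N)) (ballTorsion R) R
  simp only [ballTorsion_smul hR, integral_const_mul, finrank_euclideanSpace_fin] at h
  rw [abs_of_pos (by positivity), smul_eq_mul, eq_inv_mul_iff_mul_eq₀ (by positivity)] at h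
  rw [← h]
  ring

theorem torsionalRigidity_ball (hN : 1 ≤ N) {R : ℝ} (hR : 0 < R) :
    torsionalRigidity (openBall N R)
      = ENNReal.ofReal (R ^ (N + 2) * ∫ x : RN N, ballTorsion 1 x) := by
  obtain ⟨U, hU, hU1⟩ := exists_isTorsionFunction_ball hN hR
  rw [hU.torsionalRigidity_eq, ← integral_ballTorsion hR, ofReal_integral_eq_lintegral_ofReal
    ((continuous_ballTorsion R).integrable_of_hasCompactSupport
      (hasCompactSupport_ballTorsion hN hR)) (Eventually.of_forall fun x => le_max_right _ _)]
  refine lintegral_congr_ae ?_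
  filter_upwards [hU1] with x hx
  rw [hx]

theorem integral_ballTorsion_pos (hN : 1 ≤ N) : 0 < ∫ x : RN N, ballTorsion 1 x := by
  refine (continuous_ballTorsion 1).integral_pos_of_hasCompactSupport_nonneg_nonzero
    (hasCompactSupport_ballTorsion hN one_pos) (fun x => le_max_right _ _) (x := 0) ?_
  exact (lt_max_of_lt_left ((paraboloid_pos_iff hN one_pos).2 (by simp))).ne'

theorem exists_torsionalRigidity_eq (hN : 1 ≤ N) {c : ℝ} (hc : 0 < c) :
    ∃ Ω : Opens (RN N), torsionalRigidity Ω = ENNReal.ofReal c := by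
  have hI := integral_ballTorsion_pos hN
  set I := ∫ x : RN N, ballTorsion 1 x with hIdef
  refine ⟨openBall N ((c / I) ^ (((N + 2 : ℕ) : ℝ)⁻¹)), ?_⟩
  rw [torsionalRigidity_ball hN (by positivity), ← hIdef,
    Real.rpow_inv_natCast_pow (by positivity) (by omega), div_mul_cancel₀ _ hI.ne']

end Ball

/-! ### Eigenvalues of sets with finite torsional rigidity -/

section Main

variable {N : ℕ} {Ω : Opens (RN N)}

theorem nonempty_of_torsionalRigidity_pos (h0 : torsionalRigidity Ω ≠ 0)
    (h : torsionalRigidity Ω < ⊤) : (Ω : Set (RN N)).Nonempty := by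
  obtain ⟨U, hU, -⟩ := exists_isTorsionFunction h
  by_contra hne
  rw [not_nonempty_iff_eq_empty] at hne
  refine h0 (le_antisymm ((iInf₂_le U hU).trans ?_) zero_le)
  rw [hne, Measure.restrict_empty, lintegral_zero_measure]

theorem exists_dirichletEigenvalue_basis (hN : 1 ≤ N) (h : torsionalRigidity Ω < ⊤)
    (hΩ : (Ω : Set (RN N)).Nonempty) :
    Monotone (fun n : ℕ => dirichletEigenvalue (n + 1) Ω) ∧
      Tendsto (fun n : ℕ => dirichletEigenvalue (n + 1) Ω) atTop atTop ∧
      (∀ n : ℕ, 0 < dirichletEigenvalue (n + 1) Ω) ∧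
      opSpectrum (dirichletLaplacian Ω) = range (fun n : ℕ => dirichletEigenvalue (n + 1) Ω) ∧
      (∃ e : HilbertBasis ℕ ℝ (L2On Ω),
        ∀ n : ℕ, e n ∈ opEigenspace (dirichletLaplacian Ω) (dirichletEigenvalue (n + 1) Ω)) ∧
      ∀ n : ℕ, IsLeast (eigenvalueBounds (dirichletLaplacian Ω) (n + 1))
        (dirichletEigenvalue (n + 1) Ω) := by
  obtain ⟨lam, e, h1, h2, h3, h4, h5, h6⟩ :=
    (isShiftInverse_resolventOn Ω).exists_eigenvalue_sequence (isSymmetric_resolventOn Ω)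
      (isCompactOperator_resolventOn h) (eigenvalue_pos h) (not_finiteDimensional_L2On hN hΩ)
  have hlam : (fun n : ℕ => dirichletEigenvalue (n + 1) Ω) = lam := by
    ext n
    rw [dirichletEigenvalue, h6, csInf_Ici]
  have hlam' : ∀ n : ℕ, dirichletEigenvalue (n + 1) Ω = lam n := congrFun hlam
  simp only [hlam']
  exact ⟨h1, h2, h3, h5, ⟨e, h4⟩, fun n => by rw [h6]; exact isLeast_Ici⟩

end Main

end

theorem mainTheorem6 (N : ℕ) (hN : 1 ≤ N) :
    (∀ Ω : Opens (RN N), torsionalRigidity Ω < ⊤ →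
      (∃ w : RN N → ℝ, IsWLimit Ω w ∧ Integrable w volume) ∧
      CompactlyEmbedded Ω 1 ∧
      CompactlyEmbedded Ω 2 ∧
      IsCompactOperator (resolventOp Ω) ∧
      HasCompactResolvent (dirichletLaplacian Ω) ∧
      HasDiscreteSpectrum (dirichletLaplacian Ω) ∧
      ((Ω : Set (RN N)).Nonempty →
        0 < dirichletEigenvalue 1 Ω ∧
        Monotone (fun n : ℕ => dirichletEigenvalue (n + 1) Ω) ∧
        Tendsto (fun n : ℕ => dirichletEigenvalue (n + 1) Ω) atTop atTop ∧
        opSpectrum (dirichletLaplacian Ω) = range (fun n : ℕ => dirichletEigenvalue (n + 1) Ω) ∧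
        ∃ e : HilbertBasis ℕ ℝ (L2On Ω),
          ∀ n : ℕ, e n ∈ opEigenspace (dirichletLaplacian Ω) (dirichletEigenvalue (n + 1) Ω))) ∧
    (∀ k : ℕ, 1 ≤ k → ∀ c : ℝ, 0 < c →
      (∃ Ω : Opens (RN N), torsionalRigidity Ω = ENNReal.ofReal c) ∧
      ∀ Ω : Opens (RN N), torsionalRigidity Ω = ENNReal.ofReal c →
        IsLeast (eigenvalueBounds (dirichletLaplacian Ω) k) (dirichletEigenvalue k Ω) ∧
        0 < dirichletEigenvalue k Ω) := by
  refine ⟨fun Ω h => ⟨exists_isWLimit h, compactlyEmbedded_one h, compactlyEmbedded_two h,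
    isCompactOperator_resolventOp h,
    (isShiftInverse_resolventOn Ω).hasCompactResolvent (isCompactOperator_resolventOn h),
    (isShiftInverse_resolventOn Ω).hasDiscreteSpectrum (isSymmetric_resolventOn Ω)
      (isCompactOperator_resolventOn h) (eigenvalue_pos h), fun hΩ => ?_⟩,
    fun k hk c hc => ⟨exists_torsionalRigidity_eq hN hc, fun Ω hΩ => ?_⟩⟩
  · obtain ⟨h1, h2, h3, h4, h5, -⟩ := exists_dirichletEigenvalue_basis hN h hΩ
    exact ⟨h3 0, h1, h2, h4, h5⟩
  · have hlt : torsionalRigidity Ω < ⊤ := by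
      rw [hΩ]
      exact ENNReal.ofReal_lt_top
    -- The empty set has rigidity `0`, so `c > 0` excludes it.
    have hne : (Ω : Set (RN N)).Nonempty :=
      nonempty_of_torsionalRigidity_pos (by rw [hΩ]; exact (ENNReal.ofReal_pos.2 hc).ne') hlt
    obtain ⟨-, -, h3, -, -, h6⟩ := exists_dirichletEigenvalue_basis hN hlt hne
    obtain ⟨n, rfl⟩ : ∃ n, k = n + 1 := ⟨k - 1, by omega⟩
    exact ⟨h6 n, h3 n⟩
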